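/- Let $g\ge 0$, let $b_0<a_1<b_1<\dots<a_g<b_g<a_0$ be real numbers and put $E=[b_0,a_0]\setminus\bigcup_{j=1}^g(a_j,b_j)$, $E_k=E\cap[b_0,a_k]$ for $k=1,\dots,g$. The gaps are the intervals $(a_j,b_j)$, $j=1,\dots,g$, and the arc $(a_0,b_0)$ of $\mathbb R\cup\{\infty\}$ that runs from $a_0$ through $\infty$ to $b_0$. Let $\omega(\cdot,E_k)$ be the harmonic measure of $E_k$ in the domain $\overline{\mathbb C}\setminus E$ (extended by its boundary values $1$ on $E_k$ and $0$ on $E\setminus E_k$). For $\beta\in(\mathbb R/\mathbb Z)^g$ and $z\in\mathbb C_+$ consider the problem of finding $\mathfrak X=(x_0,\dots,x_g)$ with $x_j\in[a_j,b_j]$ (the closed gaps) such that $$\sum_{j=0}^g\omega(x_j,E_k)=\beta_k \pmod 1,\quad k=1,\dots,g,\qquad(1)$$ $$\sum_{j=0}^g\Big(\int_{a_j}^{x_j}+\int_{b_j}^{x_j}\Big)\frac{dx}{|x-z|^2}=0,\qquad(2)$$ where the integrals are taken along the closed gaps. Let $T(w)=\prod_{j=0}^g(w-a_j)(w-b_j)$,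 let $\sqrt T$ be the branch analytic in $\mathbb C\setminus E$ with $\sqrt{T(w)}\sim w^{g+1}$ at infinity, and for finite $x_j$ let $\mathfrak m_{\mathfrak X}(z)$ be the $(g+1)\times(g+1)$ determinant with rows $(x_0^i,\dots,x_g^i)$, $i=0,\dots,g-1$, and last row $\big(\frac{\sqrt{T(x_0)}}{z-x_0},\dots,\frac{\sqrt{T(x_g)}}{z-x_g}\big)$. Then the following hold. (i) Let $z\in\mathbb C_+$ and let $x_j$ be finite points of the closed gaps, $j=0,\dots,g$. The determinant with the same first $g$ rows and with last row $\big(\frac{\sqrt{T(x_j)}}{z-x_j}-\frac{\sqrt{T(x_j)}}{\bar z-x_j}\big)_{j=0}^g$ is equal to $\mathfrak m_{\mathfrak X}(z)-\overline{\mathfrak m_{\mathfrak X}(z)}$, and it is different from $0$ as soon as at least one $x_j$ lies in the open gap. (ii) There is a real constant $C\neq0$, depending only on $E$, such that for all $z\in\mathbb C_+$ and all finite points $x_j$ of the open gaps, $j=0,\dots,g$, the left-hand sides of (1)–(2) are continuously differentiable functions of $(x_0,\dots,x_g)\in\mathbb R^{g+1}$ near $\mathfrak X$, and their Jacobian determinant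 $J(\mathfrak X,z)$ satisfies $$J(\mathfrak X,z)\prod_{j=0}^g\sqrt{T(x_j)}=\frac{iC}{\operatorname{Im}z}\big(\mathfrak m_{\mathfrak X}(z)-\overline{\mathfrak m_{\mathfrak X}(z)}\big),\qquad J(\mathfrak X,z)\ne0 .$$ (iii) The problem is locally solvable: if $\mathfrak X^0$ is a solution for the data $(\beta^0,z^0)$, $z^0\in\mathbb C_+$, and every $x_j^0$ lies in the open gap ($x^0_0=\infty$ is allowed), then there are an open neighbourhood $U$ of $(\beta^0,z^0)$ in $(\mathbb R/\mathbb Z)^g\times\mathbb C_+$ and an open neighbourhood $W$ of $\mathfrak X^0$ in the product of the open gaps such that for each $(\beta,z)\in U$ the problem has exactly one solution $\mathfrak X(\beta,z)$ in $W$, and this solution depends continuously on $(\beta,z)$, with $\mathfrak X(\beta^0,z^0)=\mathfrak X^0$. -/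

import Mathlib

open scoped Topology

noncomputable section

/-- Continuous subharmonic functions on an open subset `Ω` of the Riemann sphere `OnePoint ℂ`:
the sub-mean value inequality holds for every closed disc contained in `Ω`, including the closed
discs centred at the point at infinity, i.e. the complements of open discs `|w - c| < R`. -/
structure IsSubharmonicOn (v : OnePoint ℂ → ℝ) (Ω : Set (OnePoint ℂ)) : Prop where
  continuousOn : ContinuousOn v Ω
  le_circleAverage : ∀ (c : ℂ) (R : ℝ), 0 < R →
    (∀ w : ℂ, ‖w - c‖ ≤ R → (w : OnePoint ℂ) ∈ Ω) →
      v (c : OnePoint ℂ) ≤ Real.circleAverage (fun w : ℂ => v (w : OnePoint ℂ)) c R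
  le_circleAverage_infty : OnePoint.infty ∈ Ω → ∀ (c : ℂ) (R : ℝ), 0 < R →
    (∀ w : ℂ, R ≤ ‖w - c‖ → (w : OnePoint ℂ) ∈ Ω) →
      v OnePoint.infty ≤ Real.circleAverage (fun w : ℂ => v (w : OnePoint ℂ)) c R

/-- The (lower) Perron class of the indicator function of `F ⊆ E` for the domain `Eᶜ` in the
Riemann sphere: subharmonic functions whose upper limits at the points `ζ` of `E` are at most
`1` if `ζ ∈ F` and at most `0` otherwise. -/
def PerronClass (E F : Set (OnePoint ℂ)) : Set (OnePoint ℂ → ℝ) :=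
  {v | IsSubharmonicOn v Eᶜ ∧
    ∀ ζ ∈ E, ∀ m : ℝ, F.indicator (fun _ => (1 : ℝ)) ζ < m → ∀ᶠ w in 𝓝[Eᶜ] ζ, v w < m}

open Classical in
/-- The harmonic measure `ω(p, F)` of `F ⊆ E` at the point `p` with respect to the domain
`Eᶜ` of the Riemann sphere: the Perron solution of the Dirichlet problem with boundary data the
indicator function of `F`, extended by its boundary data to the points of `E`. -/
def harmonicMeasure (E F : Set (OnePoint ℂ)) (p : OnePoint ℂ) : ℝ :=
  if p ∈ E then F.indicator (fun _ => (1 : ℝ)) p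
  else sSup ((fun v : OnePoint ℂ → ℝ => v p) '' PerronClass E F)

/-- The inclusion of the circle `ℝ ∪ {∞}` in the Riemann sphere. -/
def realToSphere : OnePoint ℝ → OnePoint ℂ :=
  OnePoint.map (fun t : ℝ => (t : ℂ))

/-- The open arc of the circle `ℝ ∪ {∞}` from `p` to `q` in the positive direction
(through `∞` when `q ≤ p`). -/
def openArc (p q : ℝ) : Set (OnePoint ℝ) :=
  if p < q then (fun t : ℝ => (t : OnePoint ℝ)) '' Set.Ioo p q
  else ((fun t : ℝ => (t : OnePoint ℝ)) '' Set.Icc q p)ᶜ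

/-- The closed arc of the circle `ℝ ∪ {∞}` from `p` to `q` in the positive direction
(through `∞` when `q ≤ p`). -/
def closedArc (p q : ℝ) : Set (OnePoint ℝ) :=
  if p < q then (fun t : ℝ => (t : OnePoint ℝ)) '' Set.Icc p q
  else ((fun t : ℝ => (t : OnePoint ℝ)) '' Set.Ioo q p)ᶜ

/-- The finite points of the closed arc from `p` to `x` in the positive direction. -/
def arcTo (p : ℝ) (x : OnePoint ℝ) : Set ℝ :=
  x.elim (Set.Ici p)
    (fun t : ℝ => if p ≤ t then Set.Icc p t else Set.Ici p ∪ Set.Iic t)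

/-- The finite points of the closed arc from `x` to `q` in the positive direction. -/
def arcFrom (q : ℝ) (x : OnePoint ℝ) : Set ℝ :=
  x.elim (Set.Iic q)
    (fun t : ℝ => if t ≤ q then Set.Icc t q else Set.Ici t ∪ Set.Iic q)

/-- Endpoints of the gaps of a system of `g + 1` non-degenerate intervals,
`b 0 < a 1 < b 1 < ⋯ < a g < b g < a 0`. The gaps are the intervals `(a j, b j)` for
`j = 1, …, g` and the arc `(a 0, b 0)` of `ℝ ∪ {∞}`, which passes through infinity. -/
structure GapSystem (g : ℕ) where
  a : Fin (g + 1) → ℝ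
  b : Fin (g + 1) → ℝ
  a_lt_b : ∀ j : Fin g, a j.succ < b j.succ
  b_lt_a : ∀ j : Fin g, b j.castSucc < a j.succ
  b_last_lt : b (Fin.last g) < a 0

namespace GapSystem

variable {g : ℕ} (G : GapSystem g)

/-- `E = [b 0, a 0] ∖ ⋃ (a j, b j)`. -/
def E : Set ℝ := Set.Icc (G.b 0) (G.a 0) \ ⋃ j : Fin g, Set.Ioo (G.a j.succ) (G.b j.succ)

/-- `E_k = E ∩ [b 0, a k]`; the index `k = 1, …, g` is written as `k.succ` with `k : Fin g`. -/
def Ek (k : Fin g) : Set ℝ := G.E ∩ Set.Icc (G.b 0) (G.a k.succ)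

/-- The harmonic measure `ω(x, E_k)` at `x ∈ ℝ ∪ {∞}` in the complement of `E` in the sphere. -/
def omega (k : Fin g) (x : OnePoint ℝ) : ℝ :=
  harmonicMeasure ((fun t : ℝ => ((t : ℂ) : OnePoint ℂ)) '' G.E)
    ((fun t : ℝ => ((t : ℂ) : OnePoint ℂ)) '' G.Ek k) (realToSphere x)

/-- The `j`-th open gap. -/
def gap (j : Fin (g + 1)) : Set (OnePoint ℝ) := openArc (G.a j) (G.b j)

/-- The `j`-th closed gap. -/
def closedGap (j : Fin (g + 1)) : Set (OnePoint ℝ) := closedArc (G.a j) (G.b j)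

/-- The left-hand side `∑_j ω(x_j, E_k)` of the `k`-th equation of the first group. -/
def harmonicSum (k : Fin g) (X : Fin (g + 1) → OnePoint ℝ) : ℝ := ∑ j, G.omega k (X j)

/-- The left-hand side `∑_j (∫_{a_j}^{x_j} + ∫_{b_j}^{x_j}) dt / |t - z|²` of the last equation.
Integration is along the closed gaps. -/
def poissonSum (z : ℂ) (X : Fin (g + 1) → OnePoint ℝ) : ℝ :=
  ∑ j, ((∫ t in arcTo (G.a j) (X j), 1 / ‖(t : ℂ) - z‖ ^ 2) -
    ∫ t in arcFrom (G.b j) (X j), 1 / ‖(t : ℂ) - z‖ ^ 2)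

/-- `X` solves the generalized Abel–Jacobi inversion problem with data `β` and `z`. The
characters `β` are given by their coordinates in `(ℝ / ℤ) ^ g`. -/
def IsSolution (β : Fin g → UnitAddCircle) (z : ℂ) (X : Fin (g + 1) → OnePoint ℝ) : Prop :=
  (∀ j, X j ∈ G.closedGap j) ∧
    (∀ k, ((G.harmonicSum k X : ℝ) : UnitAddCircle) = β k) ∧ G.poissonSum z X = 0

/-- The left-hand sides of all `g + 1` equations as a function of finite points
`x_0, …, x_g`. -/
def systemMap (z : ℂ) (x : Fin (g + 1) → ℝ) : Fin (g + 1) → ℝ :=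
  Fin.snoc (α := fun _ => ℝ) (fun k : Fin g => G.harmonicSum k (fun j => (x j : OnePoint ℝ)))
    (G.poissonSum z (fun j => (x j : OnePoint ℝ)))

/-- The Jacobian determinant `det (∂ (left-hand sides) / ∂ (x_0, …, x_g))` of the system. -/
def jacobian (z : ℂ) (x : Fin (g + 1) → ℝ) : ℝ := (fderiv ℝ (G.systemMap z) x).det

/-- The branch of the square root of `T(w) = ∏_j (w - a_j) (w - b_j)` which is analytic outside
`E` and behaves like `w ^ (g + 1)` at infinity (principal powers; the jumps of the factors cancel
on the gaps). -/
def sqrtT (w : ℂ) : ℂ := ∏ j, (w - G.a j) ^ (1 / 2 : ℂ) * (w - G.b j) ^ (1 / 2 : ℂ)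

/-- The function `𝔪_X(z)`: the determinant with rows `x_j ^ i`, `i = 0, …, g - 1`, and last row
`√T(x_j) / (z - x_j)`. -/
def frakM (x : Fin (g + 1) → ℝ) (z : ℂ) : ℂ :=
  Matrix.det (Matrix.of fun i j : Fin (g + 1) =>
    if (i : ℕ) < g then (x j : ℂ) ^ (i : ℕ) else G.sqrtT (x j) / (z - x j))

/-- The matrix with rows `x_j ^ i`, `i = 0, …, g - 1`, and last row
`√T(x_j) / (z - x_j) - √T(x_j) / (conj z - x_j)`. -/
def vandermondeType (x : Fin (g + 1) → ℝ) (z : ℂ) : Matrix (Fin (g + 1)) (Fin (g + 1)) ℂ :=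
  Matrix.of fun i j : Fin (g + 1) =>
    if (i : ℕ) < g then (x j : ℂ) ^ (i : ℕ)
    else G.sqrtT (x j) / (z - x j) - G.sqrtT (x j) / (starRingEnd ℂ z - x j)

end GapSystem

end

/-! Nonvanishing of the determinants is a matter of signs. For one point in each closed gap,
`√T(x_j)` is a common sign times `r_j ∏_{k ≠ j} (x_j - x_k)` with `r_j ≥ 0`, and `r_j > 0` in the
open gap (`sqrtT_eq_of_mem_closedGap`). Since `s/(z - x) - s/(z̄ - x) = -2i Im z · s/|x - z|²`, the
determinant in (i) is a nonzero multiple of `poissonDet`. A linear relation between the rows of the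
latter gives a polynomial `P` of degree less than `g` and a number `c` with `P(x_j) = -c
√T(x_j)/|x_j - z|²`. The divided difference of `P` at the `g + 1` points vanishes, while that of the
right-hand side is `c` times a nonzero sum of terms of one sign. Hence `c = 0`, so `P` has `g + 1`
zeros and vanishes (`det_powers_snoc_ne_zero`).

For (ii) the harmonic measures are computed explicitly. For `i < g`, take the primitive of `w^i/√T`
in the upper half-plane that vanishes at infinity. Its real part is constant on each component of
`E`, where `√T` is imaginary, and continues harmonically by even reflection across the gaps, where
`√T` is real. By Rolle's theorem the matrix of periods over the inner gaps is invertible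
(`det_periodMatrix_ne_zero`), so a constant plus a combination of these real parts equals `1` on
`E_k` and `0` on the rest of `E`. The maximum principle, applied to every member of the Perron
class, identifies it with `ω(·, E_k)` (`harmonicMeasure_eq`, `omega_eq`). Thus `dω = P_k dx/√T` in
the gaps with `deg P_k < g`, while the Poisson sum has derivatives `2/|x_j - z|²`. Taking out the
coefficient matrix of the `P_k` and the factors `1/√T(x_j)` leaves `2 * poissonDet`, and `C` is the
determinant of that coefficient matrix.

Part (iii) is the implicit function theorem, with `β` lifted locally to real numbers. At `x_0 = ∞`
the coordinate `ζ = -1/x_0` is used. The determinant there is nonzero by the same argument, with the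
divided difference at `g` points now returning the top coefficient of `P`. -/

namespace GapSystem

variable {g : ℕ} (G : GapSystem g)

/-! ### Order of the endpoints and membership in gaps -/

section Order

theorem strictMono_b : StrictMono G.b :=
  Fin.strictMono_iff_lt_succ.2 fun j => (G.b_lt_a j).trans (G.a_lt_b j)

theorem b_lt_a_of_lt {i j : Fin (g + 1)} (h : i < j) : G.b i < G.a j := by
  obtain ⟨k, rfl⟩ := Fin.exists_succ_eq.2 (Fin.ne_zero_of_lt h)
  have : i ≤ k.castSucc := by
    rw [Fin.le_def, Fin.val_castSucc]; rw [Fin.lt_def, Fin.val_succ] at h; omega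
  exact (G.strictMono_b.monotone this).trans_lt (G.b_lt_a k)

theorem b_lt_a_zero (i : Fin (g + 1)) : G.b i < G.a 0 :=
  (G.strictMono_b.monotone (Fin.le_last i)).trans_lt G.b_last_lt

theorem b_zero_lt_a (i : Fin (g + 1)) : G.b 0 < G.a i := by
  induction i using Fin.cases with
  | zero => exact G.b_lt_a_zero 0
  | succ i => exact G.b_lt_a_of_lt (Fin.succ_pos i)

theorem a_lt_a_zero (i : Fin g) : G.a i.succ < G.a 0 := (G.a_lt_b i).trans (G.b_lt_a_zero _)

theorem a_lt_a_of_lt {i j : Fin (g + 1)} (hi : i ≠ 0) (h : i < j) : G.a i < G.a j := by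
  obtain ⟨k, rfl⟩ := Fin.exists_succ_eq.2 hi
  exact (G.a_lt_b k).trans (G.b_lt_a_of_lt h)

theorem injective_a : Function.Injective G.a := by
  have key : ∀ i j, i < j → G.a i ≠ G.a j := by
    intro i j h
    induction i using Fin.cases with
    | zero =>
      obtain ⟨k, rfl⟩ := Fin.exists_succ_eq.2 (Fin.ne_zero_of_lt h)
      exact (G.a_lt_a_zero k).ne'
    | succ i => exact (G.a_lt_a_of_lt (Fin.succ_ne_zero i) h).ne
  intro i j h
  by_contra hne
  rcases lt_or_gt_of_ne hne with h' | h'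
  · exact key i j h' h
  · exact key j i h' h.symm

theorem a_ne_b (i j : Fin (g + 1)) : G.a i ≠ G.b j := by
  rcases lt_or_ge j i with h | h
  · exact (G.b_lt_a_of_lt h).ne'
  · induction i using Fin.cases with
    | zero => exact (G.b_lt_a_zero j).ne'
    | succ i => exact ((G.a_lt_b i).trans_le (G.strictMono_b.monotone h)).ne

/-- All endpoints of the system. -/
def endpt : Fin (g + 1) ⊕ Fin (g + 1) → ℝ := Sum.elim G.a G.b

theorem injective_endpt : Function.Injective G.endpt :=
  G.injective_a.sumElim G.strictMono_b.injective G.a_ne_b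

theorem coe_mem_gap_zero {x : ℝ} :
    (x : OnePoint ℝ) ∈ G.gap 0 ↔ x < G.b 0 ∨ G.a 0 < x := by
  have h := G.b_lt_a_zero 0
  simp only [gap, openArc, if_neg h.le.not_gt, Set.mem_compl_iff, Set.mem_image, OnePoint.coe_eq_coe,
    exists_eq_right, Set.mem_Icc, not_and_or, not_le]

theorem coe_mem_gap_succ {x : ℝ} (j : Fin g) :
    (x : OnePoint ℝ) ∈ G.gap j.succ ↔ G.a j.succ < x ∧ x < G.b j.succ := by
  simp only [gap, openArc, if_pos (G.a_lt_b j), Set.mem_image, OnePoint.coe_eq_coe,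
    exists_eq_right, Set.mem_Ioo]

theorem infty_notMem_gap_succ (j : Fin g) : OnePoint.infty ∉ G.gap j.succ := by
  simp [gap, openArc, if_pos (G.a_lt_b j)]

theorem coe_mem_closedGap_zero {x : ℝ} :
    (x : OnePoint ℝ) ∈ G.closedGap 0 ↔ x ≤ G.b 0 ∨ G.a 0 ≤ x := by
  have h := G.b_lt_a_zero 0
  simp only [closedGap, closedArc, if_neg h.le.not_gt, Set.mem_compl_iff, Set.mem_image,
    OnePoint.coe_eq_coe, exists_eq_right, Set.mem_Ioo, not_and_or, not_lt]

theorem coe_mem_closedGap_succ {x : ℝ} (j : Fin g) :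
    (x : OnePoint ℝ) ∈ G.closedGap j.succ ↔ G.a j.succ ≤ x ∧ x ≤ G.b j.succ := by
  simp only [closedGap, closedArc, if_pos (G.a_lt_b j), Set.mem_image, OnePoint.coe_eq_coe,
    exists_eq_right, Set.mem_Icc]

theorem gap_subset_closedGap (j : Fin (g + 1)) : G.gap j ⊆ G.closedGap j := by
  have h := G.b_lt_a_zero 0
  induction j using Fin.cases with
  | zero =>
    simp only [gap, closedGap, openArc, closedArc, if_neg h.le.not_gt]
    exact Set.compl_subset_compl.2 (Set.image_mono Set.Ioo_subset_Icc_self)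
  | succ j =>
    simp only [gap, closedGap, openArc, closedArc, if_pos (G.a_lt_b j)]
    exact Set.image_mono Set.Ioo_subset_Icc_self

theorem coe_a_mem_closedGap (j : Fin (g + 1)) : (G.a j : OnePoint ℝ) ∈ G.closedGap j := by
  induction j using Fin.cases with
  | zero => exact G.coe_mem_closedGap_zero.2 (Or.inr le_rfl)
  | succ j => exact (G.coe_mem_closedGap_succ j).2 ⟨le_rfl, (G.a_lt_b j).le⟩

theorem mem_E_iff {x : ℝ} :
    x ∈ G.E ↔ (G.b 0 ≤ x ∧ x ≤ G.a 0) ∧ ∀ j : Fin g, x ≤ G.a j.succ ∨ G.b j.succ ≤ x := by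
  simp only [E, Set.mem_sdiff, Set.mem_Icc, Set.mem_iUnion, Set.mem_Ioo, not_exists, not_and_or,
    not_lt]

theorem mem_E_or_mem_gap (x : ℝ) : x ∈ G.E ∨ ∃ j, (x : OnePoint ℝ) ∈ G.gap j := by
  by_contra! h
  obtain ⟨h1, h2⟩ := h
  refine h1 (G.mem_E_iff.2 ⟨?_, fun j => ?_⟩)
  · have := h2 0
    rw [coe_mem_gap_zero] at this
    push Not at this; exact this
  · have := h2 j.succ
    rw [coe_mem_gap_succ] at this
    by_contra! h; exact this h

end Order

end GapSystem

/-! ### Signs of pairs of principal square roots on the real line -/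

section Roots

open Complex

theorem cpow_half_of_nonneg {u : ℝ} (hu : 0 ≤ u) : (u : ℂ) ^ (1 / 2 : ℂ) = (√u : ℝ) := by
  rw [Real.sqrt_eq_rpow, Complex.ofReal_cpow hu]; norm_num

theorem cpow_half_of_nonpos {u : ℝ} (hu : u ≤ 0) : (u : ℂ) ^ (1 / 2 : ℂ) = I * (√(-u) : ℝ) := by
  rw [Complex.ofReal_cpow_of_nonpos hu, ← Complex.ofReal_neg, cpow_half_of_nonneg (by linarith),
    mul_comm]
  congr 1
  rw [show (Real.pi : ℂ) * I * (1 / 2) = ((Real.pi / 2 : ℝ) : ℂ) * I by push_cast; ring,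
    Complex.exp_mul_I, ← Complex.ofReal_cos, ← Complex.ofReal_sin]
  simp

theorem pair_of_le_le {x p q : ℝ} (hp : p ≤ x) (hq : q ≤ x) :
    ((x : ℂ) - p) ^ (1 / 2 : ℂ) * ((x : ℂ) - q) ^ (1 / 2 : ℂ) = ((√(x - p) * √(x - q) : ℝ) : ℂ) := by
  rw [← Complex.ofReal_sub, ← Complex.ofReal_sub, cpow_half_of_nonneg (by linarith),
    cpow_half_of_nonneg (by linarith)]
  push_cast; rfl

theorem pair_of_ge_ge {x p q : ℝ} (hp : x ≤ p) (hq : x ≤ q) :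
    ((x : ℂ) - p) ^ (1 / 2 : ℂ) * ((x : ℂ) - q) ^ (1 / 2 : ℂ) =
      ((-(√(p - x) * √(q - x)) : ℝ) : ℂ) := by
  rw [← Complex.ofReal_sub, ← Complex.ofReal_sub, cpow_half_of_nonpos (by linarith),
    cpow_half_of_nonpos (by linarith), neg_sub, neg_sub]
  push_cast
  linear_combination ((√(p - x) : ℝ) : ℂ) * ((√(q - x) : ℝ) : ℂ) * I_mul_I

theorem pair_of_le_ge {x p q : ℝ} (hp : p ≤ x) (hq : x ≤ q) :
    ((x : ℂ) - p) ^ (1 / 2 : ℂ) * ((x : ℂ) - q) ^ (1 / 2 : ℂ) =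
      I * ((√(x - p) * √(q - x) : ℝ) : ℂ) := by
  rw [← Complex.ofReal_sub, ← Complex.ofReal_sub, cpow_half_of_nonneg (by linarith),
    cpow_half_of_nonpos (by linarith), neg_sub]
  push_cast; ring

/-- Outside the open interval between `p` and `q`, and strictly on the side of `y`, the pair of
roots is a positive multiple of `x - y`. -/
theorem pair_eq_of_separated {x y p q : ℝ} (h : (x < p ∧ x < q ∧ x < y) ∨ (p < x ∧ q < x ∧ y < x)) :
    ∃ r : ℝ, 0 < r ∧
      ((x : ℂ) - p) ^ (1 / 2 : ℂ) * ((x : ℂ) - q) ^ (1 / 2 : ℂ) = ((r * (x - y) : ℝ) : ℂ) := by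
  rcases h with ⟨h1, h2, h3⟩ | ⟨h1, h2, h3⟩
  · refine ⟨√(p - x) * √(q - x) / (y - x), ?_, ?_⟩
    · have := Real.sqrt_pos.2 (sub_pos.2 h1)
      have := Real.sqrt_pos.2 (sub_pos.2 h2)
      have := sub_pos.2 h3
      positivity
    · rw [pair_of_ge_ge h1.le h2.le]
      congr 1
      have : y - x ≠ 0 := (sub_pos.2 h3).ne'
      field_simp; ring
  · refine ⟨√(x - p) * √(x - q) / (x - y), ?_, ?_⟩
    · have := Real.sqrt_pos.2 (sub_pos.2 h1)
      have := Real.sqrt_pos.2 (sub_pos.2 h2)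
      have := sub_pos.2 h3
      positivity
    · rw [pair_of_le_le h1.le h2.le]
      congr 1
      have : x - y ≠ 0 := (sub_pos.2 h3).ne'
      field_simp

end Roots

namespace GapSystem

variable {g : ℕ} (G : GapSystem g)

/-! ### Sign pattern of `√T` at a configuration of points of the gaps -/

section Config

open Complex Finset

/-- Distinct gaps are separated by nondegenerate components of `E`, so even the closed gaps are
pairwise disjoint. -/
theorem injective_of_mem_closedGap {x : Fin (g + 1) → ℝ}
    (hx : ∀ j, (x j : OnePoint ℝ) ∈ G.closedGap j) : Function.Injective x := by
  have key : ∀ i j, i < j → x i ≠ x j := by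
    intro i j h
    obtain ⟨k, rfl⟩ := Fin.exists_succ_eq.2 (Fin.ne_zero_of_lt h)
    have hk := (G.coe_mem_closedGap_succ k).1 (hx k.succ)
    have h1 := G.b_zero_lt_a k.succ
    have h2 := G.b_lt_a_zero k.succ
    induction i using Fin.cases with
    | zero =>
      rcases G.coe_mem_closedGap_zero.1 (hx 0) with h0 | h0
      · exact (h0.trans_lt (h1.trans_le hk.1)).ne
      · exact ((hk.2.trans_lt h2).trans_le h0).ne'
    | succ i =>
      have hi := (G.coe_mem_closedGap_succ i).1 (hx i.succ)
      exact ((hi.2.trans_lt (G.b_lt_a_of_lt h)).trans_le hk.1).ne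
  intro i j h
  by_contra hne
  rcases lt_or_gt_of_ne hne with h' | h'
  · exact key i j h' h
  · exact key j i h' h.symm

/-- The side of the unbounded gap on which `x` lies. -/
noncomputable def side (x : ℝ) : ℝ := if G.a 0 ≤ x then 1 else -1

theorem side_ne_zero (x : ℝ) : G.side x ≠ 0 := by
  unfold side; split_ifs <;> norm_num

theorem pair_zero_eq {x : ℝ} (hx : (x : OnePoint ℝ) ∈ G.closedGap 0) :
    ∃ r : ℝ, 0 ≤ r ∧ ((x : OnePoint ℝ) ∈ G.gap 0 → 0 < r) ∧
      ((x : ℂ) - G.a 0) ^ (1 / 2 : ℂ) * ((x : ℂ) - G.b 0) ^ (1 / 2 : ℂ) =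
        ((G.side x * r : ℝ) : ℂ) := by
  have hba := G.b_lt_a_zero 0
  rw [coe_mem_closedGap_zero] at hx
  rw [coe_mem_gap_zero]
  by_cases h : G.a 0 ≤ x
  · refine ⟨√(x - G.a 0) * √(x - G.b 0), by positivity, fun h' => ?_, ?_⟩
    · have h1 : G.a 0 < x := by rcases h' with h' | h' <;> linarith
      exact mul_pos (Real.sqrt_pos.2 (by linarith)) (Real.sqrt_pos.2 (by linarith))
    · rw [pair_of_le_le h (by linarith), side, if_pos h, one_mul]
  · have hxb : x ≤ G.b 0 := hx.resolve_right h
    refine ⟨√(G.a 0 - x) * √(G.b 0 - x), by positivity, fun h' => ?_, ?_⟩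
    · have h1 : x < G.b 0 := by rcases h' with h' | h' <;> linarith
      exact mul_pos (Real.sqrt_pos.2 (by linarith)) (Real.sqrt_pos.2 (by linarith))
    · rw [pair_of_ge_ge (by linarith) hxb, side, if_neg h, neg_one_mul]

/-- Inside `[b 0, a 0]` the outer pair is `i` times a nonnegative number, and so is the pair of the
gap that contains `x`. Only their product is real, and it is nonpositive. Since `x - y` has the sign
opposite to `side y`, this sign is the one required of the factor of index `0` in the configuration
formula. -/
theorem pair_zero_mul_pair_eq {x y : ℝ} (hy : (y : OnePoint ℝ) ∈ G.closedGap 0) (j : Fin g)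
    (hx : (x : OnePoint ℝ) ∈ G.closedGap j.succ) :
    ∃ r : ℝ, 0 ≤ r ∧ ((x : OnePoint ℝ) ∈ G.gap j.succ → 0 < r) ∧
      (((x : ℂ) - G.a 0) ^ (1 / 2 : ℂ) * ((x : ℂ) - G.b 0) ^ (1 / 2 : ℂ)) *
      (((x : ℂ) - G.a j.succ) ^ (1 / 2 : ℂ) * ((x : ℂ) - G.b j.succ) ^ (1 / 2 : ℂ)) =
        ((G.side y * r * (x - y) : ℝ) : ℂ) := by
  have hba := G.b_lt_a_zero 0
  have h1 := G.b_zero_lt_a j.succ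
  have h2 := G.b_lt_a_zero j.succ
  rw [coe_mem_closedGap_zero] at hy
  rw [coe_mem_closedGap_succ] at hx
  rw [coe_mem_gap_succ]
  have e := congrArg₂ (· * ·) (pair_of_le_ge (h1.le.trans hx.1) (hx.2.trans h2.le))
    (pair_of_le_ge hx.1 hx.2)
  -- With `s = 1/|x - y|` the sign `I * I = -1` is expressed through `side y` and `x - y`.
  have hs : ∃ s : ℝ, 0 < s ∧ G.side y * s * (x - y) = -1 := by
    by_cases h : G.a 0 ≤ y
    · have : 0 < y - x := by linarith
      refine ⟨(y - x)⁻¹, by positivity, ?_⟩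
      rw [side, if_pos h]; field_simp; ring
    · have : 0 < x - y := by linarith [hy.resolve_right h]
      refine ⟨(x - y)⁻¹, by positivity, ?_⟩
      rw [side, if_neg h]; field_simp
  obtain ⟨s, hs, hse⟩ := hs
  refine ⟨s * (√(x - G.b 0) * √(G.a 0 - x) * (√(x - G.a j.succ) * √(G.b j.succ - x))),
    by positivity, fun h' => ?_, ?_⟩
  · refine mul_pos hs (mul_pos (mul_pos ?_ ?_) (mul_pos ?_ ?_)) <;>
      exact Real.sqrt_pos.2 (by linarith)
  · rw [mul_comm (((x : ℂ) - G.a 0) ^ (1 / 2 : ℂ))]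
    refine e.trans ?_
    rw [show G.side y * (s * (√(x - G.b 0) * √(G.a 0 - x) * (√(x - G.a j.succ) *
      √(G.b j.succ - x)))) * (x - y) = (G.side y * s * (x - y)) * (√(x - G.b 0) * √(G.a 0 - x) *
      (√(x - G.a j.succ) * √(G.b j.succ - x))) by ring, hse]
    push_cast
    linear_combination (((√(x - G.b 0) : ℝ) : ℂ) * ((√(G.a 0 - x) : ℝ) : ℂ) *
      (((√(x - G.a j.succ) : ℝ) : ℂ) * ((√(G.b j.succ - x) : ℝ) : ℂ))) * I_mul_I

theorem pair_eq_of_mem_closedGap {x y : ℝ} {j k : Fin (g + 1)} (hk : k ≠ 0) (hjk : k ≠ j)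
    (hx : (x : OnePoint ℝ) ∈ G.closedGap j) (hy : (y : OnePoint ℝ) ∈ G.closedGap k) :
    ∃ r : ℝ, 0 < r ∧ ((x : ℂ) - G.a k) ^ (1 / 2 : ℂ) * ((x : ℂ) - G.b k) ^ (1 / 2 : ℂ) =
      ((r * (x - y) : ℝ) : ℂ) := by
  obtain ⟨k, rfl⟩ := Fin.exists_succ_eq.2 hk
  rw [coe_mem_closedGap_succ] at hy
  apply pair_eq_of_separated
  have h1 := G.b_zero_lt_a k.succ
  have h2 := G.b_lt_a_zero k.succ
  have h3 := G.a_lt_b k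
  induction j using Fin.cases with
  | zero =>
    rcases G.coe_mem_closedGap_zero.1 hx with h0 | h0
    · left; refine ⟨?_, ?_, ?_⟩ <;> linarith
    · right; refine ⟨?_, ?_, ?_⟩ <;> linarith
  | succ j =>
    have hj := (G.coe_mem_closedGap_succ j).1 hx
    rcases lt_or_gt_of_ne hjk with h | h
    · have := G.b_lt_a_of_lt h
      right; refine ⟨?_, ?_, ?_⟩ <;> linarith
    · have := G.b_lt_a_of_lt h
      left; refine ⟨?_, ?_, ?_⟩ <;> linarith

/-- At a configuration of points of the closed gaps, `√T(x j)` is up to the sign `side (x 0)` a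
nonnegative multiple of `∏_{k ≠ j} (x j - x k)`. -/
theorem sqrtT_eq_of_mem_closedGap {x : Fin (g + 1) → ℝ}
    (hx : ∀ j, (x j : OnePoint ℝ) ∈ G.closedGap j) (j : Fin (g + 1)) :
    ∃ r : ℝ, 0 ≤ r ∧ ((x j : OnePoint ℝ) ∈ G.gap j → 0 < r) ∧
      G.sqrtT (x j) = ((G.side (x 0) * r * ∏ k ∈ univ.erase j, (x j - x k) : ℝ) : ℂ) := by
  have hpair : ∀ k, k ≠ 0 → k ≠ j → ∃ r : ℝ, 0 < r ∧
      ((x j : ℂ) - G.a k) ^ (1 / 2 : ℂ) * ((x j : ℂ) - G.b k) ^ (1 / 2 : ℂ) =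
        ((r * (x j - x k) : ℝ) : ℂ) :=
    fun k hk hkj => G.pair_eq_of_mem_closedGap hk hkj (hx j) (hx k)
  choose! ρ hρ hρe using hpair
  have hprod : ∀ s : Finset (Fin (g + 1)), 0 ∉ s → j ∉ s →
      ∏ k ∈ s, ((x j : ℂ) - G.a k) ^ (1 / 2 : ℂ) * ((x j : ℂ) - G.b k) ^ (1 / 2 : ℂ) =
        (((∏ k ∈ s, ρ k) * ∏ k ∈ s, (x j - x k) : ℝ) : ℂ) ∧ 0 < ∏ k ∈ s, ρ k := by
    intro s h0 hj
    have hne : ∀ k ∈ s, k ≠ 0 ∧ k ≠ j := fun k hk =>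
      ⟨fun h => h0 (h ▸ hk), fun h => hj (h ▸ hk)⟩
    constructor
    · rw [← Finset.prod_mul_distrib, Complex.ofReal_prod]
      exact Finset.prod_congr rfl fun k hk => hρe k (hne k hk).1 (hne k hk).2
    · exact Finset.prod_pos fun k hk => hρ k (hne k hk).1 (hne k hk).2
  rw [sqrtT, ← Finset.mul_prod_erase univ _ (mem_univ j)]
  -- For `j = 0` the outer pair is real by itself. For an inner gap it must be grouped with pair
  -- `j`, and the grouped product then supplies the factor `x j - x 0`.
  by_cases h0 : j = 0
  · subst h0
    obtain ⟨r, hr, hr', hre⟩ := G.pair_zero_eq (hx 0)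
    obtain ⟨h1, h2⟩ := hprod (univ.erase 0) (by simp) (by simp)
    refine ⟨r * ∏ k ∈ univ.erase 0, ρ k, by positivity, fun h => mul_pos (hr' h) h2, ?_⟩
    rw [hre, h1]; push_cast; ring
  · obtain ⟨i, rfl⟩ := Fin.exists_succ_eq.2 h0
    obtain ⟨r, hr, hr', hre⟩ := G.pair_zero_mul_pair_eq (hx 0) i (hx i.succ)
    obtain ⟨h1, h2⟩ := hprod ((univ.erase i.succ).erase 0) (by simp) (by simp)
    refine ⟨r * ∏ k ∈ (univ.erase i.succ).erase 0, ρ k, by positivity,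
      fun h => mul_pos (hr' h) h2, ?_⟩
    have hm : (0 : Fin (g + 1)) ∈ univ.erase i.succ := by simp [(Fin.succ_ne_zero i).symm]
    rw [← Finset.mul_prod_erase _ _ hm, h1, ← Finset.mul_prod_erase _ (fun k => x i.succ - x k) hm]
    push_cast at hre ⊢
    linear_combination ((∏ k ∈ (univ.erase i.succ).erase 0, (ρ k : ℂ)) *
      ∏ k ∈ (univ.erase i.succ).erase 0, ((x i.succ : ℂ) - x k)) * hre

/-- Completes a single point to a full configuration, so that facts about `√T` at one point follow
from the configuration formula. -/
theorem update_a_mem_closedGap {j : Fin (g + 1)} {x : ℝ}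
    (hx : (x : OnePoint ℝ) ∈ G.closedGap j) (k : Fin (g + 1)) :
    ((Function.update G.a j x k : ℝ) : OnePoint ℝ) ∈ G.closedGap k := by
  by_cases h : k = j
  · subst h; simpa using hx
  · rw [Function.update_of_ne h]; exact G.coe_a_mem_closedGap k

theorem sqrtT_im_of_mem_closedGap {j : Fin (g + 1)} {x : ℝ}
    (hx : (x : OnePoint ℝ) ∈ G.closedGap j) : (G.sqrtT x).im = 0 := by
  obtain ⟨r, -, -, h⟩ := G.sqrtT_eq_of_mem_closedGap (G.update_a_mem_closedGap hx) j
  rw [Function.update_self] at h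
  rw [h, Complex.ofReal_im]

theorem sqrtT_ne_zero_of_mem_gap {j : Fin (g + 1)} {x : ℝ}
    (hx : (x : OnePoint ℝ) ∈ G.gap j) : G.sqrtT x ≠ 0 := by
  have hx' := G.update_a_mem_closedGap (G.gap_subset_closedGap j hx)
  obtain ⟨r, -, hr, h⟩ := G.sqrtT_eq_of_mem_closedGap hx' j
  have hinj := G.injective_of_mem_closedGap hx'
  rw [Function.update_self] at h hr
  rw [h, Complex.ofReal_ne_zero]
  refine mul_ne_zero (mul_ne_zero (G.side_ne_zero _) (hr hx).ne') (Finset.prod_ne_zero_iff.2 ?_)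
  intro k hk
  have := hinj.ne (Finset.ne_of_mem_erase hk).symm
  rw [Function.update_self] at this
  exact sub_ne_zero.2 this

/-- On `E` the outer pair is the only imaginary factor. Each inner pair is real because the point
avoids the open gap between its endpoints. -/
theorem sqrtT_re_of_mem_E {x : ℝ} (hx : x ∈ G.E) : (G.sqrtT x).re = 0 := by
  obtain ⟨⟨h1, h2⟩, h3⟩ := G.mem_E_iff.1 hx
  have hpair : ∀ k : Fin g, ∃ r : ℝ,
      ((x : ℂ) - G.a k.succ) ^ (1 / 2 : ℂ) * ((x : ℂ) - G.b k.succ) ^ (1 / 2 : ℂ) = (r : ℂ) := by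
    intro k
    have := G.a_lt_b k
    rcases h3 k with h | h
    · exact ⟨_, pair_of_ge_ge h (by linarith)⟩
    · exact ⟨_, pair_of_le_le (by linarith) h⟩
  choose ρ hρ using hpair
  rw [sqrtT, Fin.prod_univ_succ, mul_comm (((x : ℂ) - G.a 0) ^ (1 / 2 : ℂ)), pair_of_le_ge h1 h2]
  simp_rw [hρ]
  rw [← Complex.ofReal_prod, mul_assoc, ← Complex.ofReal_mul, Complex.I_mul_re, Complex.ofReal_im,
    neg_zero]

end Config

end GapSystem

/-! ### Divided differences and nonvanishing of bordered Vandermonde determinants -/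

section LinearAlgebra

open Polynomial Finset

theorem degree_sum_monomial_lt {n : ℕ} (c : Fin n → ℝ) :
    (∑ i : Fin n, C (c i) * X ^ (i : ℕ) : ℝ[X]).degree < n := by
  refine (degree_sum_le _ _).trans_lt ((Finset.sup_lt_iff (WithBot.bot_lt_coe n)).2 fun i _ => ?_)
  exact (degree_C_mul_X_pow_le _ _).trans_lt (Nat.cast_lt.2 i.2)

theorem coeff_sum_monomial {n : ℕ} (c : Fin n → ℝ) (i : Fin n) :
    (∑ i : Fin n, C (c i) * X ^ (i : ℕ) : ℝ[X]).coeff i = c i := by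
  rw [finsetSum_coeff, Finset.sum_eq_single i]
  · simp
  · intro j _ hj
    rw [coeff_C_mul_X_pow, if_neg (fun h => hj (Fin.ext h).symm)]
  · simp

theorem eval_sum_monomial {n : ℕ} (c : Fin n → ℝ) (x : ℝ) :
    (∑ i : Fin n, C (c i) * X ^ (i : ℕ) : ℝ[X]).eval x = ∑ i : Fin n, c i * x ^ (i : ℕ) := by
  simp [eval_finsetSum]

theorem eq_zero_of_forall_eval_eq_zero {n : ℕ} {c x : Fin n → ℝ} (hx : Function.Injective x)
    (h : ∀ j, ∑ i : Fin n, c i * x j ^ (i : ℕ) = 0) : c = 0 := by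
  have hp : (∑ i : Fin n, C (c i) * X ^ (i : ℕ) : ℝ[X]) = 0 :=
    Polynomial.eq_zero_of_degree_lt_of_eval_index_eq_zero (s := Finset.univ) (v := x) hx.injOn
      (by rw [card_univ, Fintype.card_fin]; exact degree_sum_monomial_lt c)
      fun j _ => by rw [eval_sum_monomial, h]
  ext i
  rw [← coeff_sum_monomial c i, hp]; rfl

/-- Divided differences at `g + 1` points annihilate polynomials of degree less than `g`. -/
theorem sum_eval_div_prod_eq_zero {g : ℕ} {x : Fin (g + 1) → ℝ} (hx : Function.Injective x)
    (c : Fin g → ℝ) :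
    ∑ j, (∑ i : Fin g, c i * x j ^ (i : ℕ)) / ∏ k ∈ univ.erase j, (x j - x k) = 0 := by
  have hdeg := degree_sum_monomial_lt c
  have h := Lagrange.coeff_eq_sum (s := univ) (v := x) hx.injOn
    (P := ∑ i : Fin g, C (c i) * X ^ (i : ℕ))
    (hdeg.trans_le (by rw [card_univ, Fintype.card_fin]; exact_mod_cast Nat.le_succ g))
  rw [card_univ, Fintype.card_fin, Nat.add_sub_cancel, coeff_eq_zero_of_degree_lt hdeg] at h
  simp_rw [eval_sum_monomial] at h
  exact h.symm

theorem sum_eval_div_prod_eq_coeff {g : ℕ} {x : Fin (g + 1) → ℝ} (hx : Function.Injective x)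
    (c : Fin (g + 1) → ℝ) :
    ∑ j, (∑ i : Fin (g + 1), c i * x j ^ (i : ℕ)) / ∏ k ∈ univ.erase j, (x j - x k) =
      c (Fin.last g) := by
  have h := Lagrange.coeff_eq_sum (s := univ) (v := x) hx.injOn
    (P := ∑ i : Fin (g + 1), C (c i) * X ^ (i : ℕ))
    ((degree_sum_monomial_lt c).trans_le (by rw [card_univ, Fintype.card_fin]))
  rw [card_univ, Fintype.card_fin, Nat.add_sub_cancel] at h
  simp_rw [eval_sum_monomial] at h
  rw [← h, ← coeff_sum_monomial c (Fin.last g), Fin.val_last]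

theorem prod_sub_ne_zero {n : ℕ} {x : Fin n → ℝ} (hx : Function.Injective x) (j : Fin n) :
    ∏ k ∈ univ.erase j, (x j - x k) ≠ 0 :=
  prod_ne_zero_iff.2 fun _ hk => sub_ne_zero.2 (hx.ne (ne_of_mem_erase hk).symm)

/-- A left kernel vector consists of the coefficients of a polynomial of degree less than `g` and a
last entry `c`. Applying the divided difference at the points `x j` to the relation it expresses
kills the polynomial and leaves `c * σ * ∑ w j = 0`. So `c = 0`, and the polynomial has too many
zeros. -/
theorem det_powers_snoc_ne_zero {g : ℕ} {x v w : Fin (g + 1) → ℝ} (hx : Function.Injective x)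
    {σ : ℝ} (hσ : σ ≠ 0) (hv : ∀ j, v j = σ * w j * ∏ k ∈ univ.erase j, (x j - x k))
    (hw : ∀ j, 0 ≤ w j) (hw' : ∃ j, 0 < w j) :
    (Matrix.of fun i j : Fin (g + 1) => if (i : ℕ) < g then x j ^ (i : ℕ) else v j).det ≠ 0 := by
  intro hdet
  obtain ⟨c, hc, hcM⟩ := Matrix.exists_vecMul_eq_zero_iff.2 hdet
  have hrel : ∀ j, ∑ i : Fin g, c i.castSucc * x j ^ (i : ℕ) + c (Fin.last g) * v j = 0 := by
    intro j
    have := congrFun hcM j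
    simpa [Matrix.vecMul, dotProduct, Fin.sum_univ_castSucc] using this
  have h0 := sum_eval_div_prod_eq_zero hx (fun i => c i.castSucc)
  have hlast : c (Fin.last g) = 0 := by
    have h1 : ∑ j, (∑ i : Fin g, c i.castSucc * x j ^ (i : ℕ)) /
        ∏ k ∈ univ.erase j, (x j - x k) = -(c (Fin.last g) * σ) * ∑ j, w j := by
      rw [mul_sum]
      refine sum_congr rfl fun j _ => ?_
      rw [eq_neg_of_add_eq_zero_left (hrel j), hv, div_eq_iff (prod_sub_ne_zero hx j)]
      ring
    have h2 : 0 < ∑ j, w j := by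
      obtain ⟨j, hj⟩ := hw'
      exact sum_pos' (fun j _ => hw j) ⟨j, mem_univ j, hj⟩
    rw [h0] at h1
    rcases mul_eq_zero.1 h1.symm with h | h
    · exact (mul_eq_zero.1 (neg_eq_zero.1 h)).resolve_right hσ
    · exact absurd h h2.ne'
  have hP : ∀ j, ∑ i : Fin (g + 1), c i * x j ^ (i : ℕ) = 0 := by
    intro j
    have := hrel j
    rw [hlast, zero_mul, add_zero] at this
    rw [Fin.sum_univ_castSucc, hlast, zero_mul, add_zero]
    exact this
  exact hc (eq_zero_of_forall_eval_eq_zero hx hP)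

/-- The analogue of `det_powers_snoc_ne_zero` with one of the points at infinity. -/
theorem det_powers_snoc_infty_ne_zero {g : ℕ} {x v w : Fin g → ℝ} (hx : Function.Injective x)
    {w₀ : ℝ} (hw₀ : 0 < w₀) (hv : ∀ j, v j = -(w j * ∏ k ∈ univ.erase j, (x j - x k)))
    (hw : ∀ j, 0 ≤ w j) {M : Matrix (Fin (g + 1)) (Fin (g + 1)) ℝ}
    (hM : ∀ i j : Fin g, M i.castSucc j.succ = x j ^ (i : ℕ))
    (hM₀ : ∀ i : Fin g, M i.castSucc 0 = if (i : ℕ) + 1 = g then 1 else 0)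
    (hMl : ∀ j : Fin g, M (Fin.last g) j.succ = v j) (hMl₀ : M (Fin.last g) 0 = w₀) :
    M.det ≠ 0 := by
  intro hdet
  obtain ⟨c, hc, hcM⟩ := Matrix.exists_vecMul_eq_zero_iff.2 hdet
  have hrel : ∀ j, ∑ i : Fin g, c i.castSucc * x j ^ (i : ℕ) + c (Fin.last g) * v j = 0 := by
    intro j
    have := congrFun hcM j.succ
    simpa [hM, hMl, Matrix.vecMul, dotProduct, Fin.sum_univ_castSucc] using this
  have hrel0 : ∑ i : Fin g, c i.castSucc * (if (i : ℕ) + 1 = g then 1 else 0) +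
      c (Fin.last g) * w₀ = 0 := by
    have := congrFun hcM 0
    simpa [hM₀, hMl₀, Matrix.vecMul, dotProduct, Fin.sum_univ_castSucc] using this
  have hlast : c (Fin.last g) = 0 := by
    -- For `g = 0` the matrix is the single entry `w₀`. Otherwise the column at infinity reads off
    -- the coefficient of `x ^ (g - 1)`, which the divided difference at the `g` finite points also
    -- computes. Comparing the two gives `c_last * (∑ w + w₀) = 0`.
    obtain _ | n := g
    · simpa [hw₀.ne'] using hrel0
    · have h0 := sum_eval_div_prod_eq_coeff hx (fun i => c i.castSucc)
      have h1 : ∑ j, (∑ i : Fin (n + 1), c i.castSucc * x j ^ (i : ℕ)) /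
          ∏ k ∈ univ.erase j, (x j - x k) = c (Fin.last (n + 1)) * ∑ j, w j := by
        rw [mul_sum]
        refine sum_congr rfl fun j _ => ?_
        rw [eq_neg_of_add_eq_zero_left (hrel j), hv, div_eq_iff (prod_sub_ne_zero hx j)]
        ring
      have h2 : ∑ i : Fin (n + 1), c i.castSucc * (if (i : ℕ) + 1 = n + 1 then 1 else 0) =
          c (Fin.last n).castSucc := by
        rw [Finset.sum_eq_single (Fin.last n)]
        · simp
        · intro i _ hi
          rw [if_neg, mul_zero]
          exact fun h => hi (Fin.ext (by simpa using h))
        · simp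
      rw [h2, ← h0, h1, ← mul_add] at hrel0
      have h3 : 0 < ∑ j, w j + w₀ := add_pos_of_nonneg_of_pos (sum_nonneg fun j _ => hw j) hw₀
      exact (mul_eq_zero.1 hrel0).resolve_right h3.ne'
  have hP : (fun i : Fin g => c i.castSucc) = 0 := by
    refine eq_zero_of_forall_eval_eq_zero hx fun j => ?_
    simpa [hlast] using hrel j
  refine hc (funext fun i => ?_)
  induction i using Fin.lastCases with
  | last => exact hlast
  | cast i => exact congrFun hP i

end LinearAlgebra

namespace GapSystem

variable {g : ℕ} (G : GapSystem g)

/-! ### The determinant of part (i) -/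

section Determinant

open Complex Finset

theorem ofReal_sub_ne_zero {z : ℂ} (hz : z.im ≠ 0) (x : ℝ) : z - x ≠ 0 := by
  intro h
  apply hz
  have := congrArg Complex.im h
  simpa using this

/-- The difference of the two Cauchy kernels is a multiple of the Poisson kernel. This links `𝔪` to
the last equation of the system. -/
theorem vandermondeType_last_eq {z : ℂ} (hz : z.im ≠ 0) (s : ℂ) (x : ℝ) :
    s / (z - x) - s / (starRingEnd ℂ z - x) =
      (-2 * z.im * I) * (s / ((‖(x : ℂ) - z‖ ^ 2 : ℝ) : ℂ)) := by
  have h1 := ofReal_sub_ne_zero hz x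
  have h2 : starRingEnd ℂ z - x ≠ 0 := ofReal_sub_ne_zero (by simpa using hz) x
  have h3 : ((‖(x : ℂ) - z‖ ^ 2 : ℝ) : ℂ) = (z - x) * (starRingEnd ℂ z - x) := by
    rw [norm_sub_rev, ← Complex.normSq_eq_norm_sq, ← Complex.mul_conj, map_sub, Complex.conj_ofReal]
  have h4 : z - starRingEnd ℂ z = 2 * z.im * I := by
    rw [Complex.sub_conj]; push_cast; ring
  rw [h3, div_sub_div _ _ h1 h2, ← mul_div_assoc]
  congr 1
  linear_combination (-s) * h4

/-- The determinant with rows `x_j ^ i` and last row `√T(x_j) / |x_j - z|²`. -/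
noncomputable def poissonDet (x : Fin (g + 1) → ℝ) (z : ℂ) : ℝ :=
  (Matrix.of fun i j : Fin (g + 1) =>
    if (i : ℕ) < g then x j ^ (i : ℕ) else (G.sqrtT (x j)).re / ‖(x j : ℂ) - z‖ ^ 2).det

theorem sqrtT_eq_ofReal_re {j : Fin (g + 1)} {x : ℝ}
    (hx : (x : OnePoint ℝ) ∈ G.closedGap j) : G.sqrtT x = ((G.sqrtT x).re : ℂ) :=
  Complex.ext rfl (G.sqrtT_im_of_mem_closedGap hx)

theorem det_vandermondeType {z : ℂ} (hz : z.im ≠ 0) {x : Fin (g + 1) → ℝ}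
    (hx : ∀ j, (x j : OnePoint ℝ) ∈ G.closedGap j) :
    (G.vandermondeType x z).det = (-2 * z.im * I) * (G.poissonDet x z : ℂ) := by
  have h : G.vandermondeType x z = Matrix.of fun i j : Fin (g + 1) =>
      (if (i : ℕ) < g then 1 else -2 * z.im * I) * ((Matrix.of fun i j : Fin (g + 1) =>
        if (i : ℕ) < g then x j ^ (i : ℕ) else (G.sqrtT (x j)).re / ‖(x j : ℂ) - z‖ ^ 2).map
          Complex.ofRealHom) i j := by
    ext i j
    simp only [vandermondeType, Matrix.of_apply, Matrix.map_apply]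
    split_ifs with hi
    · simp
    · rw [vandermondeType_last_eq hz, G.sqrtT_eq_ofReal_re (hx j)]; simp
  have h' := RingHom.map_det Complex.ofRealHom (Matrix.of fun i j : Fin (g + 1) =>
    if (i : ℕ) < g then x j ^ (i : ℕ) else (G.sqrtT (x j)).re / ‖(x j : ℂ) - z‖ ^ 2)
  rw [RingHom.mapMatrix_apply] at h'
  rw [h, Matrix.det_mul_column, ← h', poissonDet, Complex.ofRealHom_eq_coe]
  congr 1
  rw [Fin.prod_univ_castSucc]
  simp

theorem poissonDet_ne_zero {z : ℂ} (hz : z.im ≠ 0) {x : Fin (g + 1) → ℝ}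
    (hx : ∀ j, (x j : OnePoint ℝ) ∈ G.closedGap j) (hx' : ∃ j, (x j : OnePoint ℝ) ∈ G.gap j) :
    G.poissonDet x z ≠ 0 := by
  choose r hr hr' hre using G.sqrtT_eq_of_mem_closedGap hx
  have hn : ∀ j, 0 < ‖(x j : ℂ) - z‖ ^ 2 := fun j => by
    have := norm_pos_iff.2 (ofReal_sub_ne_zero hz (x j))
    rw [norm_sub_rev] at this
    positivity
  refine det_powers_snoc_ne_zero (w := fun j => r j / ‖(x j : ℂ) - z‖ ^ 2)
    (G.injective_of_mem_closedGap hx) (G.side_ne_zero (x 0)) (fun j => ?_)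
    (fun j => div_nonneg (hr j) (hn j).le) ?_
  · rw [hre j, Complex.ofReal_re]; ring
  · obtain ⟨j, hj⟩ := hx'
    exact ⟨j, div_pos (hr' j hj) (hn j)⟩

theorem det_vandermondeType_ne_zero {z : ℂ} (hz : z.im ≠ 0) {x : Fin (g + 1) → ℝ}
    (hx : ∀ j, (x j : OnePoint ℝ) ∈ G.closedGap j) (hx' : ∃ j, (x j : OnePoint ℝ) ∈ G.gap j) :
    (G.vandermondeType x z).det ≠ 0 := by
  rw [G.det_vandermondeType hz hx]
  refine mul_ne_zero (mul_ne_zero (mul_ne_zero (by norm_num) ?_) I_ne_zero) ?_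
  · exact_mod_cast hz
  · exact_mod_cast G.poissonDet_ne_zero hz hx hx'

theorem conj_frakM {z : ℂ} {x : Fin (g + 1) → ℝ}
    (hx : ∀ j, (x j : OnePoint ℝ) ∈ G.closedGap j) :
    starRingEnd ℂ (G.frakM x z) = G.frakM x (starRingEnd ℂ z) := by
  rw [frakM, frakM, RingHom.map_det, RingHom.mapMatrix_apply]
  congr 1
  ext i j
  simp only [Matrix.map_apply, Matrix.of_apply]
  split_ifs
  · simp
  · rw [map_div₀, map_sub, Complex.conj_ofReal, G.sqrtT_eq_ofReal_re (hx j), Complex.conj_ofReal]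

/-- The determinant is additive in its last row, and since `√T` is real on the closed gaps,
conjugating `𝔪` amounts to replacing `z` by its conjugate. -/
theorem det_vandermondeType_eq_sub {z : ℂ} {x : Fin (g + 1) → ℝ}
    (hx : ∀ j, (x j : OnePoint ℝ) ∈ G.closedGap j) :
    (G.vandermondeType x z).det = G.frakM x z - starRingEnd ℂ (G.frakM x z) := by
  rw [G.conj_frakM hx, eq_sub_iff_add_eq]
  set N : Matrix (Fin (g + 1)) (Fin (g + 1)) ℂ := Matrix.of fun i j => (x j : ℂ) ^ (i : ℕ)
  have key : ∀ v : Fin (g + 1) → ℂ, (Matrix.of fun i j : Fin (g + 1) =>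
      if (i : ℕ) < g then (x j : ℂ) ^ (i : ℕ) else v j) = N.updateRow (Fin.last g) v := by
    intro v
    ext i j
    induction i using Fin.lastCases with
    | last => simp
    | cast i => simp [N]
  rw [vandermondeType, frakM, frakM, key (fun j => G.sqrtT (x j) / (z - x j) -
    G.sqrtT (x j) / (starRingEnd ℂ z - x j)), key (fun j => G.sqrtT (x j) / (z - x j)),
    key (fun j => G.sqrtT (x j) / (starRingEnd ℂ z - x j)), ← Matrix.det_updateRow_add]
  congr 2
  ext j
  simp

end Determinant

end GapSystem

/-! ### Maximum principle on the sphere and identification of the Perron solution -/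

section Perron

open Filter Metric

open Classical in
/-- The chart `ζ ↦ -1/ζ` of the Riemann sphere at infinity. -/
noncomputable def sphereInv (ζ : ℂ) : OnePoint ℂ :=
  if ζ = 0 then OnePoint.infty else ((-ζ⁻¹ : ℂ) : OnePoint ℂ)

@[simp] theorem sphereInv_zero : sphereInv 0 = OnePoint.infty := by simp [sphereInv]

theorem sphereInv_of_ne {ζ : ℂ} (h : ζ ≠ 0) : sphereInv ζ = ((-ζ⁻¹ : ℂ) : OnePoint ℂ) := by
  simp [sphereInv, h]

/-- `h` is locally the real part of an analytic function on the subset `Ω` of the sphere. -/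
structure IsLocallyRe (h : OnePoint ℂ → ℝ) (Ω : Set (OnePoint ℂ)) : Prop where
  finite : ∀ p : ℂ, (p : OnePoint ℂ) ∈ Ω →
    ∃ G : ℂ → ℂ, AnalyticAt ℂ G p ∧ ∀ᶠ w : ℂ in 𝓝 p, h (w : OnePoint ℂ) = (G w).re
  infinite : OnePoint.infty ∈ Ω →
    ∃ G : ℂ → ℂ, AnalyticAt ℂ G 0 ∧ ∀ᶠ ζ in 𝓝 0, h (sphereInv ζ) = (G ζ).re

namespace IsLocallyRe

variable {h : OnePoint ℂ → ℝ} {Ω : Set (OnePoint ℂ)}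

theorem circleAverage_eq (hh : IsLocallyRe h Ω) {c : ℂ} {R : ℝ} (hR : 0 < R)
    (hc : ∀ w : ℂ, ‖w - c‖ ≤ R → (w : OnePoint ℂ) ∈ Ω) :
    Real.circleAverage (fun w : ℂ => h (w : OnePoint ℂ)) c R = h (c : OnePoint ℂ) := by
  refine InnerProductSpace.HarmonicOnNhd.circleAverage_eq (f := fun w : ℂ => h (w : OnePoint ℂ))
    fun w hw => ?_
  rw [abs_of_pos hR, mem_closedBall_iff_norm] at hw
  obtain ⟨G, hG, he⟩ := hh.finite w (hc w hw)
  exact (InnerProductSpace.harmonicAt_congr_nhds he).2 hG.harmonicAt_re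

/-- Under `w = c + 1/ζ` the exterior of the disc becomes a disc about `0` and circle averages are
preserved, so this is the ordinary mean value property at `ζ = 0`. -/
theorem circleAverage_eq_infty (hh : IsLocallyRe h Ω) (hΩ : OnePoint.infty ∈ Ω) {c : ℂ} {R : ℝ}
    (hR : 0 < R) (hc : ∀ w : ℂ, R ≤ ‖w - c‖ → (w : OnePoint ℂ) ∈ Ω) :
    Real.circleAverage (fun w : ℂ => h (w : OnePoint ℂ)) c R = h OnePoint.infty := by
  classical
  set u : ℂ → ℝ := fun ζ => if ζ = 0 then h OnePoint.infty else h ((c + ζ⁻¹ : ℂ) : OnePoint ℂ)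
    with hu
  have hu0 : u 0 = h OnePoint.infty := by simp [hu]
  have havg : Real.circleAverage (fun w : ℂ => h (w : OnePoint ℂ)) c R =
      Real.circleAverage u 0 R⁻¹ := by
    rw [Real.circleAverage_eq_circleAverage_zero_one, ← Real.circleAverage_zero_one_congr_inv,
      Real.circleAverage_eq_circleAverage_zero_one (R := R⁻¹)]
    refine Real.circleAverage_congr_sphere fun z hz => ?_
    have hz0 : z ≠ 0 := by
      rintro rfl
      simp at hz
    have hR' : (R : ℂ) ≠ 0 := by exact_mod_cast hR.ne'
    have : ((R⁻¹ : ℝ) : ℂ) * z + 0 ≠ 0 := by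
      rw [add_zero]; push_cast; exact mul_ne_zero (inv_ne_zero hR') hz0
    simp only [hu, if_neg this]
    congr 2
    rw [add_zero, Complex.ofReal_inv, mul_inv, inv_inv, add_comm]
  rw [havg, ← hu0]
  refine InnerProductSpace.HarmonicOnNhd.circleAverage_eq fun ζ hζ => ?_
  rw [abs_of_pos (inv_pos.2 hR), mem_closedBall_zero_iff] at hζ
  by_cases h0 : ζ = 0
  · subst h0
    obtain ⟨G, hG, he⟩ := hh.infinite hΩ
    -- `η` is the transition from the coordinate `ζ` with `w = c + 1/ζ` to the standard coordinate
    -- `-1/w` at infinity.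
    set η : ℂ → ℂ := fun ζ => -ζ / (1 + c * ζ) with hη
    have hη0 : η 0 = 0 := by simp [hη]
    have hηa : AnalyticAt ℂ η 0 := by
      refine AnalyticAt.div (by fun_prop) (by fun_prop) (by simp)
    have hGη : AnalyticAt ℂ (fun ζ => G (η ζ)) 0 := AnalyticAt.comp (g := G) (by rwa [hη0]) hηa
    have hne : ∀ᶠ ζ in 𝓝 (0 : ℂ), 1 + c * ζ ≠ 0 := by
      refine ContinuousAt.eventually_ne (by fun_prop) (by simp)
    have ht : Tendsto η (𝓝 0) (𝓝 0) := by
      have := hηa.continuousAt.tendsto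
      rwa [hη0] at this
    refine (InnerProductSpace.harmonicAt_congr_nhds ?_).2 hGη.harmonicAt_re
    filter_upwards [ht.eventually he, hne] with ζ h1 h2
    rw [← h1]
    by_cases hz : ζ = 0
    · subst hz; rw [hη0, sphereInv_zero, hu0]
    · have : η ζ ≠ 0 := div_ne_zero (neg_ne_zero.2 hz) h2
      rw [sphereInv_of_ne this]
      simp only [hu, if_neg hz, hη]
      congr 2
      field_simp
      ring
  · have hmem : ((c + ζ⁻¹ : ℂ) : OnePoint ℂ) ∈ Ω := by
      apply hc
      rw [add_sub_cancel_left, norm_inv]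
      exact (le_inv_comm₀ hR (norm_pos_iff.2 h0)).2 hζ
    obtain ⟨G, hG, he⟩ := hh.finite _ hmem
    have hm : AnalyticAt ℂ (fun ζ : ℂ => c + ζ⁻¹) ζ := by
      refine analyticAt_const.add (analyticAt_inv h0)
    have hGη : AnalyticAt ℂ (fun ζ => G (c + ζ⁻¹)) ζ := AnalyticAt.comp (g := G) hG hm
    refine (InnerProductSpace.harmonicAt_congr_nhds ?_).2 hGη.harmonicAt_re
    filter_upwards [hm.continuousAt.tendsto.eventually he, eventually_ne_nhds h0] with ζ h1 h2
    simp only [hu, if_neg h2]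
    exact h1

theorem isSubharmonicOn (hh : IsLocallyRe h Ω) (hcont : ContinuousOn h Ω) :
    IsSubharmonicOn h Ω :=
  ⟨hcont, fun _ _ hR hc => (hh.circleAverage_eq hR hc).ge,
    fun hΩ _ _ hR hc => (hh.circleAverage_eq_infty hΩ hR hc).ge⟩

end IsLocallyRe

theorem eq_of_le_circleAverage {φ : ℂ → ℝ} {c : ℂ} {R M : ℝ} (hR : 0 ≤ R)
    (hφ : ContinuousOn φ (sphere c R)) (hM : ∀ w ∈ sphere c R, φ w ≤ M)
    (havg : M ≤ Real.circleAverage φ c R) : ∀ w ∈ sphere c R, φ w = M := by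
  intro w hw
  by_contra hne
  have hlt : φ w < M := lt_of_le_of_ne (hM w hw) hne
  rw [← abs_of_nonneg hR, ← image_circleMap_Ioc] at hw
  obtain ⟨θ, hθ, rfl⟩ := hw
  have hcont : Continuous fun t => φ (circleMap c R t) :=
    hφ.comp_continuous (continuous_circleMap c R) fun t => circleMap_mem_sphere c hR t
  have hpos : 0 < ∫ t in (0 : ℝ)..2 * Real.pi, (M - φ (circleMap c R t)) :=
    intervalIntegral.integral_pos Real.two_pi_pos (continuous_const.sub hcont).continuousOn
      (fun t _ => sub_nonneg.2 (hM _ (circleMap_mem_sphere c hR t)))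
      ⟨θ, Set.Ioc_subset_Icc_self hθ, sub_pos.2 hlt⟩
  rw [intervalIntegral.integral_sub (by simp) (hcont.intervalIntegrable _ _),
    intervalIntegral.integral_const, sub_zero, smul_eq_mul] at hpos
  rw [Real.circleAverage_def, smul_eq_mul, ← div_eq_inv_mul, le_div_iff₀ Real.two_pi_pos] at havg
  linarith

/-- The positive part of `v - h`, extended by `0` to `E`, is continuous on the compact sphere and
attains its maximum. If the maximum were positive, the sub-mean value property would make the set
where it is attained open. This set is also closed, so it would be the whole connected sphere,
including `E`, where the function vanishes. -/
theorem le_of_mem_perronClass {E F : Set (OnePoint ℂ)} (hE : IsClosed E) (hE' : E.Nonempty)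
    {h : OnePoint ℂ → ℝ} (hcont : Continuous h) (hloc : IsLocallyRe h Eᶜ)
    (hb : ∀ p ∈ E, h p = F.indicator (fun _ => (1 : ℝ)) p) {v : OnePoint ℂ → ℝ}
    (hv : v ∈ PerronClass E F) {p : OnePoint ℂ} (hp : p ∉ E) : v p ≤ h p := by
  classical
  obtain ⟨hsub, hlim⟩ := hv
  set u : OnePoint ℂ → ℝ := fun q => if q ∈ E then 0 else max (v q - h q) 0 with hu
  have huE : ∀ q ∈ E, u q = 0 := fun q hq => by simp [hu, hq]
  have huE' : ∀ q ∉ E, u q = max (v q - h q) 0 := fun q hq => by simp [hu, hq]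
  have hunonneg : ∀ q, 0 ≤ u q := fun q => by
    by_cases hq : q ∈ E
    · rw [huE q hq]
    · rw [huE' q hq]; exact le_max_right _ _
  have hucont : Continuous u := by
    rw [continuous_iff_continuousAt]
    intro q
    by_cases hq : q ∈ E
    -- Continuity at points of `E` is where the upper limits of the Perron class enter: they bound
    -- `v - h` above by any positive number near `q`, while the lower bound is trivial.
    · rw [ContinuousAt, huE q hq, tendsto_order]
      refine ⟨fun m hm => Eventually.of_forall fun q => hm.trans_le (hunonneg q), fun m hm => ?_⟩
      have h1 := hlim q hq (F.indicator (fun _ => (1 : ℝ)) q + m / 2) (by linarith)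
      have h2 : ∀ᶠ w in 𝓝 q, h q - m / 2 < h w :=
        hcont.continuousAt.eventually (lt_mem_nhds (by linarith))
      rw [eventually_nhdsWithin_iff] at h1
      filter_upwards [h1, h2] with w h1 h2
      by_cases hw : w ∈ E
      · rwa [huE w hw]
      · have := h1 hw
        rw [hb q hq] at h2
        rw [huE' w hw]
        exact max_lt (by linarith) hm
    · have hn : Eᶜ ∈ 𝓝 q := hE.isOpen_compl.mem_nhds hq
      have : ContinuousAt (fun q => max (v q - h q) 0) q :=
        ((hsub.continuousOn.continuousAt hn).sub hcont.continuousAt).max continuousAt_const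
      refine this.congr ?_
      filter_upwards [hn] with w hw
      exact (huE' w hw).symm
  obtain ⟨q, -, hq⟩ := isCompact_univ.exists_isMaxOn (Set.univ_nonempty (α := OnePoint ℂ))
    hucont.continuousOn
  have hmax : ∀ w, u w ≤ u q := fun w => hq (Set.mem_univ w)
  suffices hle : u q ≤ 0 by
    have := (hmax p).trans hle
    rw [huE' p hp] at this
    linarith [le_max_left (v p - h p) 0]
  by_contra! hM
  have hvh : ∀ w, w ∉ E → v w - h w ≤ u q := fun w hw =>
    (le_max_left _ _).trans ((huE' w hw).symm.le.trans (hmax w))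
  have heq : ∀ w, u w = u q → w ∉ E ∧ v w - h w = u q := by
    intro w hw
    have hwE : w ∉ E := fun hwE => by rw [huE w hwE] at hw; linarith
    refine ⟨hwE, ?_⟩
    rw [huE' w hwE] at hw
    rcases max_choice (v w - h w) 0 with h' | h'
    · rw [← hw, h']
    · rw [h'] at hw; linarith
  have heq' : ∀ w, w ∉ E → v w - h w = u q → u w = u q := fun w hw h' => by
    rw [huE' w hw, h', max_eq_left hM.le]
  have hcirc : ∀ (c : ℂ) (R : ℝ), 0 < R → (∀ w ∈ sphere c R, (w : OnePoint ℂ) ∉ E) →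
      u q ≤ Real.circleAverage (fun w : ℂ => v (w : OnePoint ℂ)) c R -
        Real.circleAverage (fun w : ℂ => h (w : OnePoint ℂ)) c R →
      ∀ w ∈ sphere c R, u (w : OnePoint ℂ) = u q := by
    intro c R hR hs havg w hw
    have hvc : ContinuousOn (fun w : ℂ => v (w : OnePoint ℂ)) (sphere c R) :=
      hsub.continuousOn.comp OnePoint.continuous_coe.continuousOn fun w hw => hs w hw
    have hhc : ContinuousOn (fun w : ℂ => h (w : OnePoint ℂ)) (sphere c R) :=
      (hcont.comp OnePoint.continuous_coe).continuousOn
    have hi : ∀ {f : ℂ → ℝ}, ContinuousOn f (sphere c R) → CircleIntegrable f c R :=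
      fun hf => hf.circleIntegrable hR.le
    rw [← Real.circleAverage_sub (hi hvc) (hi hhc)] at havg
    exact heq' w (hs w hw) (eq_of_le_circleAverage hR.le (hvc.sub hhc)
      (fun w hw => hvh w (hs w hw)) havg w hw)
  have hclopen : IsClopen {w | u w = u q} := by
    refine ⟨isClosed_eq hucont continuous_const, isOpen_iff_mem_nhds.2 fun w hw => ?_⟩
    obtain ⟨hwE, hw'⟩ := heq w hw
    have hn : Eᶜ ∈ 𝓝 w := hE.isOpen_compl.mem_nhds hwE
    induction w using OnePoint.rec with
    | infty =>
      rw [OnePoint.nhds_infty_eq, mem_sup] at hn ⊢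
      refine ⟨?_, by simpa using hw⟩
      have hn1 := hn.1
      rw [mem_map, coclosedCompact_eq_cocompact, ← cobounded_eq_cocompact] at hn1 ⊢
      obtain ⟨R, hR, hRs⟩ := hasBasis_cobounded_norm.mem_iff.1 hn1 |>.imp fun R h => h
      have hout : ∀ w : ℂ, max R 1 ≤ ‖w‖ → (w : OnePoint ℂ) ∉ E :=
        fun w hw => hRs (show R ≤ ‖w‖ from (le_max_left _ _).trans hw)
      -- Every `w` far out lies on the circle `|w'| = ‖w‖`, whose exterior avoids `E`. Equality in
      -- the mean value inequality at infinity on this circle forces the maximum at `w`.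
      refine hasBasis_cobounded_norm.mem_iff.2 ⟨max R 1, trivial, fun w hw => ?_⟩
      have hw1 : max R 1 ≤ ‖w‖ := hw
      have hwpos : 0 < ‖w‖ := lt_of_lt_of_le one_pos ((le_max_right _ _).trans hw1)
      have hout' : ∀ w' : ℂ, ‖w‖ ≤ ‖w' - 0‖ → (w' : OnePoint ℂ) ∈ Eᶜ := fun w' h' =>
        hout w' (hw1.trans (by simpa using h'))
      refine hcirc 0 ‖w‖ hwpos (fun w' h' => ?_) ?_ w (by simp)
      · exact hout' w' (by rw [mem_sphere_iff_norm] at h'; exact h'.ge)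
      · rw [hloc.circleAverage_eq_infty hwE hwpos hout', ← hw']
        exact sub_le_sub_right (hsub.le_circleAverage_infty hwE 0 _ hwpos hout') _
    | coe c =>
      rw [OnePoint.nhds_coe_eq, mem_map] at hn ⊢
      obtain ⟨r, hr, hrs⟩ := Metric.mem_nhds_iff.1 hn
      refine Metric.mem_nhds_iff.2 ⟨r, hr, fun w hwb => ?_⟩
      by_cases hwc : w = c
      · subst hwc; exact hw
      have hwpos : 0 < ‖w - c‖ := norm_pos_iff.2 (sub_ne_zero.2 hwc)
      have hin : ∀ w' : ℂ, ‖w' - c‖ ≤ ‖w - c‖ → (w' : OnePoint ℂ) ∈ Eᶜ := fun w' h' =>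
        hrs (mem_ball_iff_norm.2 (h'.trans_lt (mem_ball_iff_norm.1 hwb)))
      refine hcirc c ‖w - c‖ hwpos (fun w' h' => ?_) ?_ w (by simp)
      · exact hin w' (by rw [mem_sphere_iff_norm] at h'; exact h'.le)
      · rw [hloc.circleAverage_eq hwpos hin, ← hw']
        exact sub_le_sub_right (hsub.le_circleAverage c _ hwpos hin) _
  have huniv := hclopen.eq_univ ⟨q, rfl⟩
  obtain ⟨e, he⟩ := hE'
  have : u e = u q := by
    have : e ∈ {w | u w = u q} := huniv ▸ Set.mem_univ e
    exact this
  rw [huE e he] at this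
  linarith

/-- A continuous function on the sphere with the right boundary values which is locally the real
part of an analytic function off `E` is the harmonic measure. -/
theorem harmonicMeasure_eq {E F : Set (OnePoint ℂ)} (hE : IsClosed E) (hE' : E.Nonempty)
    {h : OnePoint ℂ → ℝ} (hcont : Continuous h) (hloc : IsLocallyRe h Eᶜ)
    (hb : ∀ p ∈ E, h p = F.indicator (fun _ => (1 : ℝ)) p) (p : OnePoint ℂ) :
    harmonicMeasure E F p = h p := by
  by_cases hp : p ∈ E
  · rw [harmonicMeasure, if_pos hp, hb p hp]
  · rw [harmonicMeasure, if_neg hp]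
    refine IsGreatest.csSup_eq ⟨⟨h, ⟨hloc.isSubharmonicOn hcont.continuousOn, ?_⟩, rfl⟩, ?_⟩
    · intro ζ hζ m hm
      rw [← hb ζ hζ] at hm
      exact nhdsWithin_le_nhds (hcont.continuousAt.eventually (gt_mem_nhds hm))
    · rintro _ ⟨v, hv, rfl⟩
      exact le_of_mem_perronClass hE hE' hcont hloc hb hv hp

end Perron

/-! ### A square root with downward cut -/

section BranchRoot

open Complex

/-- The square root which is analytic off the downward vertical half-line and agrees with the
principal one on the closed upper half-plane. -/
noncomputable def branchRoot (w : ℂ) : ℂ := exp (Real.pi / 4 * I) * (-I * w) ^ (1 / 2 : ℂ)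

theorem branchRoot_sq (w : ℂ) : branchRoot w ^ 2 = w := by
  have h1 : ((-I * w) ^ (1 / 2 : ℂ)) ^ 2 = -I * w := by simp only [one_div, cpow_ofNat_inv_pow]
  have h2 : exp (Real.pi / 4 * I) ^ 2 = I := by
    rw [← Complex.exp_nat_mul, show ((2 : ℕ) : ℂ) * (Real.pi / 4 * I) = Real.pi / 2 * I by
      push_cast; ring, Complex.exp_pi_div_two_mul_I]
  rw [branchRoot, mul_pow, h1, h2]
  linear_combination (-w) * I_mul_I

theorem norm_branchRoot_sq (w : ℂ) : ‖branchRoot w‖ ^ 2 = ‖w‖ := by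
  rw [← norm_pow, branchRoot_sq]

theorem branchRoot_ne_zero {w : ℂ} (hw : w ≠ 0) : branchRoot w ≠ 0 := fun h => by
  apply hw; rw [← branchRoot_sq w, h]; norm_num

theorem analyticAt_branchRoot {w : ℂ} (hw : 0 < w.im ∨ w.re ≠ 0) : AnalyticAt ℂ branchRoot w := by
  refine analyticAt_const.mul (AnalyticAt.cpow (by fun_prop) analyticAt_const ?_)
  rw [Complex.mem_slitPlane_iff]
  simpa using hw

theorem arg_neg_I_add_mem {w : ℂ} (hw : 0 ≤ w.im) :
    (-I).arg + w.arg ∈ Set.Ioc (-Real.pi) Real.pi := by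
  have h1 := Complex.arg_nonneg_iff.2 hw
  have h2 := Complex.arg_le_pi w
  have := Real.pi_pos
  rw [Complex.arg_neg_I]
  constructor <;> linarith

/-- For `w` in the closed upper half-plane, multiplication by `-I` lowers the argument by `π/2`
without leaving `(-π, π]`, so the logarithms add and the factor `exp (π i / 4)` compensates. -/
theorem branchRoot_eq_cpow {w : ℂ} (hw : 0 ≤ w.im) : branchRoot w = w ^ (1 / 2 : ℂ) := by
  rcases eq_or_ne w 0 with rfl | h0
  · simp [branchRoot]
  have hlog := (Complex.log_mul_eq_add_log_iff (neg_ne_zero.2 I_ne_zero) h0).2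
    (arg_neg_I_add_mem hw)
  rw [branchRoot, Complex.cpow_def_of_ne_zero (mul_ne_zero (neg_ne_zero.2 I_ne_zero) h0),
    Complex.cpow_def_of_ne_zero h0, hlog, Complex.log_neg_I, ← Complex.exp_add]
  congr 1
  ring

end BranchRoot

/-! ### Hyperelliptic integrals along vertical rays -/

section BranchIntegral

open Complex Filter MeasureTheory

variable {ι : Type*} {e : ι → ℝ}

/-- `w` does not lie on the vertical half-lines pointing downwards from the points `e k`. -/
def IsRegularPoint (e : ι → ℝ) (w : ℂ) : Prop := ∀ k, 0 < w.im ∨ w.re ≠ e k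

theorem IsRegularPoint.sub_ne_zero {w : ℂ} (hw : IsRegularPoint e w) (k : ι) : w - e k ≠ 0 := by
  intro h
  have h1 := congrArg Complex.re h
  have h2 := congrArg Complex.im h
  simp at h1 h2
  rcases hw k with h | h
  · exact h.ne' h2
  · exact h (by linarith)

theorem IsRegularPoint.add_mul_I {w : ℂ} (hw : IsRegularPoint e w) {t : ℝ} (ht : 0 ≤ t) :
    IsRegularPoint e (w + t * I) := fun k => by
  rcases hw k with h | h
  · left; simp; linarith
  · right; simpa using h

theorem isRegularPoint_of_im_pos {w : ℂ} (hw : 0 < w.im) : IsRegularPoint e w := fun _ => Or.inl hw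

theorem isRegularPoint_add_mul_I {w : ℂ} (hw : 0 ≤ w.im) {t : ℝ} (ht : 0 < t) :
    IsRegularPoint e (w + t * I) :=
  isRegularPoint_of_im_pos (by simp; linarith)

variable [Fintype ι]

/-- `w ^ n` divided by the branch of the square root of `∏ (w - e k)` which is analytic off the
vertical half-lines pointing downwards from the points `e k`. -/
noncomputable def branchFun (e : ι → ℝ) (n : ℕ) (w : ℂ) : ℂ := w ^ n / ∏ k, branchRoot (w - e k)

/-- A primitive of `branchFun` vanishing at infinity. -/
noncomputable def branchPrim (e : ι → ℝ) (n : ℕ) (w : ℂ) : ℂ :=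
  -I * ∫ t in Set.Ioi (0 : ℝ), branchFun e n (w + t * I)

variable {n : ℕ}

theorem IsRegularPoint.eventually {w : ℂ} (hw : IsRegularPoint e w) :
    ∀ᶠ w' in 𝓝 w, IsRegularPoint e w' := by
  refine eventually_all.2 fun k => ?_
  rcases hw k with h | h
  · filter_upwards [Complex.continuous_im.continuousAt.eventually (lt_mem_nhds h)] with w h
    exact Or.inl h
  · filter_upwards [Complex.continuous_re.continuousAt.eventually_ne h] with w h
    exact Or.inr h

theorem analyticAt_branchFun {w : ℂ} (hw : IsRegularPoint e w) :
    AnalyticAt ℂ (branchFun e n) w := by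
  refine AnalyticAt.div (by fun_prop) ?_ ?_
  · refine Finset.analyticAt_fun_prod _ fun k _ => ?_
    refine AnalyticAt.fun_comp (g := branchRoot) (analyticAt_branchRoot ?_) (by fun_prop)
    rcases hw k with h | h
    · left; simpa using h
    · right; simpa [_root_.sub_eq_zero] using h
  · exact Finset.prod_ne_zero_iff.2 fun k _ => branchRoot_ne_zero (hw.sub_ne_zero k)

theorem norm_branchFun_sq (w : ℂ) :
    ‖branchFun e n w‖ ^ 2 = ‖w‖ ^ (2 * n) / ∏ k, ‖w - e k‖ := by
  rw [branchFun, norm_div, div_pow, norm_pow, norm_prod, ← Finset.prod_pow]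
  simp_rw [norm_branchRoot_sq]
  rw [← pow_mul, mul_comm]

/-- The function dominating `t ↦ branchFun e n (w + i t)`. -/
noncomputable def branchBound (t : ℝ) : ℝ := √(1 / (t * (1 + t) ^ 3))

theorem integrableOn_branchBound : IntegrableOn branchBound (Set.Ioi 0) := by
  have hm : AEStronglyMeasurable branchBound (volume.restrict (Set.Ioi 0)) := by
    refine ContinuousOn.aestronglyMeasurable (fun t ht => ContinuousAt.continuousWithinAt ?_)
      measurableSet_Ioi
    have ht' : 0 < t := ht
    have : t * (1 + t) ^ 3 ≠ 0 := by positivity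
    have hd : ContinuousAt (fun t : ℝ => 1 / (t * (1 + t) ^ 3)) t :=
      ContinuousAt.div (by fun_prop) (by fun_prop) this
    exact hd.sqrt
  have h01 : IntegrableOn branchBound (Set.Ioc 0 1) := by
    have hi : IntegrableOn (fun t : ℝ => t ^ (-(1 / 2) : ℝ)) (Set.Ioc 0 1) :=
      (intervalIntegrable_iff_integrableOn_Ioc_of_le zero_le_one).1
        (intervalIntegral.intervalIntegrable_rpow' (by norm_num))
    refine Integrable.mono' hi (hm.mono_set Set.Ioc_subset_Ioi_self) ?_
    refine (ae_restrict_iff' measurableSet_Ioc).2 (Eventually.of_forall fun t ht => ?_)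
    rw [branchBound, Real.norm_of_nonneg (Real.sqrt_nonneg _), Real.rpow_neg ht.1.le,
      ← Real.sqrt_eq_rpow, ← Real.sqrt_inv]
    refine Real.sqrt_le_sqrt ?_
    rw [one_div]
    refine inv_anti₀ ht.1 (le_mul_of_one_le_right ht.1.le (one_le_pow₀ ?_))
    linarith [ht.1]
  have h1 : IntegrableOn branchBound (Set.Ioi 1) := by
    have hi : IntegrableOn (fun t : ℝ => t ^ (-2 : ℝ)) (Set.Ioi 1) :=
      integrableOn_Ioi_rpow_of_lt (by norm_num) one_pos
    refine Integrable.mono' hi (hm.mono_set (Set.Ioi_subset_Ioi zero_le_one)) ?_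
    refine (ae_restrict_iff' measurableSet_Ioi).2 (Eventually.of_forall fun t ht => ?_)
    have ht' : (1 : ℝ) < t := ht
    have ht0 : 0 < t := one_pos.trans ht'
    rw [branchBound, Real.norm_of_nonneg (Real.sqrt_nonneg _), Real.rpow_neg ht0.le]
    refine Real.sqrt_le_iff.2 ⟨by positivity, ?_⟩
    rw [Real.rpow_two, one_div, ← inv_pow, ← pow_mul, inv_pow]
    refine inv_anti₀ (by positivity) ?_
    calc t ^ (2 * 2) = t * t ^ 3 := by ring
      _ ≤ t * (1 + t) ^ 3 := by gcongr; linarith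
  rw [← Set.Ioc_union_Ioi_eq_Ioi zero_le_one]
  exact h01.union h1

theorem tendsto_branchBound : Tendsto branchBound atTop (𝓝 0) := by
  have h : Tendsto (fun t : ℝ => t * (1 + t) ^ 3) atTop atTop := by
    refine tendsto_atTop_mono' _ ?_ tendsto_id
    filter_upwards [eventually_ge_atTop 0] with t ht
    exact le_mul_of_one_le_right ht (one_le_pow₀ (by linarith))
  have h2 := (Real.continuous_sqrt.tendsto 0).comp (tendsto_inv_atTop_zero.comp h)
  rw [Real.sqrt_zero] at h2
  refine h2.congr fun t => ?_
  simp [branchBound]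

/-- For large `t` the vertical displacement dominates; for small `t` regularity keeps the ray away
from `x`. Both estimates are uniform near `w₀`. -/
theorem eventually_le_norm_of_regular {w₀ : ℂ} {x : ℝ} (h : 0 < w₀.im ∨ w₀.re ≠ x) :
    ∃ c : ℝ, 0 < c ∧ ∀ᶠ w in 𝓝 w₀, ∀ t : ℝ, 0 < t → c * (1 + t) ≤ ‖w + t * I - x‖ := by
  obtain ⟨α, β, hα, hβ, hev⟩ : ∃ α β : ℝ, 0 < α ∧ 0 ≤ β ∧ ∀ᶠ w in 𝓝 w₀, ∀ t : ℝ, 0 < t →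
      α ≤ ‖w + t * I - x‖ ∧ t - β ≤ ‖w + t * I - x‖ := by
    have him : ∀ (w : ℂ) (t : ℝ), w.im + t ≤ ‖w + t * I - x‖ := fun w t => by
      have := Complex.im_le_norm (w + t * I - x)
      simpa using this
    rcases h with h | h
    · refine ⟨w₀.im / 2, 0, by positivity, le_rfl, ?_⟩
      filter_upwards [Complex.continuous_im.continuousAt.eventually
        (lt_mem_nhds (half_lt_self h))] with w hw t ht
      have := him w t
      constructor <;> linarith
    · have hpos : 0 < |w₀.re - x| := abs_pos.2 (_root_.sub_ne_zero.2 h)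
      refine ⟨|w₀.re - x| / 2, |w₀.im| + 1, by positivity, by positivity, ?_⟩
      have hc : ContinuousAt (fun w : ℂ => |w.re - x|) w₀ := by fun_prop
      filter_upwards [hc.eventually (lt_mem_nhds (half_lt_self hpos)),
        Complex.continuous_im.continuousAt.eventually
          (lt_mem_nhds (show w₀.im - 1 < w₀.im by linarith))] with w hw hw' t ht
      have h1 := him w t
      have h2 : |w.re - x| ≤ ‖w + t * I - x‖ := by
        have := Complex.abs_re_le_norm (w + t * I - x)
        simpa using this
      have h3 := neg_abs_le w₀.im
      constructor <;> linarith
  -- Weighting the lower bounds `α` and `t - β` by `β + 1` and `α` and adding them gives `α * (1 +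
  -- t)`.
  refine ⟨α / (α + β + 1), by positivity, ?_⟩
  filter_upwards [hev] with w hw t ht
  obtain ⟨h1, h2⟩ := hw t ht
  have : 0 < α + β + 1 := by positivity
  rw [div_mul_eq_mul_div, div_le_iff₀ this]
  nlinarith

theorem le_norm_of_im_nonneg {w : ℂ} (hw : 0 ≤ w.im) (t x : ℝ) : t ≤ ‖w + t * I - x‖ := by
  have := Complex.im_le_norm (w + t * I - x)
  have h2 : (w + t * I - x).im = w.im + t := by simp
  linarith

theorem norm_branchFun_le_of_sq_le {w : ℂ} {K t : ℝ} (hK : 0 ≤ K)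
    (h : ‖branchFun e n w‖ ^ 2 ≤ K * (1 / (t * (1 + t) ^ 3))) :
    ‖branchFun e n w‖ ≤ √K * branchBound t := by
  rw [branchBound, ← Real.sqrt_mul hK]
  exact Real.le_sqrt_of_sq_le h

/-- One factor `w + i t - e k₀` may be as small as a multiple of `t`, which costs only an integrable
`t ^ (-1/2)`. All other factors are at least a multiple of `1 + t`. As there are at least `2n + 4`
factors, the power `w ^ n` is absorbed and decay of order `t ^ (-2)` remains. -/
theorem exists_bound (hn : 2 * n + 4 ≤ Fintype.card ι) {w₀ : ℂ} {l : Filter ℂ} (hl : l ≤ 𝓝 w₀)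
    (k₀ : ι) (h₀ : ∃ c : ℝ, 0 < c ∧ ∀ᶠ w in l, ∀ t : ℝ, 0 < t → c * t ≤ ‖w + t * I - e k₀‖)
    (h : ∀ k, k ≠ k₀ → 0 < w₀.im ∨ w₀.re ≠ e k) :
    ∃ K : ℝ, ∀ᶠ w in l, ∀ t : ℝ, 0 < t → ‖branchFun e n (w + t * I)‖ ≤ K * branchBound t := by
  classical
  obtain ⟨c₀, hc₀, hev₀⟩ := h₀
  choose! c hc hev using fun k hk => eventually_le_norm_of_regular (h k hk)
  set N := Fintype.card ι with hN
  have hcard : (Finset.univ.erase k₀).card = N - 1 := by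
    rw [Finset.card_erase_of_mem (Finset.mem_univ _), Finset.card_univ]
  set c' := c₀ * ∏ k ∈ Finset.univ.erase k₀, c k with hc'
  have hc'pos : 0 < c' :=
    mul_pos hc₀ (Finset.prod_pos fun k hk => hc k (Finset.ne_of_mem_erase hk))
  set B := ‖w₀‖ + 1 with hB
  have hBpos : 1 ≤ B := by have := norm_nonneg w₀; linarith
  have hnorm : ∀ᶠ w in l, ‖w‖ < B :=
    hl (continuous_norm.continuousAt.eventually (gt_mem_nhds (by linarith)))
  have hall : ∀ᶠ w in l, ∀ k, k ≠ k₀ → ∀ t : ℝ, 0 < t → c k * (1 + t) ≤ ‖w + t * I - e k‖ := by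
    refine eventually_all.2 fun k => ?_
    by_cases hk : k = k₀
    · exact Eventually.of_forall fun w h => absurd hk h
    · exact Eventually.mono (hl (hev k hk)) fun w hw _ => hw
  refine ⟨√(B ^ (2 * n) / c'), ?_⟩
  filter_upwards [hev₀, hnorm, hall] with w h1 h2 h3 t ht
  refine norm_branchFun_le_of_sq_le (by positivity) ?_
  have hprod : c' * (t * (1 + t) ^ (N - 1)) ≤ ∏ k, ‖w + t * I - e k‖ := by
    rw [← Finset.mul_prod_erase _ _ (Finset.mem_univ k₀), hc']
    calc c₀ * (∏ k ∈ Finset.univ.erase k₀, c k) * (t * (1 + t) ^ (N - 1))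
        = (c₀ * t) * ∏ k ∈ Finset.univ.erase k₀, (c k * (1 + t)) := by
          rw [Finset.prod_mul_distrib, Finset.prod_const, hcard]; ring
      _ ≤ _ := by
          refine mul_le_mul (h1 t ht) (Finset.prod_le_prod (fun k hk => ?_) fun k hk => ?_) ?_
            (norm_nonneg _)
          · have := hc k (Finset.ne_of_mem_erase hk); positivity
          · exact h3 k (Finset.ne_of_mem_erase hk) t ht
          · refine Finset.prod_nonneg fun k hk => ?_
            have := hc k (Finset.ne_of_mem_erase hk); positivity
  have hw : ‖w + t * I‖ ≤ B * (1 + t) := by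
    calc ‖w + t * I‖ ≤ ‖w‖ + ‖(t : ℂ) * I‖ := norm_add_le _ _
      _ = ‖w‖ + t := by simp [abs_of_pos ht]
      _ ≤ B * (1 + t) := by nlinarith
  rw [norm_branchFun_sq, div_le_iff₀ (lt_of_lt_of_le (by positivity) hprod)]
  have hcr : 0 < t * (1 + t) ^ 3 := by positivity
  calc ‖w + t * I‖ ^ (2 * n) ≤ (B * (1 + t)) ^ (2 * n) := by gcongr
    _ = B ^ (2 * n) / c' * (1 / (t * (1 + t) ^ 3)) *
        (c' * (t * (1 + t) ^ (2 * n + 3))) := by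
        rw [mul_pow, pow_add]
        field_simp
    _ ≤ B ^ (2 * n) / c' * (1 / (t * (1 + t) ^ 3)) * (c' * (t * (1 + t) ^ (N - 1))) := by
        gcongr
        · linarith
        · omega
    _ ≤ _ := by gcongr

theorem exists_bound_of_regular (hn : 2 * n + 4 ≤ Fintype.card ι) {w₀ : ℂ}
    (hw₀ : IsRegularPoint e w₀) :
    ∃ K : ℝ, ∀ᶠ w in 𝓝 w₀, ∀ t : ℝ, 0 < t → ‖branchFun e n (w + t * I)‖ ≤ K * branchBound t := by
  have : Nonempty ι := Fintype.card_pos_iff.1 (by omega)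
  obtain ⟨k₀⟩ := this
  obtain ⟨c, hc, h⟩ := eventually_le_norm_of_regular (hw₀ k₀)
  refine exists_bound hn le_rfl k₀ ⟨c, hc, h.mono fun w hw t ht => ?_⟩ fun k _ => hw₀ k
  refine le_trans ?_ (hw t ht)
  gcongr; linarith

/-- By injectivity of `e` at most one endpoint has the real part of `w₀`; it is taken as the
exceptional index `k₀`. -/
theorem exists_bound_of_im_nonneg (he : Function.Injective e) (hn : 2 * n + 4 ≤ Fintype.card ι)
    (w₀ : ℂ) :
    ∃ K : ℝ, ∀ᶠ w in 𝓝[{w | 0 ≤ w.im}] w₀, ∀ t : ℝ, 0 < t →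
      ‖branchFun e n (w + t * I)‖ ≤ K * branchBound t := by
  have : Nonempty ι := Fintype.card_pos_iff.1 (by omega)
  obtain ⟨k₀, hk₀⟩ : ∃ k₀, ∀ k, k ≠ k₀ → w₀.re ≠ e k := by
    by_cases h : ∃ k, w₀.re = e k
    · obtain ⟨k, hk⟩ := h
      exact ⟨k, fun k' hk' h' => hk' (he (h'.symm.trans hk))⟩
    · push Not at h
      exact ⟨Classical.arbitrary ι, fun k _ => h k⟩
  refine exists_bound hn nhdsWithin_le_nhds k₀ ⟨1, one_pos, ?_⟩ fun k hk => Or.inr (hk₀ k hk)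
  filter_upwards [self_mem_nhdsWithin] with w hw t _
  rw [one_mul]
  exact le_norm_of_im_nonneg hw t _

theorem continuousOn_branchFun_vertical {w : ℂ}
    (hw : ∀ t : ℝ, 0 < t → IsRegularPoint e (w + t * I)) :
    ContinuousOn (fun t : ℝ => branchFun e n (w + t * I)) (Set.Ioi 0) := fun t ht =>
  ((analyticAt_branchFun (hw t ht)).continuousAt.comp
    (f := fun t : ℝ => w + t * I) (by fun_prop)).continuousWithinAt

/-- Differentiation under the integral gives `-I ∫ f'(w + i t) dt`, and since `I * f'(w + i t)` is
the `t`-derivative of `f(w + i t)`, which tends to `0`, this equals `f(w)`. -/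
theorem hasDerivAt_branchPrim (hn : 2 * n + 4 ≤ Fintype.card ι) {w₀ : ℂ}
    (hw₀ : IsRegularPoint e w₀) : HasDerivAt (branchPrim e n) (branchFun e n w₀) w₀ := by
  obtain ⟨K, hK⟩ := exists_bound_of_regular (n := n) hn hw₀
  obtain ⟨r, hr, hball⟩ := Metric.eventually_nhds_iff_ball.1 (hK.and hw₀.eventually)
  set δ := r / 2 with hδ
  have hδpos : 0 < δ := by positivity
  have hreg : ∀ w ∈ Metric.ball w₀ r, ∀ t : ℝ, 0 ≤ t → IsRegularPoint e (w + t * I) :=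
    fun w hw t ht => (hball w hw).2.add_mul_I ht
  have hmeas : ∀ w ∈ Metric.ball w₀ r, AEStronglyMeasurable
      (fun t : ℝ => branchFun e n (w + t * I)) (volume.restrict (Set.Ioi 0)) := fun w hw =>
    (continuousOn_branchFun_vertical fun t ht => hreg w hw t ht.le).aestronglyMeasurable
      measurableSet_Ioi
  have hint : Integrable (fun t : ℝ => branchFun e n (w₀ + t * I)) (volume.restrict (Set.Ioi 0)) :=
    Integrable.mono' (integrableOn_branchBound.const_mul K)
      (hmeas w₀ (Metric.mem_ball_self hr))
      ((ae_restrict_iff' measurableSet_Ioi).2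
        (Eventually.of_forall fun t ht => (hball w₀ (Metric.mem_ball_self hr)).1 t ht))
  have hmeas' : AEStronglyMeasurable (fun t : ℝ => deriv (branchFun e n) (w₀ + t * I))
      (volume.restrict (Set.Ioi 0)) := by
    refine ContinuousOn.aestronglyMeasurable (fun t ht => ?_) measurableSet_Ioi
    exact ((analyticAt_branchFun (hreg w₀ (Metric.mem_ball_self hr) t
      (le_of_lt ht))).deriv.continuousAt.comp (f := fun t : ℝ => w₀ + t * I)
        (by fun_prop)).continuousWithinAt
  -- Cauchy's estimate on circles of radius `δ = r / 2`, which stay in the ball of radius `r`, turns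
  -- the bound on the integrand into one on its derivative.
  have hbound : ∀ t : ℝ, 0 < t → ∀ w ∈ Metric.ball w₀ δ,
      ‖deriv (branchFun e n) (w + t * I)‖ ≤ K * branchBound t / δ := by
    intro t ht w hw
    have hsub : ∀ ζ ∈ Metric.closedBall (w + t * I) δ, ζ - t * I ∈ Metric.ball w₀ r := by
      intro ζ hζ
      rw [mem_closedBall_iff_norm] at hζ
      rw [mem_ball_iff_norm] at hw ⊢
      calc ‖ζ - t * I - w₀‖ = ‖(ζ - (w + t * I)) + (w - w₀)‖ := by congr 1; ring
        _ ≤ ‖ζ - (w + t * I)‖ + ‖w - w₀‖ := norm_add_le _ _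
        _ < r := by linarith
    refine Complex.norm_deriv_le_of_forall_mem_sphere_norm_le hδpos
      (DifferentiableOn.diffContOnCl fun ζ hζ => ?_) fun ζ hζ => ?_
    · have := hreg _ (hsub ζ (Metric.closure_ball_subset_closedBall hζ)) t ht.le
      rw [sub_add_cancel] at this
      exact (analyticAt_branchFun this).differentiableAt.differentiableWithinAt
    · have := (hball _ (hsub ζ (Metric.sphere_subset_closedBall hζ))).1 t ht
      rwa [sub_add_cancel] at this
  obtain ⟨hi, hd⟩ := hasDerivAt_integral_of_dominated_loc_of_deriv_le
    (μ := volume.restrict (Set.Ioi (0 : ℝ))) (F := fun w (t : ℝ) => branchFun e n (w + t * I))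
    (F' := fun w (t : ℝ) => deriv (branchFun e n) (w + t * I)) (x₀ := w₀)
    (bound := fun t => K * branchBound t / δ)
    (Metric.ball_mem_nhds w₀ hδpos)
    (eventually_of_mem (Metric.ball_mem_nhds w₀ hr) hmeas) hint hmeas'
    ((ae_restrict_iff' measurableSet_Ioi).2 (Eventually.of_forall hbound))
    ((integrableOn_branchBound.const_mul K).div_const δ)
    ((ae_restrict_iff' measurableSet_Ioi).2 (Eventually.of_forall fun t ht w hw => by
      have h1 := (analyticAt_branchFun (n := n) (hreg w (Metric.ball_subset_ball (by linarith) hw) t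
        (le_of_lt ht))).differentiableAt.hasDerivAt
      exact h1.comp_add_const w _))
  have hval : ∫ t in Set.Ioi (0 : ℝ), I * deriv (branchFun e n) (w₀ + t * I) =
      0 - branchFun e n (w₀ + (0 : ℝ) * I) := by
    have hder : ∀ t : ℝ, 0 ≤ t → HasDerivAt (fun t : ℝ => branchFun e n (w₀ + t * I))
        (I * deriv (branchFun e n) (w₀ + t * I)) t := by
      intro t ht
      have h1 := (analyticAt_branchFun (n := n) (hreg w₀ (Metric.mem_ball_self hr) t
        ht)).differentiableAt.hasDerivAt
      have h2 : HasDerivAt (fun t : ℝ => w₀ + t * I) I t := by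
        simpa using (Complex.ofRealCLM.hasDerivAt (x := t)).mul_const I |>.const_add w₀
      have := h1.scomp t h2
      simpa [Function.comp_def] using this
    refine integral_Ioi_of_hasDerivAt_of_tendsto (hder 0 le_rfl).continuousAt.continuousWithinAt
      (fun t ht => hder t (le_of_lt ht)) (hi.const_mul I) ?_
    have hz : Tendsto (fun t => K * branchBound t) atTop (𝓝 0) := by
      simpa using tendsto_branchBound.const_mul K
    refine squeeze_zero_norm' ?_ hz
    filter_upwards [eventually_gt_atTop 0] with t ht
    exact (hball w₀ (Metric.mem_ball_self hr)).1 t ht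
  have := hd.const_mul (-I)
  rw [show -I * ∫ t in Set.Ioi (0 : ℝ), deriv (branchFun e n) (w₀ + t * I) =
    branchFun e n w₀ by
      rw [integral_const_mul] at hval
      rw [neg_mul, hval]; simp] at this
  exact this

theorem continuousOn_branchPrim (he : Function.Injective e) (hn : 2 * n + 4 ≤ Fintype.card ι) :
    ContinuousOn (branchPrim e n) {w | 0 ≤ w.im} := by
  intro w₀ hw₀
  obtain ⟨K, hK⟩ := exists_bound_of_im_nonneg he hn w₀
  refine continuousWithinAt_const.mul (continuousWithinAt_of_dominated
    (bound := fun t => K * branchBound t) ?_ ?_ (integrableOn_branchBound.const_mul K) ?_)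
  · filter_upwards [self_mem_nhdsWithin] with w hw
    exact (continuousOn_branchFun_vertical fun t ht =>
      isRegularPoint_add_mul_I hw ht).aestronglyMeasurable measurableSet_Ioi
  · filter_upwards [hK] with w hw
    exact (ae_restrict_iff' measurableSet_Ioi).2 (Eventually.of_forall fun t ht => hw t ht)
  · refine (ae_restrict_iff' measurableSet_Ioi).2 (Eventually.of_forall fun t ht => ?_)
    have := (analyticAt_branchFun (n := n) (isRegularPoint_add_mul_I (e := e) hw₀ ht)).continuousAt
    exact (this.comp (f := fun w : ℂ => w + t * I) (by fun_prop)).continuousWithinAt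

theorem exists_far_bound (e : ι → ℝ) (hn : 2 * n + 4 ≤ Fintype.card ι) :
    ∃ R K : ℝ, 1 ≤ R ∧ 0 ≤ K ∧ ∀ w : ℂ, R ≤ ‖w‖ →
      ‖branchFun e n w‖ ^ 2 ≤ K / ‖w‖ ^ 4 := by
  obtain ⟨M, hM⟩ : ∃ M : ℝ, ∀ k, |e k| ≤ M := by
    obtain ⟨M, hM⟩ := (Set.finite_range fun k => |e k|).bddAbove
    exact ⟨M, fun k => hM ⟨k, rfl⟩⟩
  -- Beyond `2 * M` each factor is at least `‖w‖ / 2`, which accounts for the constant `2 ^ card ι`.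
  refine ⟨max 1 (2 * M), 2 ^ Fintype.card ι, le_max_left _ _, by positivity, fun w hw => ?_⟩
  have h1 : 1 ≤ ‖w‖ := (le_max_left _ _).trans hw
  have h2 : 2 * M ≤ ‖w‖ := (le_max_right _ _).trans hw
  have hprod : (‖w‖ / 2) ^ Fintype.card ι ≤ ∏ k, ‖w - e k‖ := by
    rw [← Finset.card_univ, ← Finset.prod_const]
    refine Finset.prod_le_prod (fun k _ => by positivity) fun k _ => ?_
    have := norm_sub_norm_le w (e k)
    rw [Complex.norm_real, Real.norm_eq_abs] at this
    linarith [hM k]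
  have hpos : 0 < ‖w‖ := by linarith
  rw [norm_branchFun_sq, div_le_iff₀ (lt_of_lt_of_le (by positivity) hprod)]
  calc ‖w‖ ^ (2 * n) = ‖w‖ ^ (2 * n + 4) / ‖w‖ ^ 4 := by rw [pow_add]; field_simp
    _ ≤ ‖w‖ ^ Fintype.card ι / ‖w‖ ^ 4 := by gcongr
    _ = 2 ^ Fintype.card ι / ‖w‖ ^ 4 * (‖w‖ / 2) ^ Fintype.card ι := by
        rw [div_pow]; field_simp
    _ ≤ _ := by gcongr

theorem tendsto_branchPrim (e : ι → ℝ) (hn : 2 * n + 4 ≤ Fintype.card ι) :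
    Tendsto (branchPrim e n) (Bornology.cobounded ℂ ⊓ 𝓟 {w | 0 ≤ w.im}) (𝓝 0) := by
  obtain ⟨R, K, hR, hK, hb⟩ := exists_far_bound (n := n) e hn
  rw [← comap_norm_atTop]
  have hnorm : ∀ (w : ℂ) (t : ℝ), 0 ≤ w.im → 0 < t → ‖w‖ ≤ ‖w + t * I‖ ∧ t ≤ ‖w + t * I‖ := by
    intro w t hw ht
    constructor
    · rw [Complex.norm_def, Complex.norm_def]
      refine Real.sqrt_le_sqrt ?_
      rw [Complex.normSq_apply, Complex.normSq_apply]
      simp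
      nlinarith
    · simpa using le_norm_of_im_nonneg hw t 0
  have hev : ∀ᶠ w : ℂ in comap norm atTop ⊓ 𝓟 {w : ℂ | 0 ≤ w.im}, R ≤ ‖w‖ ∧ 0 ≤ w.im :=
    inter_mem_inf (preimage_mem_comap (Ici_mem_atTop R)) (mem_principal_self _)
  have := tendsto_integral_filter_of_dominated_convergence
    (μ := volume.restrict (Set.Ioi (0 : ℝ))) (l := comap norm atTop ⊓ 𝓟 {w : ℂ | 0 ≤ w.im})
    (F := fun w (t : ℝ) => branchFun e n (w + t * I)) (f := fun _ => 0)
    (fun t => √(16 * K) * branchBound t) ?_ ?_ (integrableOn_branchBound.const_mul _) ?_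
  · have h2 := this.const_mul (-I)
    rw [integral_zero, mul_zero] at h2
    exact h2
  · filter_upwards [hev] with w hw
    exact (continuousOn_branchFun_vertical fun t ht =>
      isRegularPoint_add_mul_I hw.2 ht).aestronglyMeasurable measurableSet_Ioi
  · filter_upwards [hev] with w hw
    refine (ae_restrict_iff' measurableSet_Ioi).2 (Eventually.of_forall fun t ht => ?_)
    have ht' : 0 < t := ht
    obtain ⟨h1, h2⟩ := hnorm w t hw.2 ht
    refine norm_branchFun_le_of_sq_le (by positivity) ((hb _ (hw.1.trans h1)).trans ?_)
    -- Averages the bounds `1 ≤ ‖w‖ ≤ ‖w + i t‖` and `t ≤ ‖w + i t‖`; the fourth power of this `2`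
    -- gives the factor `16`.
    have h3 : (1 + t) / 2 ≤ ‖w + t * I‖ := by linarith [hw.1]
    calc K / ‖w + t * I‖ ^ 4 ≤ K / ((1 + t) / 2) ^ 4 := by gcongr
      _ = 16 * K * (1 / ((1 + t) * (1 + t) ^ 3)) := by field_simp; ring
      _ ≤ 16 * K * (1 / (t * (1 + t) ^ 3)) := by gcongr; linarith
  · refine (ae_restrict_iff' measurableSet_Ioi).2 (Eventually.of_forall fun t ht => ?_)
    have hlim : Tendsto (fun w : ℂ => √(K / ‖w‖ ^ 4))
        (comap norm atTop ⊓ 𝓟 {w : ℂ | 0 ≤ w.im}) (𝓝 0) := by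
      have h1 : Tendsto (fun w : ℂ => ‖w‖) (comap norm atTop ⊓ 𝓟 {w : ℂ | 0 ≤ w.im}) atTop :=
        tendsto_comap.mono_left inf_le_left
      have h2 := (tendsto_pow_atTop (n := 4) (by norm_num)).comp h1
      have h3 := (Real.continuous_sqrt.tendsto 0).comp (h2.const_div_atTop K)
      rwa [Real.sqrt_zero] at h3
    refine squeeze_zero_norm' ?_ hlim
    filter_upwards [hev] with w hw
    obtain ⟨h1, h2⟩ := hnorm w t hw.2 ht
    refine Real.le_sqrt_of_sq_le ((hb _ (hw.1.trans h1)).trans ?_)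
    have : 0 < ‖w‖ := by linarith [hw.1]
    gcongr

end BranchIntegral

/-! ### Reflection across the real line -/

section Reflection

open Complex Filter

theorem analyticAt_conj_conj {G : ℂ → ℂ} {p : ℂ} (hG : AnalyticAt ℂ G (starRingEnd ℂ p)) :
    AnalyticAt ℂ (fun w => starRingEnd ℂ (G (starRingEnd ℂ w))) p := by
  rw [Complex.analyticAt_iff_eventually_differentiableAt] at hG ⊢
  have ht : Tendsto (starRingEnd ℂ) (𝓝 p) (𝓝 (starRingEnd ℂ p)) :=
    Complex.continuous_conj.continuousAt
  filter_upwards [ht.eventually hG] with w hw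
  have := hw.conj_conj
  rwa [Complex.conj_conj] at this

theorem eventually_im_eq {F f : ℂ → ℂ} {x : ℝ}
    (h : ∀ᶠ y : ℝ in 𝓝 x, HasDerivAt F (f y) y ∧ (f y).im = 0) :
    ∀ᶠ y : ℝ in 𝓝 x, (F y).im = (F x).im := by
  obtain ⟨r, hr, hball⟩ := Metric.eventually_nhds_iff_ball.1 h
  have hd : ∀ y ∈ Metric.ball x r, HasDerivAt (fun y : ℝ => (F y).im) 0 y := fun y hy => by
    have h1 := (hball y hy).1.comp_ofReal
    have h2 := Complex.imCLM.hasFDerivAt.comp_hasDerivAt y h1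
    simpa [(hball y hy).2, Function.comp_def] using h2
  filter_upwards [Metric.ball_mem_nhds x hr] with y hy
  exact Metric.isOpen_ball.is_const_of_deriv_eq_zero (convex_ball x r).isPreconnected
    (fun y hy => (hd y hy).differentiableAt.differentiableWithinAt)
    (fun y hy => (hd y hy).deriv) hy (Metric.mem_ball_self hr)

/-- `G` and `w ↦ conj (G (conj w)) + 2 i c` are analytic and agree on the real line near `x`, hence
agree near `x` by the identity theorem; their real parts give the symmetry. -/
theorem eventually_re_conj_eq {G : ℂ → ℂ} {x c : ℝ} (hG : AnalyticAt ℂ G x)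
    (hc : ∀ᶠ y : ℝ in 𝓝 x, (G y).im = c) :
    ∀ᶠ w in 𝓝 (x : ℂ), (G (starRingEnd ℂ w)).re = (G w).re := by
  have hK : AnalyticAt ℂ (fun w => starRingEnd ℂ (G (starRingEnd ℂ w)) + 2 * c * I) x :=
    (analyticAt_conj_conj (by rwa [Complex.conj_ofReal])).add analyticAt_const
  have ht : Tendsto (fun y : ℝ => (y : ℂ)) (𝓝[≠] x) (𝓝[≠] (x : ℂ)) :=
    tendsto_nhdsWithin_of_tendsto_nhds_of_eventually_within _
      (Complex.continuous_ofReal.continuousAt.tendsto.mono_left nhdsWithin_le_nhds)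
      (by filter_upwards [self_mem_nhdsWithin] with y hy
          simpa using hy)
  have hfreq : ∃ᶠ w in 𝓝[≠] (x : ℂ),
      G w = starRingEnd ℂ (G (starRingEnd ℂ w)) + 2 * c * I := by
    refine ht.frequently (Eventually.frequently ?_)
    filter_upwards [nhdsWithin_le_nhds hc] with y hy
    rw [Complex.conj_ofReal]
    apply Complex.ext
    · simp
    · simp; linarith
  filter_upwards [(hG.frequently_eq_iff_eventually_eq hK).1 hfreq] with w hw
  have := congrArg Complex.re hw
  simpa using this.symm

/-- The reflection of the lower half-plane to the upper one. -/
def foldUp (w : ℂ) : ℂ := ⟨w.re, |w.im|⟩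

theorem foldUp_of_nonneg {w : ℂ} (h : 0 ≤ w.im) : foldUp w = w := by
  apply Complex.ext <;> simp [foldUp, h]

theorem foldUp_of_nonpos {w : ℂ} (h : w.im ≤ 0) : foldUp w = starRingEnd ℂ w := by
  apply Complex.ext <;> simp [foldUp, h]

@[simp] theorem foldUp_ofReal (x : ℝ) : foldUp x = x := foldUp_of_nonneg (by simp)

theorem foldUp_im_nonneg (w : ℂ) : 0 ≤ (foldUp w).im := abs_nonneg _

theorem norm_foldUp (w : ℂ) : ‖foldUp w‖ = ‖w‖ := by
  rcases le_total 0 w.im with h | h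
  · rw [foldUp_of_nonneg h]
  · rw [foldUp_of_nonpos h, Complex.norm_conj]

theorem continuous_foldUp : Continuous foldUp := by
  have : foldUp = fun w : ℂ => (w.re : ℂ) + ((|w.im| : ℝ) : ℂ) * I := by
    ext w
    apply Complex.ext <;> simp [foldUp]
  rw [this]
  fun_prop

theorem im_neg_inv (w : ℂ) : (-w⁻¹).im = w.im / Complex.normSq w := by
  simp [Complex.inv_im]; ring

theorem im_neg_inv_nonneg {w : ℂ} (hw : 0 ≤ w.im) : 0 ≤ (-w⁻¹).im := by
  rw [im_neg_inv]; exact div_nonneg hw (Complex.normSq_nonneg w)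

theorem im_neg_inv_pos {w : ℂ} (hw : 0 < w.im) : 0 < (-w⁻¹).im := by
  have hw0 : w ≠ 0 := fun h => by simp [h] at hw
  rw [im_neg_inv]; exact div_pos hw (Complex.normSq_pos.2 hw0)

theorem foldUp_neg_inv (w : ℂ) : foldUp (-w⁻¹) = -(foldUp w)⁻¹ := by
  rcases le_total 0 w.im with h | h
  · rw [foldUp_of_nonneg h, foldUp_of_nonneg (im_neg_inv_nonneg h)]
  · rw [foldUp_of_nonpos h, foldUp_of_nonpos]
    · simp
    · rw [im_neg_inv]; exact div_nonpos_of_nonpos_of_nonneg h (Complex.normSq_nonneg w)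

/-- This is how the even extension of a real part from the upper half-plane is seen to be harmonic
across real points where the imaginary part is locally constant. -/
theorem eventually_re_foldUp_eq {F G : ℂ → ℂ} {x c : ℝ} (hG : AnalyticAt ℂ G x)
    (hc : ∀ᶠ y : ℝ in 𝓝 x, (G y).im = c)
    (hFG : ∀ᶠ w in 𝓝 (x : ℂ), 0 ≤ w.im → F w = G w) :
    ∀ᶠ w in 𝓝 (x : ℂ), (F (foldUp w)).re = (G w).re := by
  have ht : Tendsto foldUp (𝓝 (x : ℂ)) (𝓝 (x : ℂ)) := by
    have := continuous_foldUp.continuousAt (x := (x : ℂ)).tendsto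
    rwa [foldUp_ofReal] at this
  filter_upwards [ht.eventually hFG, eventually_re_conj_eq hG hc] with w h1 h2
  rw [h1 (foldUp_im_nonneg w)]
  rcases le_total 0 w.im with h | h
  · rw [foldUp_of_nonneg h]
  · rw [foldUp_of_nonpos h, h2]

end Reflection

/-! ### The integrals in the coordinate `ζ = -1/w` at infinity -/

section Infinity

open Complex Filter

/-- Both `u` and `-I * v` lie in the right half-plane, so their arguments add without leaving `(-π,
π)`. -/
theorem branchRoot_mul {u v : ℂ} (hu : 0 < u.re) (hv : 0 < v.im) :
    branchRoot (u * v) = u ^ (1 / 2 : ℂ) * branchRoot v := by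
  have hu0 : u ≠ 0 := fun h => by simp [h] at hu
  have hv0 : v ≠ 0 := fun h => by simp [h] at hv
  have hIv : -I * v ≠ 0 := mul_ne_zero (neg_ne_zero.2 I_ne_zero) hv0
  have hre : 0 < (-I * v).re := by simpa using hv
  have h1 := abs_lt.1 (Complex.abs_arg_lt_pi_div_two_iff.2 (Or.inl hu))
  have h2 := abs_lt.1 (Complex.abs_arg_lt_pi_div_two_iff.2 (Or.inl hre))
  have hlog := (Complex.log_mul_eq_add_log_iff hu0 hIv).2 ⟨by linarith, by linarith⟩
  rw [branchRoot, branchRoot, show -I * (u * v) = u * (-I * v) by ring,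
    Complex.cpow_def_of_ne_zero (mul_ne_zero hu0 hIv), Complex.cpow_def_of_ne_zero hu0,
    Complex.cpow_def_of_ne_zero hIv, hlog, ← Complex.exp_add, ← Complex.exp_add, ← Complex.exp_add]
  congr 1
  ring

variable {ι : Type*} [Fintype ι] {e : ι → ℝ} {n m : ℕ}

/-- The differential of `branchPrim e n` in the coordinate `ζ = -1/w` at infinity. -/
noncomputable def branchFunInfty (e : ι → ℝ) (n m : ℕ) (ζ : ℂ) : ℂ :=
  (-ζ) ^ (m - (n + 2)) / ∏ k, (1 + e k * ζ) ^ (1 / 2 : ℂ)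

/-- Since `-1/ζ - e = (-1/ζ) (1 + e ζ)`, each root splits off the root of `-1/ζ`. Their number `2m`
is even, so only integer powers of `ζ` remain; the factor `ζ⁻²` comes from `dw = dζ/ζ²`. -/
theorem branchFun_neg_inv (hm : Fintype.card ι = 2 * m) (hnm : n + 2 ≤ m) {ζ : ℂ} (hζ : 0 < ζ.im)
    (h : ∀ k, 0 < (1 + e k * ζ).re) :
    branchFun e n (-ζ⁻¹) * (ζ ^ 2)⁻¹ = branchFunInfty e n m ζ := by
  have hζ0 : ζ ≠ 0 := fun h => by simp [h] at hζ
  have him := im_neg_inv_pos hζ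
  have hk : ∀ k, branchRoot (-ζ⁻¹ - e k) = (1 + e k * ζ) ^ (1 / 2 : ℂ) * branchRoot (-ζ⁻¹) := by
    intro k
    rw [← branchRoot_mul (h k) him]
    congr 1
    field_simp
    ring
  have hprod : ∏ k, (1 + e k * ζ) ^ (1 / 2 : ℂ) ≠ 0 := by
    refine Finset.prod_ne_zero_iff.2 fun k _ h0 => ?_
    have h1 : 1 + e k * ζ ≠ 0 := fun h' => by simpa [h'] using h k
    rw [Complex.cpow_eq_zero_iff] at h0
    exact h1 h0.1
  rw [branchFun, branchFunInfty]
  simp_rw [hk]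
  rw [Finset.prod_mul_distrib, Finset.prod_const, Finset.card_univ, hm, pow_mul, branchRoot_sq]
  obtain ⟨d, rfl⟩ := Nat.exists_eq_add_of_le hnm
  rw [Nat.add_sub_cancel_left]
  have h2 : (-ζ) ≠ 0 := neg_ne_zero.2 hζ0
  rw [show -ζ⁻¹ = (-ζ)⁻¹ by rw [inv_neg], show ζ ^ 2 = (-ζ) ^ 2 by ring]
  rw [inv_pow, inv_pow, pow_add, pow_add]
  field_simp

/-- The transformed integrand is analytic at `0` and has a primitive `G` there with `G 0 = 0`. On
the upper half of a disc, `branchPrim e n (-1/ζ) - G ζ` has zero derivative and tends to `0` at the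
origin. The integrand at `0` is nonzero only for the largest exponent, `n + 2 = m`. -/
theorem exists_analyticAt_infty (e : ι → ℝ) (hm : Fintype.card ι = 2 * m) (hnm : n + 2 ≤ m) :
    ∃ G : ℂ → ℂ, AnalyticAt ℂ G 0 ∧ G 0 = 0 ∧ HasDerivAt G (if n + 2 = m then 1 else 0) 0 ∧
      (∀ᶠ y : ℝ in 𝓝 0, (G y).im = 0) ∧
      ∀ᶠ ζ : ℂ in 𝓝 0, 0 < ζ.im → branchPrim e n (-ζ⁻¹) = G ζ := by
  have hre : ∀ᶠ ζ : ℂ in 𝓝 0, ∀ k, 0 < (1 + e k * ζ).re := by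
    refine eventually_all.2 fun k => ?_
    have : ContinuousAt (fun ζ : ℂ => (1 + e k * ζ).re) 0 := by fun_prop
    exact this.eventually (lt_mem_nhds (by simp))
  obtain ⟨r, hr, hball⟩ := Metric.eventually_nhds_iff_ball.1 hre
  have hφ : ∀ ζ ∈ Metric.ball (0 : ℂ) r, AnalyticAt ℂ (branchFunInfty e n m) ζ := by
    intro ζ hζ
    refine AnalyticAt.div (by fun_prop) ?_ ?_
    · refine Finset.analyticAt_fun_prod _ fun k _ => AnalyticAt.cpow (by fun_prop) analyticAt_const ?_
      exact Complex.mem_slitPlane_iff.2 (Or.inl (hball ζ hζ k))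
    · refine Finset.prod_ne_zero_iff.2 fun k _ h0 => ?_
      rw [Complex.cpow_eq_zero_iff] at h0
      have := hball ζ hζ k
      rw [h0.1] at this
      simp at this
  have hdiff : DifferentiableOn ℂ (branchFunInfty e n m) (Metric.ball 0 r) :=
    fun ζ hζ => (hφ ζ hζ).differentiableAt.differentiableWithinAt
  obtain ⟨G, hG0, hG⟩ := hdiff.isExactOn_ball.with_val_at 0 0
  have hmem := Metric.ball_mem_nhds (0 : ℂ) hr
  have hGa : AnalyticAt ℂ G 0 := by
    rw [Complex.analyticAt_iff_eventually_differentiableAt]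
    filter_upwards [hmem] with ζ hζ
    exact (hG ζ hζ).differentiableAt
  have hG'0 : branchFunInfty e n m 0 = if n + 2 = m then 1 else 0 := by
    obtain ⟨d, rfl⟩ := Nat.exists_eq_add_of_le hnm
    rw [branchFunInfty, Nat.add_sub_cancel_left]
    rcases Nat.eq_zero_or_pos d with rfl | hd
    · simp
    · rw [neg_zero, zero_pow hd.ne', zero_div, if_neg (by omega)]
  refine ⟨G, hGa, hG0, ?_, ?_, ?_⟩
  · rw [← hG'0]
    exact hG 0 (Metric.mem_ball_self hr)
  · have ht : Tendsto (fun y : ℝ => (y : ℂ)) (𝓝 0) (𝓝 0) := by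
      simpa using Complex.continuous_ofReal.tendsto 0
    have := eventually_im_eq (F := G) (f := branchFunInfty e n m) (x := 0) <| by
      filter_upwards [ht.eventually hmem] with y hy
      refine ⟨hG _ hy, ?_⟩
      have hroot : ∀ k, (1 + e k * (y : ℂ)) ^ (1 / 2 : ℂ) = ((√(1 + e k * y) : ℝ) : ℂ) := by
        intro k
        have h0 := hball _ hy k
        rw [← cpow_half_of_nonneg (by simpa using h0.le)]
        push_cast; rfl
      rw [branchFunInfty]
      simp_rw [hroot]
      rw [← Complex.ofReal_prod, ← Complex.ofReal_neg, ← Complex.ofReal_pow, ← Complex.ofReal_div,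
        Complex.ofReal_im]
    filter_upwards [this] with y hy
    rw [hy, Complex.ofReal_zero, hG0, Complex.zero_im]
  · set U : Set ℂ := Metric.ball 0 r ∩ {ζ | 0 < ζ.im} with hU
    have hUo : IsOpen U := Metric.isOpen_ball.inter (isOpen_lt continuous_const Complex.continuous_im)
    have hUc : Convex ℝ U := (convex_ball 0 r).inter (convex_halfSpace_im_gt 0)
    have hDer : ∀ ζ ∈ U, HasDerivAt (fun ζ => branchPrim e n (-ζ⁻¹) - G ζ) 0 ζ := by
      rintro ζ ⟨hζ, hζi⟩
      have hζi : 0 < ζ.im := hζi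
      have hζ0 : ζ ≠ 0 := fun h => by simp [h] at hζi
      have him := im_neg_inv_pos hζi
      have h1 := hasDerivAt_branchPrim (e := e) (n := n) (by omega) (isRegularPoint_of_im_pos him)
      have h2 : HasDerivAt (fun ζ : ℂ => -ζ⁻¹) ((ζ ^ 2)⁻¹) ζ := by
        have := (hasDerivAt_inv hζ0).fun_neg
        rwa [neg_neg] at this
      have h3 := (HasDerivAt.comp (h₂ := branchPrim e n) ζ h1 h2).sub (hG ζ hζ)
      rw [branchFun_neg_inv hm hnm hζi (hball ζ hζ), sub_self] at h3
      exact h3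
    have hne : (𝓝[U] (0 : ℂ)).NeBot := by
      rw [hU, Set.inter_comm]
      rw [nhdsWithin_inter_of_mem' (nhdsWithin_le_nhds hmem)]
      rw [← mem_closure_iff_nhdsWithin_neBot]
      have : closure {z : ℂ | (0 : ℝ) < z.im} = {z | 0 ≤ z.im} := Complex.closure_setOfPred_lt_im 0
      rw [this]
      simp
    have hlim : Tendsto (fun ζ => branchPrim e n (-ζ⁻¹) - G ζ) (𝓝[U] 0) (𝓝 0) := by
      have h1 : Tendsto (fun ζ : ℂ => -ζ⁻¹) (𝓝[U] 0)
          (Bornology.cobounded ℂ ⊓ 𝓟 {w | 0 ≤ w.im}) := by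
        refine tendsto_inf.2 ⟨?_, tendsto_principal.2 ?_⟩
        · have h2 : Tendsto (fun ζ : ℂ => ζ⁻¹) (𝓝[U] 0) (Bornology.cobounded ℂ) := by
            refine tendsto_inv₀_nhdsNE_zero.mono_left (nhdsWithin_mono _ fun ζ hζ => ?_)
            rintro rfl
            simpa using hζ.2
          rw [← tendsto_norm_atTop_iff_cobounded] at h2 ⊢
          simpa using h2
        · filter_upwards [self_mem_nhdsWithin] with ζ hζ
          exact im_neg_inv_nonneg (le_of_lt hζ.2)
      have h2 := (tendsto_branchPrim (n := n) e (by omega)).comp h1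
      have h3 := hGa.continuousAt.tendsto.mono_left (nhdsWithin_le_nhds (s := U))
      rw [hG0] at h3
      simpa using h2.sub h3
    filter_upwards [hmem] with ζ hζ hζi
    have hconst : ∀ ζ' ∈ U, branchPrim e n (-ζ'⁻¹) - G ζ' = branchPrim e n (-ζ⁻¹) - G ζ :=
      fun ζ' hζ' => hUo.is_const_of_deriv_eq_zero hUc.isPreconnected
        (fun y hy => (hDer y hy).differentiableAt.differentiableWithinAt)
        (fun y hy => (hDer y hy).deriv) hζ' ⟨hζ, hζi⟩
    have hlim' : Tendsto (fun ζ => branchPrim e n (-ζ⁻¹) - G ζ) (𝓝[U] 0)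
        (𝓝 (branchPrim e n (-ζ⁻¹) - G ζ)) := by
      refine tendsto_const_nhds.congr' ?_
      filter_upwards [self_mem_nhdsWithin] with ζ' hζ'
      exact (hconst ζ' hζ').symm
    exact sub_eq_zero.1 (tendsto_nhds_unique hlim' hlim)

/-- On the punctured closed upper half-plane, `branchPrim e n (-1/ζ)` agrees near the origin with
an analytic function. -/
theorem exists_analyticAt_infty' (he : Function.Injective e) (hm : Fintype.card ι = 2 * m)
    (hnm : n + 2 ≤ m) :
    ∃ G : ℂ → ℂ, AnalyticAt ℂ G 0 ∧ G 0 = 0 ∧ HasDerivAt G (if n + 2 = m then 1 else 0) 0 ∧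
      (∀ᶠ y : ℝ in 𝓝 0, (G y).im = 0) ∧
      ∀ᶠ ζ : ℂ in 𝓝 0, 0 ≤ ζ.im → ζ ≠ 0 → branchPrim e n (-ζ⁻¹) = G ζ := by
  obtain ⟨G, hGa, hG0, hG', hGr, hGe⟩ := exists_analyticAt_infty (n := n) e hm hnm
  refine ⟨G, hGa, hG0, hG', hGr, ?_⟩
  filter_upwards [hGe.eventually_nhds, hGa.eventually_continuousAt] with ζ h1 h2 hζ hζ0
  -- Real nonzero `ζ` are limits of points of the open half-plane, where the identity is known, and
  -- both sides are continuous up to such `ζ`.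
  have hne : (𝓝[{z : ℂ | 0 < z.im}] ζ).NeBot := by
    rw [← mem_closure_iff_nhdsWithin_neBot]
    have : closure {z : ℂ | (0 : ℝ) < z.im} = {z | 0 ≤ z.im} := Complex.closure_setOfPred_lt_im 0
    rw [this]
    exact hζ
  have hmaps : Tendsto (fun ζ : ℂ => -ζ⁻¹) (𝓝[{z : ℂ | 0 < z.im}] ζ)
      (𝓝[{w : ℂ | 0 ≤ w.im}] (-ζ⁻¹)) := by
    refine tendsto_nhdsWithin_of_tendsto_nhds_of_eventually_within _
      (((continuousAt_inv₀ hζ0).neg.tendsto).mono_left nhdsWithin_le_nhds) ?_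
    filter_upwards [self_mem_nhdsWithin] with z hz
    exact im_neg_inv_nonneg (le_of_lt hz)
  have hmem := im_neg_inv_nonneg hζ
  have hlim1 := (continuousOn_branchPrim (n := n) he (by omega) (-ζ⁻¹) hmem).tendsto.comp hmaps
  have hlim2 := h2.tendsto.mono_left (nhdsWithin_le_nhds (s := {z : ℂ | 0 < z.im}))
  refine tendsto_nhds_unique hlim1 (hlim2.congr' ?_)
  filter_upwards [nhdsWithin_le_nhds h1, self_mem_nhdsWithin] with z hz1 hz2
  exact (hz1 hz2).symm

end Infinity

/-! ### Harmonic extension of the integrals to the sphere -/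

section PrimSphere

open Complex Filter

variable {ι : Type*} [Fintype ι] {e : ι → ℝ} {n m : ℕ}

/-- The real part of `branchPrim e n` on the closed upper half-plane, extended to the sphere by
reflection. -/
noncomputable def primSphere (e : ι → ℝ) (n : ℕ) (p : OnePoint ℂ) : ℝ :=
  p.elim 0 fun w => (branchPrim e n (foldUp w)).re

@[simp] theorem primSphere_infty : primSphere e n OnePoint.infty = 0 := rfl

theorem primSphere_coe (w : ℂ) :
    primSphere e n (w : OnePoint ℂ) = (branchPrim e n (foldUp w)).re := rfl

theorem continuous_primSphere (he : Function.Injective e) (hn : 2 * n + 4 ≤ Fintype.card ι) :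
    Continuous (primSphere e n) := by
  rw [continuous_iff_continuousAt]
  intro p
  induction p using OnePoint.rec with
  | infty =>
    rw [OnePoint.continuousAt_infty', coclosedCompact_eq_cocompact,
      ← Metric.cobounded_eq_cocompact]
    have h1 : Tendsto foldUp (Bornology.cobounded ℂ) (Bornology.cobounded ℂ ⊓ 𝓟 {w | 0 ≤ w.im}) := by
      refine tendsto_inf.2 ⟨?_, tendsto_principal.2 (Eventually.of_forall foldUp_im_nonneg)⟩
      rw [← tendsto_norm_atTop_iff_cobounded]
      simp_rw [norm_foldUp]
      exact tendsto_norm_cobounded_atTop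
    have h2 := (Complex.continuous_re.tendsto 0).comp ((tendsto_branchPrim (n := n) e hn).comp h1)
    exact h2
  | coe w =>
    rw [OnePoint.continuousAt_coe]
    have h1 := (continuousOn_branchPrim he hn).comp_continuous continuous_foldUp foldUp_im_nonneg
    exact (Complex.continuous_re.comp h1).continuousAt

theorem analyticAt_branchPrim (hn : 2 * n + 4 ≤ Fintype.card ι) {w : ℂ}
    (hw : IsRegularPoint e w) : AnalyticAt ℂ (branchPrim e n) w := by
  rw [Complex.analyticAt_iff_eventually_differentiableAt]
  filter_upwards [hw.eventually] with w hw
  exact (hasDerivAt_branchPrim hn hw).differentiableAt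

theorem primSphere_eventually_eq_of_real (hn : 2 * n + 4 ≤ Fintype.card ι) {x : ℝ}
    (hx : IsRegularPoint e x) (hreal : ∀ᶠ y : ℝ in 𝓝 x, (branchFun e n y).im = 0) :
    ∀ᶠ w : ℂ in 𝓝 (x : ℂ), primSphere e n (w : OnePoint ℂ) = (branchPrim e n w).re := by
  refine eventually_re_foldUp_eq (analyticAt_branchPrim hn hx) (c := (branchPrim e n x).im) ?_
    (Eventually.of_forall fun w _ => rfl)
  refine eventually_im_eq (f := branchFun e n) ?_
  have := Complex.continuous_ofReal.continuousAt (x := x) |>.tendsto.eventually hx.eventually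
  filter_upwards [hreal, this] with y h1 h2
  exact ⟨hasDerivAt_branchPrim hn h2, h1⟩

theorem primSphere_eventually_eq_infty (he : Function.Injective e) (hm : Fintype.card ι = 2 * m)
    (hnm : n + 2 ≤ m) :
    ∃ G : ℂ → ℂ, AnalyticAt ℂ G 0 ∧ HasDerivAt G (if n + 2 = m then 1 else 0) 0 ∧
      ∀ᶠ ζ : ℂ in 𝓝 0, primSphere e n (sphereInv ζ) = (G ζ).re := by
  classical
  obtain ⟨G, hGa, hG0, hG', hGr, hGe⟩ := exists_analyticAt_infty' he hm hnm
  refine ⟨G, hGa, hG', ?_⟩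
  -- The value at `ζ = 0` is set by hand: it represents the point at infinity, whereas `-0⁻¹` would
  -- be `0`.
  set F : ℂ → ℂ := fun ζ => if ζ = 0 then 0 else branchPrim e n (-ζ⁻¹) with hF
  have h := eventually_re_foldUp_eq (F := F) (x := 0) (c := 0) (G := G) (by simpa using hGa) hGr ?_
  · rw [Complex.ofReal_zero] at h
    filter_upwards [h] with ζ hζ
    rw [← hζ]
    by_cases h0 : ζ = 0
    · subst h0
      have : foldUp 0 = 0 := by simpa using foldUp_ofReal 0
      simp [hF, this]
    · have h0' : foldUp ζ ≠ 0 := by rw [← norm_pos_iff, norm_foldUp]; exact norm_pos_iff.2 h0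
      rw [sphereInv_of_ne h0, primSphere_coe, foldUp_neg_inv]
      simp only [hF, if_neg h0']
  · rw [Complex.ofReal_zero]
    filter_upwards [hGe] with ζ hζ hi
    by_cases h0 : ζ = 0
    · subst h0; simp [hF, hG0]
    · simp only [hF, if_neg h0]
      exact hζ hi h0

/-- Above the real line the primitive itself serves, below it its conjugate reflection, and at real
points off `E` reality of the integrand allows the reflection principle. -/
theorem isLocallyRe_primSphere (he : Function.Injective e) (hm : Fintype.card ι = 2 * m)
    (hnm : n + 2 ≤ m) {E : Set (OnePoint ℂ)}
    (hreal : ∀ x : ℝ, ((x : ℂ) : OnePoint ℂ) ∉ E →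
      IsRegularPoint e x ∧ ∀ᶠ y : ℝ in 𝓝 x, (branchFun e n y).im = 0) :
    IsLocallyRe (primSphere e n) Eᶜ := by
  have hn : 2 * n + 4 ≤ Fintype.card ι := by omega
  refine ⟨fun p hp => ?_, fun _ => ?_⟩
  · rcases lt_trichotomy p.im 0 with h | h | h
    · have hc : 0 < (starRingEnd ℂ p).im := by simpa using h
      refine ⟨_, analyticAt_conj_conj (analyticAt_branchPrim (e := e) hn
        (isRegularPoint_of_im_pos hc)), ?_⟩
      filter_upwards [Complex.continuous_im.continuousAt.eventually (gt_mem_nhds h)] with w hw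
      rw [primSphere_coe, foldUp_of_nonpos (le_of_lt hw), Complex.conj_re]
    · obtain ⟨x, rfl⟩ : ∃ x : ℝ, (x : ℂ) = p := ⟨p.re, Complex.ext rfl (by simp [h])⟩
      obtain ⟨h1, h2⟩ := hreal x hp
      exact ⟨_, analyticAt_branchPrim hn h1, primSphere_eventually_eq_of_real hn h1 h2⟩
    · refine ⟨_, analyticAt_branchPrim (e := e) hn (isRegularPoint_of_im_pos h), ?_⟩
      filter_upwards [Complex.continuous_im.continuousAt.eventually (lt_mem_nhds h)] with w hw
      rw [primSphere_coe, foldUp_of_nonneg (le_of_lt hw)]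
  · obtain ⟨G, h1, -, h2⟩ := primSphere_eventually_eq_infty he hm hnm
    exact ⟨G, h1, h2⟩

theorem IsLocallyRe.const_add_sum {κ : Type*} [Fintype κ] {h : κ → OnePoint ℂ → ℝ}
    {Ω : Set (OnePoint ℂ)} (hh : ∀ i, IsLocallyRe (h i) Ω) (c : ℝ) (A : κ → ℝ) :
    IsLocallyRe (fun p => c + ∑ i, A i * h i p) Ω := by
  have key : ∀ (q : ℂ) (G : κ → ℂ → ℂ) (ψ : ℂ → OnePoint ℂ), (∀ i, AnalyticAt ℂ (G i) q) →
      (∀ i, ∀ᶠ w in 𝓝 q, h i (ψ w) = (G i w).re) →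
      ∃ G : ℂ → ℂ, AnalyticAt ℂ G q ∧ ∀ᶠ w in 𝓝 q, c + ∑ i, A i * h i (ψ w) = (G w).re := by
    intro q G ψ hG he
    refine ⟨fun w => c + ∑ i, A i * G i w, analyticAt_const.add
      (Finset.analyticAt_fun_sum _ fun i _ => analyticAt_const.mul (hG i)), ?_⟩
    filter_upwards [eventually_all.2 he] with w hw
    simp [hw]
  constructor
  · intro p hp
    choose G hG he using fun i => (hh i).finite p hp
    exact key p G _ hG he
  · intro hΩ
    choose G hG he using fun i => (hh i).infinite hΩ
    exact key 0 G _ hG he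

end PrimSphere

namespace GapSystem

variable {g : ℕ} (G : GapSystem g)

/-! ### The integrals of the gap system on the real line -/

section HarmonicMeasure

open Complex Filter

theorem card_endpt : Fintype.card (Fin (g + 1) ⊕ Fin (g + 1)) = 2 * (g + 1) := by
  simp; ring

theorem two_mul_add_four_le (i : Fin g) :
    2 * (i : ℕ) + 4 ≤ Fintype.card (Fin (g + 1) ⊕ Fin (g + 1)) := by
  rw [card_endpt]; omega

theorem branchFun_endpt_ofReal (n : ℕ) (x : ℝ) :
    branchFun G.endpt n x = (x : ℂ) ^ n / G.sqrtT x := by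
  have h : ∀ y : ℝ, branchRoot ((x : ℂ) - y) = ((x : ℂ) - y) ^ (1 / 2 : ℂ) :=
    fun y => branchRoot_eq_cpow (by simp)
  rw [branchFun, sqrtT, Finset.prod_mul_distrib, Fintype.prod_sum_type]
  simp_rw [h]
  rfl

theorem sqrtT_endpt (k : Fin (g + 1) ⊕ Fin (g + 1)) : G.sqrtT (G.endpt k) = 0 := by
  rcases k with k | k
  · exact Finset.prod_eq_zero (Finset.mem_univ k) (by simp [endpt])
  · exact Finset.prod_eq_zero (Finset.mem_univ k) (by simp [endpt])

theorem isRegularPoint_of_mem_gap {j : Fin (g + 1)} {x : ℝ} (hx : (x : OnePoint ℝ) ∈ G.gap j) :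
    IsRegularPoint G.endpt x := fun k => Or.inr fun h => by
  rw [Complex.ofReal_re] at h
  exact G.sqrtT_ne_zero_of_mem_gap hx (h ▸ G.sqrtT_endpt k)

theorem eventually_mem_gap {j : Fin (g + 1)} {x : ℝ} (hx : (x : OnePoint ℝ) ∈ G.gap j) :
    ∀ᶠ y : ℝ in 𝓝 x, (y : OnePoint ℝ) ∈ G.gap j := by
  induction j using Fin.cases with
  | zero =>
    simp_rw [coe_mem_gap_zero] at hx ⊢
    rcases hx with h | h
    · exact (gt_mem_nhds h).mono fun y hy => Or.inl hy
    · exact (lt_mem_nhds h).mono fun y hy => Or.inr hy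
  | succ j =>
    simp_rw [coe_mem_gap_succ] at hx ⊢
    exact (lt_mem_nhds hx.1).and (gt_mem_nhds hx.2)

theorem pow_div_sqrtT_eq_ofReal {j : Fin (g + 1)} {x : ℝ}
    (hx : (x : OnePoint ℝ) ∈ G.closedGap j) (n : ℕ) :
    (x : ℂ) ^ n / G.sqrtT x = ((x ^ n / (G.sqrtT x).re : ℝ) : ℂ) := by
  rw [G.sqrtT_eq_ofReal_re hx, Complex.ofReal_re]
  push_cast; rfl

theorem eventually_branchFun_im {j : Fin (g + 1)} {x : ℝ} (hx : (x : OnePoint ℝ) ∈ G.gap j)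
    (n : ℕ) : ∀ᶠ y : ℝ in 𝓝 x, (branchFun G.endpt n y).im = 0 := by
  filter_upwards [G.eventually_mem_gap hx] with y hy
  rw [branchFun_endpt_ofReal, G.pow_div_sqrtT_eq_ofReal (G.gap_subset_closedGap j hy), ofReal_im]

theorem coe_mem_image_E {x : ℝ} {s : Set ℝ} :
    ((x : ℂ) : OnePoint ℂ) ∈ (fun t : ℝ => ((t : ℂ) : OnePoint ℂ)) '' s ↔ x ∈ s := by
  simp

theorem isLocallyRe_primSphere (i : Fin g) :
    IsLocallyRe (primSphere G.endpt i) ((fun t : ℝ => ((t : ℂ) : OnePoint ℂ)) '' G.E)ᶜ := by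
  refine _root_.isLocallyRe_primSphere G.injective_endpt card_endpt (by omega) fun x hx => ?_
  rw [coe_mem_image_E] at hx
  obtain ⟨j, hj⟩ := (G.mem_E_or_mem_gap x).resolve_left hx
  exact ⟨G.isRegularPoint_of_mem_gap hj, G.eventually_branchFun_im hj i⟩

/-- The restriction of `primSphere` to the real line. -/
noncomputable def primReal (n : ℕ) (x : ℝ) : ℝ := (branchPrim G.endpt n x).re

theorem primSphere_ofReal (n : ℕ) (x : ℝ) :
    primSphere G.endpt n ((x : ℂ) : OnePoint ℂ) = G.primReal n x := by
  rw [primSphere_coe, foldUp_ofReal, primReal]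

theorem continuous_primReal (i : Fin g) : Continuous (G.primReal i) :=
  Complex.continuous_re.comp ((continuousOn_branchPrim G.injective_endpt
    (two_mul_add_four_le i)).comp_continuous Complex.continuous_ofReal fun x => by simp)

theorem hasDerivAt_primReal (i : Fin g) {x : ℝ} (hx : IsRegularPoint G.endpt x) :
    HasDerivAt (G.primReal i) ((x : ℂ) ^ (i : ℕ) / G.sqrtT x).re x := by
  have := hasDerivAt_branchPrim (two_mul_add_four_le i) hx
  rw [branchFun_endpt_ofReal] at this
  exact this.real_of_complex

theorem hasDerivAt_primReal_of_mem_gap (i : Fin g) {j : Fin (g + 1)} {x : ℝ}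
    (hx : (x : OnePoint ℝ) ∈ G.gap j) :
    HasDerivAt (G.primReal i) (x ^ (i : ℕ) / (G.sqrtT x).re) x := by
  have := G.hasDerivAt_primReal i (G.isRegularPoint_of_mem_gap hx)
  rwa [G.pow_div_sqrtT_eq_ofReal (G.gap_subset_closedGap j hx), ofReal_re] at this

theorem contDiffAt_primReal (i : Fin g) {j : Fin (g + 1)} {x : ℝ}
    (hx : (x : OnePoint ℝ) ∈ G.gap j) : ContDiffAt ℝ 1 (G.primReal i) x :=
  (analyticAt_branchPrim (two_mul_add_four_le i)
    (G.isRegularPoint_of_mem_gap hx)).contDiffAt.real_of_complex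

/-- On `E` the root `√T` is imaginary, so the integrand has no real part. -/
theorem hasDerivAt_primReal_of_mem_E (i : Fin g) {x : ℝ} (hx : x ∈ G.E)
    (hx' : ∀ k, x ≠ G.endpt k) : HasDerivAt (G.primReal i) 0 x := by
  have := G.hasDerivAt_primReal i (x := x) fun k => Or.inr (hx' k)
  have hre : G.sqrtT x = I * ((G.sqrtT x).im : ℂ) :=
    Complex.ext (by simp [G.sqrtT_re_of_mem_E hx]) (by simp)
  rw [hre, show (x : ℂ) ^ (i : ℕ) / (I * ((G.sqrtT x).im : ℂ)) =
    I * ((-(x ^ (i : ℕ) / (G.sqrtT x).im) : ℝ) : ℂ) by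
      rw [mul_comm, ← div_div, Complex.div_I]; push_cast; ring, Complex.I_mul_re,
    Complex.ofReal_im, neg_zero] at this
  exact this

end HarmonicMeasure

/-! ### Components of `E`, periods, and the formula for `ω(·, E_k)` -/

section Components

/-- The right endpoint of the component of `E` with left endpoint `b j`. -/
def nextA (j : Fin (g + 1)) : ℝ := G.a (j + 1)

theorem nextA_castSucc (j : Fin g) : G.nextA j.castSucc = G.a j.succ := by
  rw [nextA, Fin.coeSucc_eq_succ]

theorem nextA_last : G.nextA (Fin.last g) = G.a 0 := by
  rw [nextA, Fin.last_add_one]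

theorem b_lt_nextA (j : Fin (g + 1)) : G.b j < G.nextA j := by
  induction j using Fin.lastCases with
  | last => rw [nextA_last]; exact G.b_last_lt
  | cast j => rw [nextA_castSucc]; exact G.b_lt_a j

theorem nextA_le_a {i : Fin (g + 1)} {j : Fin g} (h : i < j.succ) : G.nextA i ≤ G.a j.succ := by
  induction i using Fin.lastCases with
  | last => exact absurd (Fin.le_last j.succ) h.not_ge
  | cast i =>
    rw [nextA_castSucc]
    have : i.succ ≤ j.succ := by
      rw [Fin.lt_def, Fin.val_castSucc, Fin.val_succ] at h
      rw [Fin.le_def, Fin.val_succ, Fin.val_succ]; omega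
    rcases this.eq_or_lt with h' | h'
    · rw [h']
    · exact (G.a_lt_a_of_lt (Fin.succ_ne_zero i) h').le

theorem nextA_le_a_zero (i : Fin (g + 1)) : G.nextA i ≤ G.a 0 := by
  induction i using Fin.lastCases with
  | last => rw [nextA_last]
  | cast i => rw [nextA_castSucc]; exact (G.a_lt_a_zero i).le

theorem mem_E_of_mem_component {j : Fin (g + 1)} {x : ℝ} (h1 : G.b j ≤ x) (h2 : x ≤ G.nextA j) :
    x ∈ G.E := by
  refine G.mem_E_iff.2 ⟨⟨(G.strictMono_b.monotone (Fin.zero_le j)).trans h1,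
    h2.trans (G.nextA_le_a_zero j)⟩, fun k => ?_⟩
  rcases lt_or_ge j k.succ with h | h
  · exact Or.inl (h2.trans (G.nextA_le_a h))
  · exact Or.inr ((G.strictMono_b.monotone h).trans h1)

theorem ne_endpt_of_mem_component {j : Fin (g + 1)} {x : ℝ} (h1 : G.b j < x)
    (h2 : x < G.nextA j) (k : Fin (g + 1) ⊕ Fin (g + 1)) : x ≠ G.endpt k := by
  have ha : ∀ i : Fin (g + 1), x ≠ G.a i := by
    intro i
    induction i using Fin.cases with
    | zero => exact (h2.trans_le (G.nextA_le_a_zero j)).ne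
    | succ i =>
      rcases lt_or_ge j i.succ with h | h
      · exact (h2.trans_le (G.nextA_le_a h)).ne
      · exact ((G.a_lt_b i).trans_le (G.strictMono_b.monotone h) |>.trans h1).ne'
  have hb : ∀ i : Fin (g + 1), x ≠ G.b i := by
    intro i
    rcases le_or_gt i j with h | h
    · exact ((G.strictMono_b.monotone h).trans_lt h1).ne'
    · obtain ⟨i, rfl⟩ := Fin.exists_succ_eq.2 (Fin.ne_zero_of_lt h)
      exact (h2.trans_le (G.nextA_le_a h) |>.trans (G.a_lt_b i)).ne
  rcases k with k | k
  · exact ha k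
  · exact hb k

theorem exists_component_of_mem_E {x : ℝ} (hx : x ∈ G.E) :
    ∃ j, G.b j ≤ x ∧ x ≤ G.nextA j := by
  obtain ⟨⟨h1, h2⟩, h3⟩ := G.mem_E_iff.1 hx
  have key : ∀ j : Fin (g + 1), G.b j ≤ x ∨ ∃ i, G.b i ≤ x ∧ x ≤ G.nextA i := by
    intro j
    induction j using Fin.induction with
    | zero => exact Or.inl h1
    | succ j ih =>
      rcases ih with ih | ih
      · rcases h3 j with h | h
        · exact Or.inr ⟨j.castSucc, ih, by rwa [nextA_castSucc]⟩
        · exact Or.inl h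
      · exact Or.inr ih
  rcases key (Fin.last g) with h | h
  · exact ⟨Fin.last g, h, by rwa [nextA_last]⟩
  · exact h

theorem primReal_eq_of_mem_component (i : Fin g) {j : Fin (g + 1)} {x : ℝ} (h1 : G.b j ≤ x)
    (h2 : x ≤ G.nextA j) : G.primReal i x = G.primReal i (G.b j) := by
  rcases h1.eq_or_lt with rfl | h1
  · rfl
  obtain ⟨c, -, hc⟩ := exists_hasDerivAt_eq_slope (G.primReal i) (fun _ => 0) h1
    (G.continuous_primReal i).continuousOn fun y hy =>
      G.hasDerivAt_primReal_of_mem_E i (G.mem_E_of_mem_component hy.1.le (hy.2.le.trans h2))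
        (G.ne_endpt_of_mem_component hy.1 (hy.2.trans_le h2))
  rw [eq_comm, div_eq_zero_iff] at hc
  rcases hc with h | h <;> linarith

/-- The periods over the gaps of the differentials `x ^ i dx / √T`. -/
noncomputable def periodMatrix : Matrix (Fin g) (Fin g) ℝ :=
  Matrix.of fun j i => G.primReal i (G.b j.succ) - G.primReal i (G.a j.succ)

/-- A kernel vector gives a polynomial of degree less than `g` whose integral against `dx/√T`
vanishes over each of the `g` inner gaps. By Rolle it has a zero in each of them, so it is zero. -/
theorem det_periodMatrix_ne_zero : G.periodMatrix.det ≠ 0 := by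
  intro hdet
  obtain ⟨c, hc, hcM⟩ := Matrix.exists_mulVec_eq_zero_iff.2 hdet
  have hroot : ∀ j : Fin g, ∃ ξ ∈ Set.Ioo (G.a j.succ) (G.b j.succ),
      ∑ i : Fin g, c i * ξ ^ (i : ℕ) = 0 := by
    intro j
    have hgap : ∀ x ∈ Set.Ioo (G.a j.succ) (G.b j.succ), (x : OnePoint ℝ) ∈ G.gap j.succ :=
      fun x hx => (G.coe_mem_gap_succ j).2 hx
    obtain ⟨ξ, hξ, h0⟩ := exists_hasDerivAt_eq_zero (f := fun x => ∑ i, c i * G.primReal i x)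
      (f' := fun x => ∑ i : Fin g, c i * (x ^ (i : ℕ) / (G.sqrtT x).re)) (G.a_lt_b j)
      (continuous_finsetSum _ fun i _ =>
        continuous_const.mul (G.continuous_primReal i)).continuousOn
      (by
        have := congrFun hcM j
        simp only [Matrix.mulVec, dotProduct, periodMatrix, Matrix.of_apply, Pi.zero_apply,
          sub_mul, Finset.sum_sub_distrib] at this
        rw [sub_eq_zero] at this
        simp_rw [mul_comm (c _)]
        exact this.symm)
      fun x hx => HasDerivAt.fun_sum fun i _ =>
        (G.hasDerivAt_primReal_of_mem_gap i (hgap x hx)).const_mul (c i)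
    refine ⟨ξ, hξ, ?_⟩
    have hs : (G.sqrtT ξ).re ≠ 0 := fun h => G.sqrtT_ne_zero_of_mem_gap (hgap ξ hξ) <| by
      rw [G.sqrtT_eq_ofReal_re (G.gap_subset_closedGap _ (hgap ξ hξ)), h, Complex.ofReal_zero]
    have h0' : (∑ i : Fin g, c i * ξ ^ (i : ℕ)) / (G.sqrtT ξ).re = 0 := by
      rw [Finset.sum_div, ← h0]
      exact Finset.sum_congr rfl fun i _ => mul_div_assoc _ _ _
    exact (div_eq_zero_iff.1 h0').resolve_right hs
  choose ξ hξ hξ0 using hroot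
  have hinj : Function.Injective ξ := by
    have := G.injective_of_mem_closedGap (x := Fin.cons (G.a 0) ξ) fun j => by
      induction j using Fin.cases with
      | zero => exact G.coe_a_mem_closedGap 0
      | succ j =>
        rw [Fin.cons_succ]
        exact (G.coe_mem_closedGap_succ j).2 ⟨(hξ j).1.le, (hξ j).2.le⟩
    have h2 := this.comp (Fin.succ_injective g)
    exact h2
  exact hc (eq_zero_of_forall_eval_eq_zero hinj hξ0)

/-- The coefficients of the polynomials `P_k` for which `d ω(x, E_k) = P_k dx / √T`. -/
noncomputable def omegaCoeff : Matrix (Fin g) (Fin g) ℝ :=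
  -G.periodMatrix⁻¹.transpose

theorem det_omegaCoeff_ne_zero : G.omegaCoeff.det ≠ 0 := by
  rw [omegaCoeff, Matrix.det_neg, Matrix.det_transpose, Matrix.det_nonsing_inv,
    Ring.inverse_eq_inv']
  exact mul_ne_zero (pow_ne_zero _ (by norm_num)) (inv_ne_zero G.det_periodMatrix_ne_zero)

/-- Prescribes the jumps across the gaps: the only change is the drop by `1` across the gap just to
the right of `E_k`. -/
theorem sum_omegaCoeff_mul_period (k j : Fin g) :
    ∑ i, G.omegaCoeff k i * (G.primReal i (G.b j.succ) - G.primReal i (G.a j.succ)) =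
      if j = k then -1 else 0 := by
  have h := Matrix.mul_nonsing_inv G.periodMatrix (isUnit_iff_ne_zero.2 G.det_periodMatrix_ne_zero)
  have h2 := congrFun (congrFun h j) k
  rw [Matrix.mul_apply, Matrix.one_apply] at h2
  have h3 : ∑ i, G.omegaCoeff k i * (G.primReal i (G.b j.succ) - G.primReal i (G.a j.succ)) =
      -∑ i, G.periodMatrix j i * G.periodMatrix⁻¹ i k := by
    rw [← Finset.sum_neg_distrib]
    refine Finset.sum_congr rfl fun i _ => ?_
    simp [omegaCoeff, periodMatrix]
    ring
  rw [h3, h2]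
  split_ifs <;> simp

/-- The value of the harmonic measure of `E_k` at infinity. -/
noncomputable def omegaConst (k : Fin g) : ℝ :=
  1 - ∑ i, G.omegaCoeff k i * G.primReal i (G.b 0)

/-- The value is `1` at `b 0` by the choice of the constant and stays constant along components, so
it is found by adding up the jumps across the gaps from left to right. -/
theorem omegaConst_add_sum_b (k : Fin g) (j : Fin (g + 1)) :
    G.omegaConst k + ∑ i, G.omegaCoeff k i * G.primReal i (G.b j) =
      if j < k.succ then 1 else 0 := by
  induction j using Fin.induction with
  | zero => rw [if_pos (Fin.succ_pos k), omegaConst]; ring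
  | succ j ih =>
    have h1 := G.sum_omegaCoeff_mul_period k j
    simp_rw [mul_sub, Finset.sum_sub_distrib] at h1
    have h2 : ∀ i : Fin g, G.primReal i (G.a j.succ) = G.primReal i (G.b j.castSucc) := fun i => by
      rw [← nextA_castSucc]
      exact G.primReal_eq_of_mem_component i (G.b_lt_nextA _).le le_rfl
    simp_rw [h2] at h1
    have h3 : (j.castSucc < k.succ ↔ (j : ℕ) ≤ k) := by
      rw [Fin.lt_def, Fin.val_castSucc, Fin.val_succ, Nat.lt_succ_iff]
    have h4 : (j.succ < k.succ ↔ (j : ℕ) < k) := by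
      rw [Fin.lt_def, Fin.val_succ, Fin.val_succ, Nat.succ_lt_succ_iff]
    have h5 : (j = k ↔ (j : ℕ) = k) := Fin.ext_iff
    simp only [h3, h4, h5] at ih h1 ⊢
    split_ifs at ih h1 ⊢ <;> first | omega | linarith

theorem isCompact_E : IsCompact G.E :=
  isCompact_Icc.diff (isOpen_iUnion fun _ => isOpen_Ioo)

theorem omegaConst_add_sum_of_mem_E (k : Fin g) {x : ℝ} (hx : x ∈ G.E) :
    G.omegaConst k + ∑ i, G.omegaCoeff k i * G.primReal i x =
      (G.Ek k).indicator (fun _ => (1 : ℝ)) x := by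
  obtain ⟨j, h1, h2⟩ := G.exists_component_of_mem_E hx
  have h3 : ∀ i : Fin g, G.primReal i x = G.primReal i (G.b j) :=
    fun i => G.primReal_eq_of_mem_component i h1 h2
  simp_rw [h3]
  rw [omegaConst_add_sum_b]
  split_ifs with h
  · rw [Set.indicator_of_mem]
    exact ⟨hx, (G.mem_E_iff.1 hx).1.1, h2.trans (G.nextA_le_a h)⟩
  · rw [Set.indicator_of_notMem]
    rintro ⟨-, -, h4⟩
    have := G.strictMono_b.monotone (not_lt.1 h)
    have := G.a_lt_b k
    linarith

/-- The harmonic measures of the sets `E_k` are combinations of hyperelliptic integrals. -/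
theorem omega_eq (k : Fin g) (x : OnePoint ℝ) :
    G.omega k x =
      G.omegaConst k + ∑ i, G.omegaCoeff k i * primSphere G.endpt i (realToSphere x) := by
  have hcoe : Continuous fun t : ℝ => ((t : ℂ) : OnePoint ℂ) :=
    OnePoint.continuous_coe.comp Complex.continuous_ofReal
  refine harmonicMeasure_eq (h := fun p => G.omegaConst k + ∑ i, G.omegaCoeff k i *
    primSphere G.endpt i p) (G.isCompact_E.image hcoe).isClosed ?_ ?_
    (IsLocallyRe.const_add_sum G.isLocallyRe_primSphere _ _) ?_ _
  · exact ⟨_, G.b 0, G.mem_E_of_mem_component le_rfl (G.b_lt_nextA 0).le, rfl⟩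
  · refine continuous_const.add (continuous_finsetSum _ fun i _ => continuous_const.mul ?_)
    exact continuous_primSphere G.injective_endpt (two_mul_add_four_le i)
  · rintro _ ⟨t, ht, rfl⟩
    simp only [primSphere_ofReal]
    rw [G.omegaConst_add_sum_of_mem_E k ht]
    by_cases h : t ∈ G.Ek k
    · rw [Set.indicator_of_mem h, Set.indicator_of_mem (coe_mem_image_E.2 h)]
    · rw [Set.indicator_of_notMem h, Set.indicator_of_notMem (fun h' => h (coe_mem_image_E.1 h'))]

theorem omega_coe (k : Fin g) (x : ℝ) :
    G.omega k (x : OnePoint ℝ) = G.omegaConst k + ∑ i, G.omegaCoeff k i * G.primReal i x := by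
  rw [omega_eq]
  simp_rw [← primSphere_ofReal]
  rfl

theorem hasDerivAt_omega (k : Fin g) {j : Fin (g + 1)} {x : ℝ} (hx : (x : OnePoint ℝ) ∈ G.gap j) :
    HasDerivAt (fun x : ℝ => G.omega k (x : OnePoint ℝ))
      (∑ i, G.omegaCoeff k i * (x ^ (i : ℕ) / (G.sqrtT x).re)) x := by
  simp_rw [omega_coe]
  exact (HasDerivAt.fun_sum fun i _ =>
    (G.hasDerivAt_primReal_of_mem_gap i hx).const_mul _).const_add _

theorem contDiffAt_omega (k : Fin g) {j : Fin (g + 1)} {x : ℝ} (hx : (x : OnePoint ℝ) ∈ G.gap j) :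
    ContDiffAt ℝ 1 (fun x : ℝ => G.omega k (x : OnePoint ℝ)) x := by
  simp_rw [omega_coe]
  exact contDiffAt_const.add (ContDiffAt.sum fun i _ =>
    contDiffAt_const.mul (G.contDiffAt_primReal i hx))

open Classical in
/-- The chart `ζ ↦ -1/ζ` of the circle `ℝ ∪ {∞}` at infinity. -/
noncomputable def _root_.circleInv (ζ : ℝ) : OnePoint ℝ :=
  if ζ = 0 then OnePoint.infty else ((-ζ⁻¹ : ℝ) : OnePoint ℝ)

theorem realToSphere_circleInv (ζ : ℝ) : realToSphere (circleInv ζ) = sphereInv ζ := by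
  by_cases h : ζ = 0
  · subst h; simp [circleInv, sphereInv, realToSphere]
  · have h' : (ζ : ℂ) ≠ 0 := by exact_mod_cast h
    rw [sphereInv_of_ne h', circleInv, if_neg h, realToSphere, OnePoint.map_some]
    push_cast; rfl

/-- In the coordinate `-1/x` only the differential with the top exponent `g - 1` is nonzero at
infinity. -/
theorem omega_circleInv (k : Fin g) :
    HasDerivAt (fun ζ : ℝ => G.omega k (circleInv ζ))
      (∑ i : Fin g, G.omegaCoeff k i * if (i : ℕ) + 1 = g then 1 else 0) 0 ∧
    ContDiffAt ℝ 1 (fun ζ : ℝ => G.omega k (circleInv ζ)) 0 := by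
  have h : ∀ i : Fin g, ∃ f : ℂ → ℂ, AnalyticAt ℂ f ((0 : ℝ) : ℂ) ∧
      HasDerivAt f (if (i : ℕ) + 2 = g + 1 then 1 else 0) ((0 : ℝ) : ℂ) ∧
      ∀ᶠ ζ : ℂ in 𝓝 ((0 : ℝ) : ℂ), primSphere G.endpt i (sphereInv ζ) = (f ζ).re := fun i => by
    simpa using primSphere_eventually_eq_infty G.injective_endpt card_endpt (n := i) (by omega)
  choose f hfa hfd hfe using h
  have hev : (fun ζ : ℝ => G.omega k (circleInv ζ)) =ᶠ[𝓝 0]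
      fun ζ : ℝ => G.omegaConst k + ∑ i, G.omegaCoeff k i * (f i ζ).re := by
    filter_upwards [(Complex.continuous_ofReal.tendsto 0).eventually
      (Filter.eventually_all.2 hfe)] with ζ hζ
    rw [omega_eq, realToSphere_circleInv]
    simp_rw [hζ]
  constructor
  · refine HasDerivAt.congr_of_eventuallyEq ?_ hev
    refine (HasDerivAt.fun_sum fun i _ => ?_).const_add _
    have := ((hfd i).real_of_complex).const_mul (G.omegaCoeff k i)
    refine this.congr_deriv ?_
    have : ((i : ℕ) + 2 = g + 1 ↔ (i : ℕ) + 1 = g) := by omega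
    simp only [this]
    split_ifs <;> simp
  · refine ContDiffAt.congr_of_eventuallyEq ?_ hev
    exact contDiffAt_const.add (ContDiffAt.sum fun i _ =>
      contDiffAt_const.mul (hfa i).contDiffAt.real_of_complex)

end Components

end GapSystem

/-! ### The Poisson integrals over the gaps -/

section Poisson

open Filter MeasureTheory

/-- A primitive of `t ↦ 1 / |t - z|²`. -/
noncomputable def poissonPrim (z : ℂ) (t : ℝ) : ℝ := Real.arctan ((t - z.re) / z.im) / z.im

variable {z : ℂ}

theorem norm_ofReal_sub_sq (t : ℝ) (z : ℂ) :
    ‖(t : ℂ) - z‖ ^ 2 = (t - z.re) ^ 2 + z.im ^ 2 := by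
  rw [← Complex.normSq_eq_norm_sq, Complex.normSq_apply]
  simp
  ring

theorem one_div_norm_ofReal_sub_sq (hz : z.im ≠ 0) (t : ℝ) :
    1 / ‖(t : ℂ) - z‖ ^ 2 = (z.im ^ 2)⁻¹ * (1 + ((t - z.re) / z.im) ^ 2)⁻¹ := by
  rw [norm_ofReal_sub_sq, ← mul_inv, one_div]
  congr 1
  field_simp
  ring

theorem hasDerivAt_poissonPrim (hz : z.im ≠ 0) (t : ℝ) :
    HasDerivAt (poissonPrim z) (1 / ‖(t : ℂ) - z‖ ^ 2) t := by
  have h := ((((hasDerivAt_id t).sub_const z.re).div_const z.im).arctan).div_const z.im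
  refine h.congr_deriv ?_
  rw [one_div_norm_ofReal_sub_sq hz]
  simp only [id]
  field_simp

theorem integrable_one_div_norm_sq (hz : z.im ≠ 0) :
    Integrable fun t : ℝ => 1 / ‖(t : ℂ) - z‖ ^ 2 := by
  simp_rw [one_div_norm_ofReal_sub_sq hz]
  exact (((integrable_inv_one_add_sq.comp_div hz).comp_sub_right z.re)).const_mul _

theorem tendsto_poissonPrim_atTop (hz : 0 < z.im) :
    Tendsto (poissonPrim z) atTop (𝓝 (Real.pi / 2 / z.im)) := by
  refine Tendsto.div_const ?_ _
  refine (tendsto_nhds_of_tendsto_nhdsWithin Real.tendsto_arctan_atTop).comp ?_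
  exact (tendsto_atTop_add_const_right _ _ tendsto_id).atTop_div_const hz

theorem tendsto_poissonPrim_atBot (hz : 0 < z.im) :
    Tendsto (poissonPrim z) atBot (𝓝 (-(Real.pi / 2) / z.im)) := by
  refine Tendsto.div_const ?_ _
  refine (tendsto_nhds_of_tendsto_nhdsWithin Real.tendsto_arctan_atBot).comp ?_
  exact (tendsto_atBot_add_const_right _ _ tendsto_id).atBot_div_const hz

theorem integral_Icc_poisson (hz : z.im ≠ 0) {p x : ℝ} (h : p ≤ x) :
    ∫ t in Set.Icc p x, 1 / ‖(t : ℂ) - z‖ ^ 2 = poissonPrim z x - poissonPrim z p := by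
  rw [integral_Icc_eq_integral_Ioc, ← intervalIntegral.integral_of_le h]
  exact intervalIntegral.integral_eq_sub_of_hasDerivAt (fun t _ => hasDerivAt_poissonPrim hz t)
    (integrable_one_div_norm_sq hz).intervalIntegrable

theorem integral_Ici_poisson (hz : 0 < z.im) (p : ℝ) :
    ∫ t in Set.Ici p, 1 / ‖(t : ℂ) - z‖ ^ 2 = Real.pi / 2 / z.im - poissonPrim z p := by
  rw [integral_Ici_eq_integral_Ioi]
  exact integral_Ioi_of_hasDerivAt_of_tendsto' (fun t _ => hasDerivAt_poissonPrim hz.ne' t)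
    (integrable_one_div_norm_sq hz.ne').integrableOn (tendsto_poissonPrim_atTop hz)

theorem integral_Iic_poisson (hz : 0 < z.im) (p : ℝ) :
    ∫ t in Set.Iic p, 1 / ‖(t : ℂ) - z‖ ^ 2 = poissonPrim z p + Real.pi / 2 / z.im := by
  rw [integral_Iic_of_hasDerivAt_of_tendsto' (fun t _ => hasDerivAt_poissonPrim hz.ne' t)
    (integrable_one_div_norm_sq hz.ne').integrableOn (tendsto_poissonPrim_atBot hz)]
  ring

theorem integral_Ici_union_Iic_poisson (hz : 0 < z.im) {p q : ℝ} (h : q < p) :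
    ∫ t in Set.Ici p ∪ Set.Iic q, 1 / ‖(t : ℂ) - z‖ ^ 2 =
      poissonPrim z q - poissonPrim z p + Real.pi / z.im := by
  have hi := integrable_one_div_norm_sq hz.ne'
  rw [setIntegral_union (Set.disjoint_left.2 fun t h1 h2 =>
      (h.trans_le (Set.mem_Ici.1 h1)).not_ge (Set.mem_Iic.1 h2)) measurableSet_Iic hi.integrableOn
      hi.integrableOn, integral_Ici_poisson hz, integral_Iic_poisson hz]
  ring

/-- The contribution of a gap to `GapSystem.poissonSum`. -/
noncomputable def gapPoisson (p q : ℝ) (z : ℂ) (x : OnePoint ℝ) : ℝ :=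
  (∫ t in arcTo p x, 1 / ‖(t : ℂ) - z‖ ^ 2) - ∫ t in arcFrom q x, 1 / ‖(t : ℂ) - z‖ ^ 2

/-- The primitive is an arctangent, and an arc that passes through infinity picks up the total mass
`π / Im z`. The indicators record on which side of the endpoints this happens. -/
theorem gapPoisson_coe (hz : 0 < z.im) (p q x : ℝ) :
    gapPoisson p q z (x : OnePoint ℝ) = 2 * poissonPrim z x - poissonPrim z p - poissonPrim z q +
      Real.pi / z.im * ((if x < p then 1 else 0) - (if q < x then 1 else 0)) := by
  have h1 : ∫ t in arcTo p (x : OnePoint ℝ), 1 / ‖(t : ℂ) - z‖ ^ 2 = poissonPrim z x -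
      poissonPrim z p + Real.pi / z.im * (if x < p then 1 else 0) := by
    rw [arcTo, OnePoint.elim_some]
    by_cases h : p ≤ x
    · rw [if_pos h, if_neg h.not_gt, integral_Icc_poisson hz.ne' h]; ring
    · rw [if_neg h, if_pos (not_le.1 h), integral_Ici_union_Iic_poisson hz (not_le.1 h)]; ring
  have h2 : ∫ t in arcFrom q (x : OnePoint ℝ), 1 / ‖(t : ℂ) - z‖ ^ 2 = poissonPrim z q -
      poissonPrim z x + Real.pi / z.im * (if q < x then 1 else 0) := by
    rw [arcFrom, OnePoint.elim_some]
    by_cases h : x ≤ q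
    · rw [if_pos h, if_neg h.not_gt, integral_Icc_poisson hz.ne' h]; ring
    · rw [if_neg h, if_pos (not_le.1 h), integral_Ici_union_Iic_poisson hz (not_le.1 h)]; ring
  rw [gapPoisson, h1, h2]
  ring

theorem gapPoisson_infty (hz : 0 < z.im) (p q : ℝ) :
    gapPoisson p q z OnePoint.infty = -poissonPrim z p - poissonPrim z q := by
  rw [gapPoisson, arcTo, arcFrom, OnePoint.elim_infty, OnePoint.elim_infty,
    integral_Ici_poisson hz, integral_Iic_poisson hz]
  ring

theorem eventually_im_pos (hz : 0 < z.im) : ∀ᶠ w : ℂ in 𝓝 z, 0 < w.im :=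
  Complex.continuous_im.continuousAt.eventually (lt_mem_nhds hz)

theorem gapPoisson_eventually_eq (hz : 0 < z.im) {p q x : ℝ} (hp : x ≠ p) (hq : x ≠ q) :
    (fun v : ℂ × ℝ => gapPoisson p q v.1 (v.2 : OnePoint ℝ)) =ᶠ[𝓝 (z, x)]
      fun v => 2 * poissonPrim v.1 v.2 - poissonPrim v.1 p - poissonPrim v.1 q +
        Real.pi / v.1.im * ((if x < p then 1 else 0) - (if q < x then 1 else 0)) := by
  have h1 : ∀ᶠ y : ℝ in 𝓝 x, (y < p ↔ x < p) := by
    rcases lt_or_gt_of_ne hp with h | h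
    · exact (gt_mem_nhds h).mono fun y hy => iff_of_true hy h
    · exact (lt_mem_nhds h).mono fun y hy => iff_of_false hy.not_gt h.not_gt
  have h2 : ∀ᶠ y : ℝ in 𝓝 x, (q < y ↔ q < x) := by
    rcases lt_or_gt_of_ne hq with h | h
    · exact (gt_mem_nhds h).mono fun y hy => iff_of_false hy.not_gt h.not_gt
    · exact (lt_mem_nhds h).mono fun y hy => iff_of_true hy h
  rw [nhds_prod_eq]
  filter_upwards [(eventually_im_pos hz).prod_mk (h1.and h2)] with v hv
  rw [gapPoisson_coe hv.1]
  simp only [hv.2.1, hv.2.2]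

theorem contDiffAt_re {v : ℂ} : ContDiffAt ℝ 1 Complex.re v := Complex.reCLM.contDiff.contDiffAt

theorem contDiffAt_im {v : ℂ} : ContDiffAt ℝ 1 Complex.im v := Complex.imCLM.contDiff.contDiffAt

theorem contDiffAt_poissonPrim {F : Type*} [NormedAddCommGroup F] [NormedSpace ℝ F] {f : F → ℂ}
    {h : F → ℝ} {v : F} (hf : ContDiffAt ℝ 1 f v) (hh : ContDiffAt ℝ 1 h v)
    (hv : (f v).im ≠ 0) : ContDiffAt ℝ 1 (fun v => poissonPrim (f v) (h v)) v := by
  have h1 : ContDiffAt ℝ 1 (fun v => (f v).re) v := contDiffAt_re.comp v hf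
  have h2 : ContDiffAt ℝ 1 (fun v => (f v).im) v := contDiffAt_im.comp v hf
  exact (((hh.sub h1).div h2 hv).arctan).div h2 hv

theorem contDiffAt_gapPoisson (hz : 0 < z.im) {p q x : ℝ} (hp : x ≠ p) (hq : x ≠ q) :
    ContDiffAt ℝ 1 (fun v : ℂ × ℝ => gapPoisson p q v.1 (v.2 : OnePoint ℝ)) (z, x) := by
  refine ContDiffAt.congr_of_eventuallyEq ?_ (gapPoisson_eventually_eq hz hp hq)
  have h2 : ContDiffAt ℝ 1 (fun v : ℂ × ℝ => v.1.im) (z, x) := contDiffAt_im.comp _ contDiffAt_fst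
  exact (((contDiffAt_const.mul (contDiffAt_poissonPrim contDiffAt_fst contDiffAt_snd hz.ne')).sub
    (contDiffAt_poissonPrim contDiffAt_fst contDiffAt_const hz.ne')).sub
    (contDiffAt_poissonPrim contDiffAt_fst contDiffAt_const hz.ne')).add
    ((contDiffAt_const.div h2 hz.ne').mul contDiffAt_const)

theorem hasDerivAt_gapPoisson (hz : 0 < z.im) {p q x : ℝ} (hp : x ≠ p) (hq : x ≠ q) :
    HasDerivAt (fun x : ℝ => gapPoisson p q z (x : OnePoint ℝ)) (2 / ‖(x : ℂ) - z‖ ^ 2) x := by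
  have hev := (Continuous.prodMk_right z).continuousAt (x := x) |>.tendsto.eventually
    (gapPoisson_eventually_eq hz hp hq)
  refine HasDerivAt.congr_of_eventuallyEq ?_ hev
  simp only
  refine (((((hasDerivAt_poissonPrim hz.ne' x).const_mul 2).sub_const _).sub_const _).add_const
    _).congr_deriv ?_
  ring

/-- Near infinity, `arctan (1/y) = ± π/2 - arctan y` absorbs exactly the jumps by `π / Im z`, so the
function becomes smooth in `ζ`. Positivity of `1 + ζ p` and `1 + ζ q` ensures that `-1/ζ` lies
beyond both endpoints. -/
theorem gapPoisson_circleInv_eventually_eq (hz : 0 < z.im) (p q : ℝ) :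
    (fun v : ℂ × ℝ => gapPoisson p q v.1 (circleInv v.2)) =ᶠ[𝓝 (z, 0)]
      fun v => 2 * (Real.arctan (v.2 * v.1.im / (1 + v.2 * v.1.re)) / v.1.im) -
        poissonPrim v.1 p - poissonPrim v.1 q := by
  have h1 : ∀ᶠ v : ℂ × ℝ in 𝓝 (z, 0), 0 < 1 + v.2 * v.1.re := by
    have : ContinuousAt (fun v : ℂ × ℝ => 1 + v.2 * v.1.re) (z, 0) := by fun_prop
    exact this.eventually (lt_mem_nhds (by simp))
  have h2 : ∀ (s : ℝ), ∀ᶠ v : ℂ × ℝ in 𝓝 (z, 0), 0 < 1 + v.2 * s := by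
    intro s
    have : ContinuousAt (fun v : ℂ × ℝ => 1 + v.2 * s) (z, 0) := by fun_prop
    exact this.eventually (lt_mem_nhds (by simp))
  have h3 : ∀ᶠ v : ℂ × ℝ in 𝓝 (z, 0), 0 < v.1.im := by
    have : ContinuousAt (fun v : ℂ × ℝ => v.1.im) (z, 0) := by fun_prop
    exact this.eventually (lt_mem_nhds hz)
  filter_upwards [h1, h2 p, h2 q, h3] with ⟨w, ζ⟩ h1 hp hq h3
  simp only at h1 hp hq h3 ⊢
  by_cases h0 : ζ = 0
  · subst h0
    rw [circleInv, if_pos rfl, gapPoisson_infty h3]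
    simp
  · rw [circleInv, if_neg h0, gapPoisson_coe h3]
    set y := ζ * w.im / (1 + ζ * w.re) with hy
    have harg : (-ζ⁻¹ - w.re) / w.im = -y⁻¹ := by
      rw [hy]
      field_simp
      ring
    have hpr : poissonPrim w (-ζ⁻¹) = -Real.arctan y⁻¹ / w.im := by
      rw [poissonPrim, harg, Real.arctan_neg]
    rw [hpr]
    have hsub : ∀ s : ℝ, -ζ⁻¹ - s = (1 + ζ * s) * -ζ⁻¹ := fun s => by field_simp; ring
    rcases lt_or_gt_of_ne h0 with h | h
    · have hy0 : y < 0 := div_neg_of_neg_of_pos (mul_neg_of_neg_of_pos h h3) h1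
      have hζ : 0 < -ζ⁻¹ := neg_pos.2 (inv_lt_zero.2 h)
      have e1 : p < -ζ⁻¹ := sub_pos.1 (by rw [hsub]; exact mul_pos hp hζ)
      have e2 : q < -ζ⁻¹ := sub_pos.1 (by rw [hsub]; exact mul_pos hq hζ)
      rw [if_neg e1.not_gt, if_pos e2, Real.arctan_inv_of_neg hy0]
      ring
    · have hy0 : 0 < y := div_pos (mul_pos h h3) h1
      have hζ : -ζ⁻¹ < 0 := neg_lt_zero.2 (inv_pos.2 h)
      have e1 : -ζ⁻¹ < p := sub_neg.1 (by rw [hsub]; exact mul_neg_of_pos_of_neg hp hζ)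
      have e2 : -ζ⁻¹ < q := sub_neg.1 (by rw [hsub]; exact mul_neg_of_pos_of_neg hq hζ)
      rw [if_pos e1, if_neg e2.not_gt, Real.arctan_inv_of_pos hy0]
      ring

theorem contDiffAt_gapPoisson_circleInv (hz : 0 < z.im) (p q : ℝ) :
    ContDiffAt ℝ 1 (fun v : ℂ × ℝ => gapPoisson p q v.1 (circleInv v.2)) (z, 0) := by
  refine ContDiffAt.congr_of_eventuallyEq ?_ (gapPoisson_circleInv_eventually_eq hz p q)
  have h1 : ContDiffAt ℝ 1 (fun v : ℂ × ℝ => v.1.re) (z, 0) := contDiffAt_re.comp _ contDiffAt_fst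
  have h2 : ContDiffAt ℝ 1 (fun v : ℂ × ℝ => v.1.im) (z, 0) := contDiffAt_im.comp _ contDiffAt_fst
  have h3 : ContDiffAt ℝ 1 (fun v : ℂ × ℝ => v.2) (z, 0) := contDiffAt_snd
  exact ((contDiffAt_const.mul ((((h3.mul h2).div (contDiffAt_const.add (h3.mul h1))
    (by simp)).arctan).div h2 hz.ne')).sub
    (contDiffAt_poissonPrim contDiffAt_fst contDiffAt_const hz.ne')).sub
    (contDiffAt_poissonPrim contDiffAt_fst contDiffAt_const hz.ne')

theorem hasDerivAt_gapPoisson_circleInv (hz : 0 < z.im) (p q : ℝ) :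
    HasDerivAt (fun ζ : ℝ => gapPoisson p q z (circleInv ζ)) 2 0 := by
  have hev := (Continuous.prodMk_right z).continuousAt (x := (0 : ℝ)) |>.tendsto.eventually
    (gapPoisson_circleInv_eventually_eq hz p q)
  refine HasDerivAt.congr_of_eventuallyEq ?_ hev
  simp only
  have h1 : HasDerivAt (fun ζ : ℝ => ζ * z.im) z.im 0 := by
    simpa using (hasDerivAt_id (0 : ℝ)).mul_const z.im
  have h2 : HasDerivAt (fun ζ : ℝ => 1 + ζ * z.re) z.re 0 := by
    simpa using ((hasDerivAt_id (0 : ℝ)).mul_const z.re).const_add 1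
  refine ((((((h1.fun_div h2 (by simp)).arctan).div_const z.im).const_mul 2).sub_const
    _).sub_const _).congr_deriv ?_
  simp [div_self hz.ne']

end Poisson

/-! ### Determinant and derivative of a system with separated variables -/

section Determinants

open Finset

/-- `M` is the product of the block matrix `diag(A, 1)` with `N`. -/
theorem det_snoc_mul {g : ℕ} (A : Matrix (Fin g) (Fin g) ℝ)
    {M N : Matrix (Fin (g + 1)) (Fin (g + 1)) ℝ}
    (h : ∀ k j, M (Fin.castSucc k) j = ∑ i, A k i * N (Fin.castSucc i) j)
    (hl : ∀ j, M (Fin.last g) j = N (Fin.last g) j) : M.det = A.det * N.det := by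
  set B : Matrix (Fin (g + 1)) (Fin (g + 1)) ℝ := Matrix.of fun i j =>
    Fin.lastCases (motive := fun _ => ℝ) (Fin.lastCases (motive := fun _ => ℝ) 1 (fun _ => 0) j)
      (fun k => Fin.lastCases (motive := fun _ => ℝ) 0 (fun l => A k l) j) i with hB
  have hM : M = B * N := by
    ext i j
    rw [Matrix.mul_apply, Fin.sum_univ_castSucc]
    induction i using Fin.lastCases with
    | last => simp [hB, hl]
    | cast k => simp [hB, h]
  have hdet : B.det = A.det := by
    rw [Matrix.det_succ_row B (Fin.last g), Fin.sum_univ_castSucc]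
    have : B.submatrix (Fin.last g).succAbove (Fin.last g).succAbove = A := by
      ext i j
      simp [hB]
    rw [this]
    simp [hB, ← two_mul]
  rw [hM, Matrix.det_mul, hdet]

/-- Each left-hand side of the system is a sum of functions of single variables, so one-variable
derivatives suffice. -/
theorem hasFDerivAt_sum_apply {n : ℕ} {φ : Fin n → Fin n → ℝ → ℝ} {x : Fin n → ℝ}
    {M : Matrix (Fin n) (Fin n) ℝ} (h : ∀ i j, HasDerivAt (φ i j) (M i j) (x j)) :
    HasFDerivAt (fun y : Fin n → ℝ => fun i => ∑ j, φ i j (y j))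
      (LinearMap.toContinuousLinearMap (Matrix.toLin' M)) x := by
  rw [hasFDerivAt_pi']
  intro i
  have h1 : HasFDerivAt (fun y : Fin n → ℝ => ∑ j, φ i j (y j))
      (∑ j, (M i j) • (ContinuousLinearMap.proj j : (Fin n → ℝ) →L[ℝ] ℝ)) x :=
    HasFDerivAt.fun_sum fun j _ => (h i j).comp_hasFDerivAt (f := fun y : Fin n → ℝ => y j) x
      (hasFDerivAt_apply j x)
  refine h1.congr_fderiv ?_
  ext v
  simp [Matrix.mulVec, dotProduct]

end Determinants

namespace GapSystem

variable {g : ℕ} (G : GapSystem g)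

/-! ### The Jacobian of part (ii) -/

section Jacobian

open Finset

theorem poissonSum_eq (z : ℂ) (X : Fin (g + 1) → OnePoint ℝ) :
    G.poissonSum z X = ∑ j, gapPoisson (G.a j) (G.b j) z (X j) := rfl

theorem ne_a_of_mem_gap {j : Fin (g + 1)} {x : ℝ} (hx : (x : OnePoint ℝ) ∈ G.gap j) :
    x ≠ G.a j := fun h => G.sqrtT_ne_zero_of_mem_gap hx (h ▸ G.sqrtT_endpt (Sum.inl j))

theorem ne_b_of_mem_gap {j : Fin (g + 1)} {x : ℝ} (hx : (x : OnePoint ℝ) ∈ G.gap j) :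
    x ≠ G.b j := fun h => G.sqrtT_ne_zero_of_mem_gap hx (h ▸ G.sqrtT_endpt (Sum.inr j))

theorem sqrtT_re_ne_zero_of_mem_gap {j : Fin (g + 1)} {x : ℝ} (hx : (x : OnePoint ℝ) ∈ G.gap j) :
    (G.sqrtT x).re ≠ 0 := fun h => G.sqrtT_ne_zero_of_mem_gap hx <| by
  rw [G.sqrtT_eq_ofReal_re (G.gap_subset_closedGap _ hx), h, Complex.ofReal_zero]

/-- The Jacobian matrix of the system at finite points of the gaps. -/
noncomputable def jacobianMatrix (z : ℂ) (x : Fin (g + 1) → ℝ) :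
    Matrix (Fin (g + 1)) (Fin (g + 1)) ℝ :=
  Matrix.of fun i j => Fin.lastCases (motive := fun _ => ℝ) (2 / ‖(x j : ℂ) - z‖ ^ 2)
    (fun k : Fin g => ∑ i : Fin g, G.omegaCoeff k i * (x j ^ (i : ℕ) / (G.sqrtT (x j)).re)) i

theorem hasFDerivAt_systemMap {z : ℂ} (hz : 0 < z.im) {x : Fin (g + 1) → ℝ}
    (hx : ∀ j, (x j : OnePoint ℝ) ∈ G.gap j) :
    HasFDerivAt (G.systemMap z)
      (LinearMap.toContinuousLinearMap (Matrix.toLin' (G.jacobianMatrix z x))) x := by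
  have h := hasFDerivAt_sum_apply (M := G.jacobianMatrix z x) (x := x)
    (φ := fun i j t => Fin.lastCases (motive := fun _ => ℝ)
      (gapPoisson (G.a j) (G.b j) z (t : OnePoint ℝ))
      (fun k : Fin g => G.omega k (t : OnePoint ℝ)) i) fun i j => by
    induction i using Fin.lastCases with
    | last =>
      simpa [jacobianMatrix] using
        hasDerivAt_gapPoisson hz (G.ne_a_of_mem_gap (hx j)) (G.ne_b_of_mem_gap (hx j))
    | cast k => simpa [jacobianMatrix] using G.hasDerivAt_omega k (hx j)
  refine h.congr_of_eventuallyEq (Filter.Eventually.of_forall fun y => ?_)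
  ext i
  induction i using Fin.lastCases with
  | last => simp [systemMap, poissonSum_eq]
  | cast k => simp [systemMap, harmonicSum]

theorem contDiffAt_systemMap {z : ℂ} (hz : 0 < z.im) {x : Fin (g + 1) → ℝ}
    (hx : ∀ j, (x j : OnePoint ℝ) ∈ G.gap j) : ContDiffAt ℝ 1 (G.systemMap z) x := by
  rw [contDiffAt_pi]
  have hp : ∀ j, ContDiffAt ℝ 1 (fun y : Fin (g + 1) → ℝ => y j) x :=
    fun j => (contDiff_apply ℝ ℝ j).contDiffAt
  intro i
  induction i using Fin.lastCases with
  | last =>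
    simp only [systemMap, Fin.snoc_last, poissonSum_eq]
    refine ContDiffAt.sum fun j _ => ?_
    exact (contDiffAt_gapPoisson hz (G.ne_a_of_mem_gap (hx j)) (G.ne_b_of_mem_gap (hx j))).comp
      (f := fun y : Fin (g + 1) → ℝ => (z, y j)) x (contDiffAt_const.prodMk (hp j))
  | cast k =>
    simp only [systemMap, Fin.snoc_castSucc, harmonicSum]
    refine ContDiffAt.sum fun j _ => ?_
    exact (G.contDiffAt_omega k (hx j)).comp (f := fun y : Fin (g + 1) → ℝ => y j) x (hp j)

theorem jacobian_eq {z : ℂ} (hz : 0 < z.im) {x : Fin (g + 1) → ℝ}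
    (hx : ∀ j, (x j : OnePoint ℝ) ∈ G.gap j) :
    G.jacobian z x = (G.jacobianMatrix z x).det := by
  rw [jacobian, (G.hasFDerivAt_systemMap hz hx).fderiv, ContinuousLinearMap.det,
    LinearMap.coe_toContinuousLinearMap, LinearMap.det_toLin']

/-- The first `g` rows are `omegaCoeff` times the rows `x_j ^ i / √T(x_j)`. Multiplying column `j`
by `√T(x_j)` clears these denominators and moves the root into the last row; the `2` comes from
integrating from both endpoints. -/
theorem det_jacobianMatrix_mul_prod {z : ℂ} {x : Fin (g + 1) → ℝ}
    (hx : ∀ j, (x j : OnePoint ℝ) ∈ G.gap j) :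
    (G.jacobianMatrix z x).det * ∏ j, (G.sqrtT (x j)).re =
      2 * G.omegaCoeff.det * G.poissonDet x z := by
  set s : Fin (g + 1) → ℝ := fun j => (G.sqrtT (x j)).re with hs
  have hs0 : ∀ j, s j ≠ 0 := fun j => G.sqrtT_re_ne_zero_of_mem_gap (hx j)
  set N : Matrix (Fin (g + 1)) (Fin (g + 1)) ℝ := Matrix.of fun i j =>
    if (i : ℕ) < g then x j ^ (i : ℕ) / s j else 2 / ‖(x j : ℂ) - z‖ ^ 2 with hN
  have h1 : (G.jacobianMatrix z x).det = G.omegaCoeff.det * N.det := by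
    refine det_snoc_mul _ (fun k j => ?_) fun j => ?_
    · simp [jacobianMatrix, hN, hs]
    · simp [jacobianMatrix, hN]
  have h2 : N.det * ∏ j, s j = 2 * G.poissonDet x z := by
    have h3 := Matrix.det_mul_row s N
    have h4 := Matrix.det_mul_column (fun i : Fin (g + 1) => if (i : ℕ) < g then (1 : ℝ) else 2)
      (Matrix.of fun i j : Fin (g + 1) =>
        if (i : ℕ) < g then x j ^ (i : ℕ) else s j / ‖(x j : ℂ) - z‖ ^ 2)
    rw [poissonDet, mul_comm, ← h3]
    have h5 : (2 : ℝ) = ∏ i : Fin (g + 1), if (i : ℕ) < g then (1 : ℝ) else 2 := by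
      rw [Fin.prod_univ_castSucc]; simp
    nth_rewrite 1 [h5]
    rw [← h4]
    congr 1
    ext i j
    simp only [Matrix.of_apply, hN]
    split_ifs
    · rw [one_mul, mul_div_cancel₀ _ (hs0 j)]
    · ring
  rw [h1, mul_assoc, h2]
  ring

theorem jacobian_mul_prod {z : ℂ} (hz : 0 < z.im) {x : Fin (g + 1) → ℝ}
    (hx : ∀ j, (x j : OnePoint ℝ) ∈ G.gap j) :
    (G.jacobian z x : ℂ) * ∏ j, G.sqrtT (x j) = (G.omegaCoeff.det : ℂ) *
      (Complex.I / (z.im : ℂ)) * (G.frakM x z - starRingEnd ℂ (G.frakM x z)) := by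
  have hx' := fun j => G.gap_subset_closedGap j (hx j)
  rw [← G.det_vandermondeType_eq_sub hx', G.det_vandermondeType hz.ne' hx', G.jacobian_eq hz hx]
  have h := congrArg (fun r : ℝ => (r : ℂ)) (G.det_jacobianMatrix_mul_prod (z := z) hx)
  simp only [Complex.ofReal_mul, Complex.ofReal_prod] at h
  have h2 : ∏ j, G.sqrtT (x j) = ∏ j, (((G.sqrtT (x j)).re : ℝ) : ℂ) :=
    prod_congr rfl fun j _ => G.sqrtT_eq_ofReal_re (hx' j)
  rw [h2, h]
  have hz' : (z.im : ℂ) ≠ 0 := by exact_mod_cast hz.ne'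
  field_simp
  push_cast
  linear_combination (2 * (G.omegaCoeff.det : ℂ) * (G.poissonDet x z : ℂ)) * Complex.I_mul_I

theorem jacobian_ne_zero {z : ℂ} (hz : 0 < z.im) {x : Fin (g + 1) → ℝ}
    (hx : ∀ j, (x j : OnePoint ℝ) ∈ G.gap j) : G.jacobian z x ≠ 0 := by
  intro h
  have h1 := G.det_jacobianMatrix_mul_prod (z := z) hx
  rw [← G.jacobian_eq hz hx, h, zero_mul] at h1
  exact mul_ne_zero (mul_ne_zero two_ne_zero G.det_omegaCoeff_ne_zero)
    (G.poissonDet_ne_zero hz.ne' (fun j => G.gap_subset_closedGap j (hx j)) ⟨0, hx 0⟩) h1.symm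

end Jacobian

end GapSystem

/-! ### Charts of the circles and the implicit function theorem -/

section Topological

open Filter

theorem circleInv_zero : circleInv 0 = OnePoint.infty := if_pos rfl

theorem circleInv_of_ne {ζ : ℝ} (h : ζ ≠ 0) : circleInv ζ = ((-ζ⁻¹ : ℝ) : OnePoint ℝ) := if_neg h

theorem tendsto_circleInv_cocompact :
    Tendsto circleInv (cocompact ℝ) (𝓝 ((0 : ℝ) : OnePoint ℝ)) := by
  have h0 : ∀ᶠ ζ : ℝ in cocompact ℝ, ζ ≠ 0 :=
    (isCompact_singleton (x := (0 : ℝ))).compl_mem_cocompact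
  have h1 : Tendsto (fun ζ : ℝ => -ζ⁻¹) (cocompact ℝ) (𝓝 0) := by
    simpa [Metric.cobounded_eq_cocompact] using (tendsto_inv₀_cobounded (α := ℝ)).neg
  refine (((OnePoint.continuous_coe.tendsto (0 : ℝ)).comp h1)).congr' ?_
  filter_upwards [h0] with ζ h
  rw [circleInv_of_ne h, Function.comp]

theorem continuous_circleInv : Continuous circleInv := by
  refine continuous_iff_continuousAt.2 fun ζ => ?_
  by_cases h : ζ = 0
  · subst h
    rw [continuousAt_iff_punctured_nhds, circleInv_zero]
    have h1 : Tendsto (fun ζ : ℝ => -ζ⁻¹) (𝓝[≠] 0) (coclosedCompact ℝ) := by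
      rw [coclosedCompact_eq_cocompact, ← Metric.cobounded_eq_cocompact]
      exact tendsto_neg_cobounded.comp tendsto_inv₀_nhdsNE_zero
    refine (OnePoint.tendsto_coe_infty.comp h1).congr' ?_
    filter_upwards [self_mem_nhdsWithin] with ζ h
    rw [circleInv_of_ne h, Function.comp]
  · have h1 : ContinuousAt (fun ζ : ℝ => ((-ζ⁻¹ : ℝ) : OnePoint ℝ)) ζ :=
      OnePoint.continuous_coe.continuousAt.comp (continuousAt_inv₀ h).neg
    refine h1.congr ?_
    filter_upwards [isOpen_ne.mem_nhds h] with ζ h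
    rw [circleInv_of_ne h]

/-- The involution `x ↦ -1 / x` of the circle `ℝ ∪ {∞}`. -/
noncomputable def circleInvHomeomorph : OnePoint ℝ ≃ₜ OnePoint ℝ :=
  have hinv : Function.Involutive fun x : OnePoint ℝ => x.elim ((0 : ℝ) : OnePoint ℝ) circleInv := by
    intro x
    induction x using OnePoint.rec with
    | infty => simp [circleInv_zero]
    | coe x =>
      by_cases h : x = 0
      · simp [h, circleInv_zero]
      · simp [circleInv_of_ne h, circleInv_of_ne (neg_ne_zero.2 (inv_ne_zero h))]
  have hc : Continuous fun x : OnePoint ℝ => x.elim ((0 : ℝ) : OnePoint ℝ) circleInv := by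
    rw [OnePoint.continuous_iff, coclosedCompact_eq_cocompact]
    exact ⟨tendsto_circleInv_cocompact, continuous_circleInv⟩
  { toEquiv := hinv.toPerm
    continuous_toFun := hc
    continuous_invFun := hc }

theorem isOpenEmbedding_circleInv : Topology.IsOpenEmbedding circleInv :=
  circleInvHomeomorph.isOpenEmbedding.comp OnePoint.isOpenEmbedding_coe

/-- A local solution of a system of equations, some of them modulo `1`, from an implicit function
in the coordinates `Φ`. -/
theorem exists_local_solution {m n : ℕ} {Y : Type*} [TopologicalSpace Y] {Φ : (Fin n → ℝ) → Y}
    (hΦ : Topology.IsOpenEmbedding Φ) {H : Fin m → Y → ℝ} {P : ℂ → Y → ℝ} {z₀ : ℂ} (hz₀ : 0 < z₀.im)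
    {y₀ : Fin n → ℝ} {O : Set Y} (hO : ∀ᶠ y in 𝓝 y₀, Φ y ∈ O)
    (hH : ∀ k, ContinuousAt (fun y => H k (Φ y)) y₀)
    {ψ : (Fin m → ℝ) × ℂ → Fin n → ℝ} (hψ₀ : ψ (fun k => H k (Φ y₀), z₀) = y₀)
    (hψ : ∀ᶠ v in 𝓝 (fun k => H k (Φ y₀), z₀), ContinuousAt ψ v)
    (hiff : ∀ᶠ v : ((Fin m → ℝ) × ℂ) × (Fin n → ℝ) in 𝓝 ((fun k => H k (Φ y₀), z₀), y₀),
      ((∀ k, H k (Φ v.2) = v.1.1 k) ∧ P v.1.2 (Φ v.2) = 0) ↔ ψ v.1 = v.2) :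
    ∃ (U : Set ((Fin m → UnitAddCircle) × ℂ)) (W : Set Y) (S : (Fin m → UnitAddCircle) × ℂ → Y),
      IsOpen U ∧ ((fun k => ((H k (Φ y₀) : ℝ) : UnitAddCircle)), z₀) ∈ U ∧ (∀ p ∈ U, 0 < p.2.im) ∧
      IsOpen W ∧ Φ y₀ ∈ W ∧ W ⊆ O ∧ ContinuousOn S U ∧
      S ((fun k => ((H k (Φ y₀) : ℝ) : UnitAddCircle)), z₀) = Φ y₀ ∧
      ∀ p ∈ U, ∀ X, (X ∈ W ∧ (∀ k, ((H k X : ℝ) : UnitAddCircle) = p.1 k) ∧ P p.2 X = 0) ↔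
        X = S p := by
  -- Each circle is parametrised by the interval of length one centred at the value `b k`, whose
  -- inverse chart lifts the data near the given point.
  set b : Fin m → ℝ := fun k => H k (Φ y₀) with hb
  set c : Fin m → OpenPartialHomeomorph ℝ UnitAddCircle := fun k =>
    AddCircle.openPartialHomeomorphCoe (1 : ℝ) (b k - 1 / 2) with hc
  have hsrc : ∀ k, (c k).source = Set.Ioo (b k - 1 / 2) (b k - 1 / 2 + 1) := fun k => rfl
  have hcoe : ∀ k (t : ℝ), c k t = (t : UnitAddCircle) := fun k t => rfl
  have hbs : ∀ k, b k ∈ (c k).source := fun k => by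
    rw [hsrc]; constructor <;> linarith
  set T : Set ((Fin m → UnitAddCircle) × ℂ) := {p | ∀ k, p.1 k ∈ (c k).target} with hT
  have hTo : IsOpen T := by
    rw [hT, Set.ofPred_forall]
    exact isOpen_iInter_of_finite fun k =>
      (c k).open_target.preimage ((continuous_apply k).comp continuous_fst)
  set Λ : (Fin m → UnitAddCircle) × ℂ → (Fin m → ℝ) × ℂ :=
    fun p => (fun k => (c k).symm (p.1 k), p.2) with hΛ
  have hΛc : ContinuousOn Λ T := by
    refine ContinuousOn.prodMk (continuousOn_pi.2 fun k => ?_) continuousOn_snd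
    exact (c k).continuousOn_symm.comp ((continuous_apply k).comp continuous_fst).continuousOn
      fun p hp => hp k
  have hΛ₀ : Λ (fun k => (b k : UnitAddCircle), z₀) = (b, z₀) := by
    refine Prod.ext (funext fun k => ?_) rfl
    exact (c k).left_inv (hbs k)
  have hT₀ : ((fun k => (b k : UnitAddCircle)), z₀) ∈ T := fun k => (c k).map_source (hbs k)
  have hys : ∀ᶠ y in 𝓝 y₀, ∀ k, H k (Φ y) ∈ (c k).source :=
    eventually_all.2 fun k => (hH k).eventually ((c k).open_source.mem_nhds (hbs k))
  rw [nhds_prod_eq] at hiff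
  obtain ⟨pV, hpV, pW, hpW, hVW⟩ := eventually_prod_iff.1 hiff
  -- On `W₀` the values of `H` stay in the chart intervals, so there a congruence modulo `1` is an
  -- equality with the lifted data.
  obtain ⟨W₀, hW₀, hW₀o, hyW₀⟩ := eventually_nhds_iff.1 ((hpW.and hO).and hys)
  have hψW : ∀ᶠ v in 𝓝 (b, z₀), ψ v ∈ W₀ :=
    hψ.self_of_nhds.eventually (by rw [hψ₀]; exact hW₀o.mem_nhds hyW₀)
  have him : ∀ᶠ v : (Fin m → ℝ) × ℂ in 𝓝 (b, z₀), 0 < v.2.im :=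
    (Complex.continuous_im.comp continuous_snd).continuousAt.eventually (lt_mem_nhds hz₀)
  obtain ⟨V, hV, hVo, hbV⟩ := eventually_nhds_iff.1 (((hpV.and hψ).and hψW).and him)
  refine ⟨T ∩ Λ ⁻¹' V, Φ '' W₀, fun p => Φ (ψ (Λ p)), hΛc.isOpen_inter_preimage hTo hVo,
    ⟨hT₀, by rw [Set.mem_preimage, hΛ₀]; exact hbV⟩, fun p hp => (hV _ hp.2).2,
    hΦ.isOpenMap _ hW₀o, Set.mem_image_of_mem _ hyW₀, ?_, ?_, ?_, ?_⟩
  · rintro _ ⟨y, hy, rfl⟩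
    exact (hW₀ y hy).1.2
  · refine hΦ.continuous.comp_continuousOn ?_
    refine ContinuousOn.comp (t := V) (fun v hv => (hV v hv).1.1.2.continuousWithinAt)
      (hΛc.mono Set.inter_subset_left) fun p hp => hp.2
  · exact congrArg Φ ((congrArg ψ hΛ₀).trans hψ₀)
  · rintro p ⟨hpT, hpV'⟩ X
    have hp := hV _ hpV'
    constructor
    · rintro ⟨⟨y, hy, rfl⟩, h1, h2⟩
      refine congrArg Φ ((hVW hp.1.1.1 (hW₀ y hy).1.1).1 ⟨fun k => ?_, h2⟩).symm
      simp only [hΛ]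
      rw [← h1 k, ← hcoe k, (c k).left_inv ((hW₀ y hy).2 k)]
    · rintro rfl
      have h := (hVW hp.1.1.1 (hW₀ _ hp.1.2).1.1).2 rfl
      refine ⟨Set.mem_image_of_mem _ hp.1.2, fun k => ?_, h.2⟩
      rw [h.1 k, ← hcoe k]
      exact (c k).right_inv (hpT k)

/-- The implicit function theorem for a `C¹` map on `ℝⁿ` depending on parameters, with
non-vanishing Jacobian determinant. -/
theorem exists_implicit_function {n : ℕ} {E : Type*} [NormedAddCommGroup E] [NormedSpace ℝ E]
    [CompleteSpace E] {f : E × (Fin n → ℝ) → Fin n → ℝ} {p₀ : E} {y₀ : Fin n → ℝ}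
    (hf : ContDiffAt ℝ 1 f (p₀, y₀)) {M : Matrix (Fin n) (Fin n) ℝ}
    (hM : HasFDerivAt (fun y => f (p₀, y)) (LinearMap.toContinuousLinearMap (Matrix.toLin' M)) y₀)
    (hdet : M.det ≠ 0) :
    ∃ ψ : E → Fin n → ℝ, ψ p₀ = y₀ ∧ (∀ᶠ v in 𝓝 p₀, ContinuousAt ψ v) ∧
      ∀ᶠ v in 𝓝 (p₀, y₀), f v = f (p₀, y₀) ↔ ψ v.1 = v.2 := by
  have h1 : fderiv ℝ f (p₀, y₀) ∘L .inr ℝ E (Fin n → ℝ) =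
      LinearMap.toContinuousLinearMap (Matrix.toLin' M) :=
    (((hf.differentiableAt one_ne_zero).hasFDerivAt).comp y₀
      (hasFDerivAt_prodMk_right p₀ y₀)).unique hM
  have hinv : (fderiv ℝ f (p₀, y₀) ∘L .inr ℝ E (Fin n → ℝ)).IsInvertible := by
    rw [h1]
    have hdet' : (LinearMap.toContinuousLinearMap (Matrix.toLin' M)).det ≠ 0 := by
      rwa [ContinuousLinearMap.det, LinearMap.coe_toContinuousLinearMap, LinearMap.det_toLin']
    exact ⟨ContinuousLinearMap.toContinuousLinearEquivOfDetNeZero _ hdet', by ext; simp⟩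
  refine ⟨hf.implicitFunction one_ne_zero hinv, hf.implicitFunction_apply_self one_ne_zero hinv,
    ?_, hf.eventually_apply_eq_iff_implicitFunction one_ne_zero hinv⟩
  exact ((hf.contDiffAt_implicitFunction one_ne_zero hinv).eventually (by simp)).mono
    fun v hv => hv.continuousAt

end Topological

theorem isOpen_openArc (p q : ℝ) : IsOpen (openArc p q) := by
  rw [openArc]
  split_ifs
  · exact OnePoint.isOpenEmbedding_coe.isOpenMap _ isOpen_Ioo
  · exact OnePoint.isOpen_compl_image_coe.2 ⟨isClosed_Icc, isCompact_Icc⟩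

namespace GapSystem

variable {g : ℕ} (G : GapSystem g)

/-! ### Local solvability of part (iii) -/

section Solvability

open Filter

/-- The local solvability statement near `X₀`. -/
def LocallySolvable (z₀ : ℂ) (X₀ : Fin (g + 1) → OnePoint ℝ) : Prop :=
  ∃ (U : Set ((Fin g → UnitAddCircle) × ℂ)) (W : Set (Fin (g + 1) → OnePoint ℝ))
    (S : (Fin g → UnitAddCircle) × ℂ → Fin (g + 1) → OnePoint ℝ),
    IsOpen U ∧ ((fun k => ((G.harmonicSum k X₀ : ℝ) : UnitAddCircle)), z₀) ∈ U ∧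
    (∀ p ∈ U, 0 < p.2.im) ∧ IsOpen W ∧ X₀ ∈ W ∧ (∀ X ∈ W, ∀ j, X j ∈ G.gap j) ∧
    ContinuousOn S U ∧ S ((fun k => ((G.harmonicSum k X₀ : ℝ) : UnitAddCircle)), z₀) = X₀ ∧
    ∀ p ∈ U, ∀ X, (X ∈ W ∧ G.IsSolution p.1 p.2 X) ↔ X = S p

/-- General charts `φ j` allow finite points and `x₀ = ∞` to be treated at once; only the
derivatives in the chart coordinates and their determinant enter. -/
theorem locallySolvable_of_charts {z₀ : ℂ} (hz₀ : 0 < z₀.im) {φ : Fin (g + 1) → ℝ → OnePoint ℝ}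
    (hφ : ∀ j, Topology.IsOpenEmbedding (φ j)) {y₀ : Fin (g + 1) → ℝ}
    (hgap : ∀ j, φ j (y₀ j) ∈ G.gap j) {D : Matrix (Fin (g + 1)) (Fin (g + 1)) ℝ}
    (hω : ∀ k j, HasDerivAt (fun y => G.omega k (φ j y)) (D (Fin.castSucc k) j) (y₀ j))
    (hω' : ∀ k j, ContDiffAt ℝ 1 (fun y => G.omega k (φ j y)) (y₀ j))
    (hP : ∀ j, HasDerivAt (fun y => gapPoisson (G.a j) (G.b j) z₀ (φ j y)) (D (Fin.last g) j)
      (y₀ j))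
    (hP' : ∀ j, ContDiffAt ℝ 1 (fun v : ℂ × ℝ => gapPoisson (G.a j) (G.b j) v.1 (φ j v.2))
      (z₀, y₀ j))
    (hD : D.det ≠ 0) (hsol : G.poissonSum z₀ (fun j => φ j (y₀ j)) = 0) :
    G.LocallySolvable z₀ fun j => φ j (y₀ j) := by
  -- The lifted data are parameters subtracted from the harmonic sums, so solutions are zeros of `f`
  -- and its partial derivative in the last variable is `D`.
  set f : ((Fin g → ℝ) × ℂ) × (Fin (g + 1) → ℝ) → Fin (g + 1) → ℝ := fun v =>
    Fin.snoc (α := fun _ => ℝ) (fun k : Fin g => G.harmonicSum k (fun j => φ j (v.2 j)) - v.1.1 k)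
      (G.poissonSum v.1.2 (fun j => φ j (v.2 j))) with hf
  set p₀ : (Fin g → ℝ) × ℂ := (fun k => G.harmonicSum k fun j => φ j (y₀ j), z₀) with hp₀
  have happ : ∀ j, ContDiffAt ℝ 1
      (fun v : ((Fin g → ℝ) × ℂ) × (Fin (g + 1) → ℝ) => v.2 j) (p₀, y₀) :=
    fun j => (contDiff_apply ℝ ℝ j).contDiffAt.comp _ contDiffAt_snd
  have hf1 : ContDiffAt ℝ 1 f (p₀, y₀) := by
    rw [contDiffAt_pi]
    intro i
    induction i using Fin.lastCases with
    | last =>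
      simp only [hf, Fin.snoc_last, poissonSum_eq]
      refine ContDiffAt.sum fun j _ => ?_
      exact (hP' j).comp (f := fun v : ((Fin g → ℝ) × ℂ) × (Fin (g + 1) → ℝ) => (v.1.2, v.2 j))
        (p₀, y₀) ((contDiffAt_snd.comp _ contDiffAt_fst).prodMk (happ j))
    | cast k =>
      simp only [hf, Fin.snoc_castSucc, harmonicSum]
      refine ContDiffAt.sub (ContDiffAt.sum fun j _ => ?_) ?_
      · exact (hω' k j).comp (f := fun v : ((Fin g → ℝ) × ℂ) × (Fin (g + 1) → ℝ) => v.2 j)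
          (p₀, y₀) (happ j)
      · exact (contDiff_apply ℝ ℝ k).contDiffAt.comp _ (contDiffAt_fst.comp _ contDiffAt_fst)
  have hf2 : HasFDerivAt (fun y => f (p₀, y))
      (LinearMap.toContinuousLinearMap (Matrix.toLin' D)) y₀ := by
    have h := (hasFDerivAt_sum_apply (M := D) (x := y₀)
      (φ := fun i j t => Fin.lastCases (motive := fun _ => ℝ)
        (gapPoisson (G.a j) (G.b j) z₀ (φ j t)) (fun k : Fin g => G.omega k (φ j t)) i)
      fun i j => by
        induction i using Fin.lastCases with
        | last => simpa using hP j
        | cast k => simpa using hω k j).sub_const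
      (Fin.snoc (α := fun _ => ℝ) p₀.1 0 : Fin (g + 1) → ℝ)
    refine h.congr_of_eventuallyEq (Eventually.of_forall fun y => ?_)
    ext i
    induction i using Fin.lastCases with
    | last => simp [hf, hp₀, poissonSum_eq]
    | cast k => simp [hf, hp₀, harmonicSum]
  have hf0 : f (p₀, y₀) = 0 := by
    ext i
    induction i using Fin.lastCases with
    | last => simpa [hf, hp₀] using hsol
    | cast k => simp [hf, hp₀]
  obtain ⟨ψ, hψ₀, hψ, hiff⟩ := exists_implicit_function hf1 hf2 hD
  have hΦ : Topology.IsOpenEmbedding (Pi.map φ) := Topology.IsOpenEmbedding.piMap hφ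
  have hO : ∀ᶠ y in 𝓝 y₀, Pi.map φ y ∈ {X | ∀ j, X j ∈ G.gap j} := by
    refine eventually_all.2 fun j => ?_
    exact ((hφ j).continuous.comp (continuous_apply j)).continuousAt.eventually
      ((isOpen_openArc _ _).mem_nhds (hgap j))
  have hH : ∀ k, ContinuousAt (fun y => G.harmonicSum k (Pi.map φ y)) y₀ := by
    intro k
    refine tendsto_finsetSum _ fun j _ => ?_
    exact (hω' k j).continuousAt.comp (f := fun y : Fin (g + 1) → ℝ => y j)
      (continuous_apply j).continuousAt
  have hiff' : ∀ᶠ v : ((Fin g → ℝ) × ℂ) × (Fin (g + 1) → ℝ) in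
      𝓝 ((fun k => G.harmonicSum k (Pi.map φ y₀), z₀), y₀),
      ((∀ k, G.harmonicSum k (Pi.map φ v.2) = v.1.1 k) ∧ G.poissonSum v.1.2 (Pi.map φ v.2) = 0) ↔
        ψ v.1 = v.2 := by
    refine hiff.mono fun v hv => ?_
    rw [← hv, hf0, funext_iff, Fin.forall_fin_succ']
    simp only [hf, Fin.snoc_castSucc, Fin.snoc_last, Pi.zero_apply, sub_eq_zero]
    rfl
  obtain ⟨U, W, S, hU, hmU, hpos, hW, hmW, hWO, hS, hS₀, hX⟩ :=
    exists_local_solution hΦ (P := G.poissonSum) hz₀ hO hH hψ₀ hψ hiff'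
  refine ⟨U, W, S, hU, hmU, hpos, hW, hmW, fun X h => hWO h, hS, hS₀, fun p hp X => ?_⟩
  rw [← hX p hp X]
  -- Points of `W` lie in the open gaps, so the closed-gap condition in `IsSolution` is automatic.
  exact and_congr_right fun h =>
    and_iff_right_of_imp (fun _ j => G.gap_subset_closedGap j (hWO h j))

/-- The Jacobian matrix in the coordinate `-1 / x₀` at `x₀ = ∞`. -/
noncomputable def jacobianMatrixInfty (z : ℂ) (x : Fin g → ℝ) :
    Matrix (Fin (g + 1)) (Fin (g + 1)) ℝ :=
  Matrix.of fun i j => Fin.lastCases (motive := fun _ => ℝ)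
    (Fin.cases (motive := fun _ => ℝ) 2 (fun j => 2 / ‖(x j : ℂ) - z‖ ^ 2) j)
    (fun k : Fin g => ∑ i : Fin g, G.omegaCoeff k i *
      Fin.cases (motive := fun _ => ℝ) (if (i : ℕ) + 1 = g then 1 else 0)
        (fun j => x j ^ (i : ℕ) / (G.sqrtT (x j)).re) j) i

/-- The configuration is completed by `a 0`. The negative factor `x j - a 0` is absorbed into `r`,
which produces the common minus sign needed for the determinant with a point at infinity. -/
theorem sqrtT_re_eq_of_mem_gap_succ {x : Fin g → ℝ}
    (hx : ∀ j, (x j : OnePoint ℝ) ∈ G.gap j.succ) (j : Fin g) :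
    ∃ r, 0 < r ∧ (G.sqrtT (x j)).re = -(r * ∏ k ∈ Finset.univ.erase j, (x j - x k)) := by
  set x' : Fin (g + 1) → ℝ := Fin.cons (α := fun _ => ℝ) (G.a 0) x with hx'
  have hmem : ∀ j, (x' j : OnePoint ℝ) ∈ G.closedGap j := by
    intro j
    induction j using Fin.cases with
    | zero => exact G.coe_a_mem_closedGap 0
    | succ j => exact G.gap_subset_closedGap _ (by simpa [hx'] using hx j)
  obtain ⟨r, -, hr, h⟩ := G.sqrtT_eq_of_mem_closedGap hmem j.succ
  have hxa : x j < G.a 0 := ((G.coe_mem_gap_succ j).1 (hx j)).2.trans (G.b_lt_a_zero _)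
  refine ⟨r * (G.a 0 - x j), mul_pos (hr (by simpa [hx'] using hx j)) (sub_pos.2 hxa), ?_⟩
  have hprod : ∏ k ∈ Finset.univ.erase j.succ, (x' j.succ - x' k) =
      (x j - G.a 0) * ∏ k ∈ Finset.univ.erase j, (x j - x k) := by
    have he : Finset.univ.erase j.succ =
        insert 0 ((Finset.univ.erase j).map (Fin.succEmb g)) := by
      ext k
      induction k using Fin.cases with
      | zero => simp [(Fin.succ_ne_zero j).symm]
      | succ k => simp
    rw [he, Finset.prod_insert (by simp), Finset.prod_map]
    simp [hx']
  rw [hprod] at h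
  have hside : G.side (x' 0) = 1 := by simp [hx', side]
  rw [hside] at h
  have h2 := congrArg Complex.re h
  rw [Complex.ofReal_re] at h2
  simp only [hx', Fin.cons_succ] at h2
  rw [h2]
  ring

/-- As at finite points, `omegaCoeff` is taken out and the finite columns are multiplied by
`√T(x_j)`. The column at infinity is left alone, its last entry `2` having the sign that prevents
cancellation. -/
theorem det_jacobianMatrixInfty_ne_zero {z : ℂ} {x : Fin g → ℝ}
    (hx : ∀ j, (x j : OnePoint ℝ) ∈ G.gap j.succ) : (G.jacobianMatrixInfty z x).det ≠ 0 := by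
  choose r hr hs using G.sqrtT_re_eq_of_mem_gap_succ hx
  set s : Fin g → ℝ := fun j => (G.sqrtT (x j)).re with hsdef
  have hs0 : ∀ j, s j ≠ 0 := fun j => G.sqrtT_re_ne_zero_of_mem_gap (hx j)
  have hinj : Function.Injective x := by
    have h := G.injective_of_mem_closedGap
      (x := Fin.cons (α := fun _ => ℝ) (G.a 0) x) fun j => by
        induction j using Fin.cases with
        | zero => exact G.coe_a_mem_closedGap 0
        | succ j => exact G.gap_subset_closedGap _ (by simpa using hx j)
    exact fun i j hij => Fin.succ_injective _ (h (by simpa using hij))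
  set N : Matrix (Fin (g + 1)) (Fin (g + 1)) ℝ := Matrix.of fun i j =>
    Fin.lastCases (motive := fun _ => ℝ)
    (Fin.cases (motive := fun _ => ℝ) 2 (fun j => 2 / ‖(x j : ℂ) - z‖ ^ 2) j)
    (fun i : Fin g => Fin.cases (motive := fun _ => ℝ) (if (i : ℕ) + 1 = g then 1 else 0)
        (fun j => x j ^ (i : ℕ) / s j) j) i with hN
  have h1 : (G.jacobianMatrixInfty z x).det = G.omegaCoeff.det * N.det :=
    det_snoc_mul _ (fun k j => by simp [jacobianMatrixInfty, hN, hsdef])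
      fun j => by simp [jacobianMatrixInfty, hN]
  have h2 := Matrix.det_mul_row (Fin.cons (α := fun _ => ℝ) 1 s : Fin (g + 1) → ℝ) N
  rw [h1]
  refine mul_ne_zero G.det_omegaCoeff_ne_zero fun h0 => ?_
  rw [h0, mul_zero] at h2
  refine det_powers_snoc_infty_ne_zero (w := fun j => 2 * r j / ‖(x j : ℂ) - z‖ ^ 2)
    (v := fun j => s j * (2 / ‖(x j : ℂ) - z‖ ^ 2)) (w₀ := 2) hinj two_pos (fun j => ?_)
    (fun j => ?_) (fun i j => ?_) (fun i => ?_) (fun j => ?_) ?_ h2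
  · simp only [hsdef, hs j]
    ring
  · have := (hr j).le
    positivity
  · simp [hN, mul_div_cancel₀ _ (hs0 j)]
  · simp [hN]
  · simp [hN]
  · simp [hN]

theorem locallySolvable {z₀ : ℂ} (hz₀ : 0 < z₀.im) {X₀ : Fin (g + 1) → OnePoint ℝ}
    (hX₀ : ∀ j, X₀ j ∈ G.gap j) (hsol : G.poissonSum z₀ X₀ = 0) : G.LocallySolvable z₀ X₀ := by
  have hfin : ∀ j : Fin g, ∃ x : ℝ, (x : OnePoint ℝ) = X₀ j.succ := fun j =>
    OnePoint.ne_infty_iff_exists.1 fun h => G.infty_notMem_gap_succ j (h ▸ hX₀ j.succ)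
  choose x hx using hfin
  have hxg : ∀ j, (x j : OnePoint ℝ) ∈ G.gap j.succ := fun j => (hx j).symm ▸ hX₀ j.succ
  rcases eq_or_ne (X₀ 0) OnePoint.infty with h0 | h0
  -- Only the gap of index `0` contains infinity, so only the first coordinate needs the chart
  -- `-1/ζ`.
  · set φ : Fin (g + 1) → ℝ → OnePoint ℝ :=
      Fin.cons (α := fun _ => ℝ → OnePoint ℝ) circleInv (fun _ t => (t : OnePoint ℝ)) with hφ
    set y : Fin (g + 1) → ℝ := Fin.cons (α := fun _ => ℝ) 0 x with hy
    have hX : X₀ = fun j => φ j (y j) := by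
      funext j
      induction j using Fin.cases with
      | zero => simp [hφ, hy, h0, circleInv_zero]
      | succ j => simp [hφ, hy, hx]
    rw [hX] at hX₀ hsol ⊢
    refine G.locallySolvable_of_charts hz₀ (D := G.jacobianMatrixInfty z₀ x) (fun j => ?_) hX₀
      (fun k j => ?_) (fun k j => ?_) (fun j => ?_) (fun j => ?_)
      (G.det_jacobianMatrixInfty_ne_zero hxg) hsol
    all_goals induction j using Fin.cases with
      | zero => ?_
      | succ j => ?_
    · exact isOpenEmbedding_circleInv
    · exact OnePoint.isOpenEmbedding_coe
    · exact ((G.omega_circleInv k).1).congr_deriv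
        (by simp [jacobianMatrixInfty])
    · exact (G.hasDerivAt_omega k (hxg j)).congr_deriv
        (by simp [jacobianMatrixInfty])
    · exact (G.omega_circleInv k).2
    · exact G.contDiffAt_omega k (hxg j)
    · exact (hasDerivAt_gapPoisson_circleInv hz₀ (G.a 0) (G.b 0)).congr_deriv
        (by simp [jacobianMatrixInfty])
    · exact (hasDerivAt_gapPoisson hz₀ (G.ne_a_of_mem_gap (hxg j))
        (G.ne_b_of_mem_gap (hxg j))).congr_deriv (by simp [jacobianMatrixInfty])
    · exact contDiffAt_gapPoisson_circleInv hz₀ (G.a 0) (G.b 0)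
    · exact contDiffAt_gapPoisson hz₀ (G.ne_a_of_mem_gap (hxg j)) (G.ne_b_of_mem_gap (hxg j))
  · obtain ⟨x₀, hx₀⟩ := OnePoint.ne_infty_iff_exists.1 h0
    set y : Fin (g + 1) → ℝ := Fin.cons (α := fun _ => ℝ) x₀ x with hy
    have hX : X₀ = fun j => (y j : OnePoint ℝ) := by
      funext j
      induction j using Fin.cases with
      | zero => simp [hy, hx₀]
      | succ j => simp [hy, hx]
    rw [hX] at hX₀ hsol ⊢
    refine G.locallySolvable_of_charts hz₀ (D := G.jacobianMatrix z₀ y)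
      (φ := fun _ t => (t : OnePoint ℝ)) (fun j => OnePoint.isOpenEmbedding_coe) hX₀
      (fun k j => ?_) (fun k j => G.contDiffAt_omega k (hX₀ j)) (fun j => ?_)
      (fun j => contDiffAt_gapPoisson hz₀ (G.ne_a_of_mem_gap (hX₀ j)) (G.ne_b_of_mem_gap (hX₀ j)))
      (G.jacobian_eq hz₀ hX₀ ▸ G.jacobian_ne_zero hz₀ hX₀) hsol
    · simpa [jacobianMatrix] using G.hasDerivAt_omega k (hX₀ j)
    · simpa [jacobianMatrix] using
        hasDerivAt_gapPoisson hz₀ (G.ne_a_of_mem_gap (hX₀ j)) (G.ne_b_of_mem_gap (hX₀ j))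

end Solvability

end GapSystem

theorem mainTheorem12 {g : ℕ} (G : GapSystem g) :
    -- the Vandermonde-type determinant
    (∀ (z : ℂ) (x : Fin (g + 1) → ℝ), 0 < z.im → (∀ j, (x j : OnePoint ℝ) ∈ G.closedGap j) →
      (G.vandermondeType x z).det = G.frakM x z - starRingEnd ℂ (G.frakM x z) ∧
      ((∃ j, (x j : OnePoint ℝ) ∈ G.gap j) → (G.vandermondeType x z).det ≠ 0)) ∧
    -- the Jacobian of the system
    (∃ C : ℝ, C ≠ 0 ∧
      ∀ (z : ℂ) (x : Fin (g + 1) → ℝ), 0 < z.im → (∀ j, (x j : OnePoint ℝ) ∈ G.gap j) →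
        ContDiffAt ℝ 1 (G.systemMap z) x ∧
        (G.jacobian z x : ℂ) * ∏ j, G.sqrtT (x j) =
          (C : ℂ) * (Complex.I / (z.im : ℂ)) * (G.frakM x z - starRingEnd ℂ (G.frakM x z)) ∧
        G.jacobian z x ≠ 0) ∧
    -- local solvability
    (∀ (β₀ : Fin g → UnitAddCircle) (z₀ : ℂ) (X₀ : Fin (g + 1) → OnePoint ℝ),
      0 < z₀.im → (∀ j, X₀ j ∈ G.gap j) → G.IsSolution β₀ z₀ X₀ →
      ∃ (U : Set ((Fin g → UnitAddCircle) × ℂ)) (W : Set (Fin (g + 1) → OnePoint ℝ))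
        (S : (Fin g → UnitAddCircle) × ℂ → Fin (g + 1) → OnePoint ℝ),
        IsOpen U ∧ (β₀, z₀) ∈ U ∧ (∀ p ∈ U, 0 < p.2.im) ∧
        IsOpen W ∧ X₀ ∈ W ∧ (∀ X ∈ W, ∀ j, X j ∈ G.gap j) ∧
        ContinuousOn S U ∧ S (β₀, z₀) = X₀ ∧
        ∀ p ∈ U, ∀ X, (X ∈ W ∧ G.IsSolution p.1 p.2 X) ↔ X = S p) := by
  refine ⟨fun z x hz hx => ⟨G.det_vandermondeType_eq_sub hx,
    fun hx' => G.det_vandermondeType_ne_zero hz.ne' hx hx'⟩,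
    ⟨G.omegaCoeff.det, G.det_omegaCoeff_ne_zero, fun z x hz hx =>
      ⟨G.contDiffAt_systemMap hz hx, G.jacobian_mul_prod hz hx, G.jacobian_ne_zero hz hx⟩⟩, ?_⟩
  intro β₀ z₀ X₀ hz₀ hX₀ hsol
  -- The local statement is centred at the data computed from `X₀`, which are `β₀` because `X₀` is a
  -- solution.
  have hβ : (fun k => ((G.harmonicSum k X₀ : ℝ) : UnitAddCircle)) = β₀ := funext hsol.2.1
  have h := G.locallySolvable hz₀ hX₀ hsol.2.2
  rw [GapSystem.LocallySolvable, hβ] at h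
  exact h
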